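/- Let $G$ be a crystallographic group of $\mathbb{R}^3$ (a group of isometries) belonging to one of the following eleven affine conjugacy classes, listed with their numbers in the International Tables: the orthorhombic groups $Pnnn$ (48), $Pnna$ (52), $Pccn$ (56), $Pcca$ (54) (with the vertical axis listed first: $P\frac2n\frac2n\frac2n$, $P\frac2a\frac2n\frac{2_1}n$, $P\frac2n\frac{2_1}c\frac{2_1}c$, $P\frac2a\frac{2_1}c\frac2c$), and the tetragonal groups $P4_2/n$ (86), $P4_222$ (93), $P4_22_12$ (94), $P\bar42c$ (112), $P\bar42_1c$ (114), $P\bar4c2$ (116), $P\bar4n2$ (118). Call vertical the direction of the third (principal) axis in the standard setting, and horizontal the planes orthogonal to it. Let $v$ be a shortest vertical translation vector of $G$, and let $G_0\le G$ be the subgroup of horizontal motions, i.e. of those elements that map every horizontal plane to itself. Then: 1. $G$ has 8 aspects: its translation subgroup has index 8. 2. $G_0$ is of type $p2$ with rectangular grid: there are orthogonal nonzero horizontal vectors $a,b$ and a point $O$ such that $G_0$ is generated by the translations by $a$ and $b$ and the half-turn about the vertical line through $O$. The order-two rotation axes of $G_0$ are the vertical lines through the points $O+\frac m2a+\frac n2b$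 $(m,n\in\mathbb{Z})$, and they cut each horizontal plane into elementary rectangles. The reflection in every vertical plane containing an edge of an elementary rectangle lies in the normalizer of $G$ in the isometry group of $\mathbb{R}^3$. 3. Call $P\in\mathbb{R}^3$ generic if it lies over the interior of an elementary rectangle and every $g\in G$ for which $gP$ and $P$ are at the same height belongs to $G_0$; generic points form an open dense set. For generic $P$ let $Z_P$ be the closed band between the horizontal planes through $P+v$ and $P-v$. Apart from these two planes and the one through $P$, exactly six horizontal planes in $Z_P$ contain points of the orbit $GP$, and each of them meets $GP$ in a single $G_0$-orbit. Call a point white if it lies over the interior of an elementary rectangle in the $G_0$-orbit of the rectangle over which $P$ lies, and black if it lies over the interior of an elementary rectangle outside that orbit. Then on exactly four of the six planes all points of $GP$ are black, and on exactly two of them all points of $GP$ are white. 4. For every $P\in\mathbb{R}^3$ the Dirichlet stereohedron of $G$ with base point $P$, that is, the closed Voronoi region of $P$ in the Voronoi diagram of the orbit $GP$, has at most 38 facets. -/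

import Mathlib

noncomputable section

namespace Stereohedra

/-- Euclidean 3-space. -/
abbrev E3 : Type := EuclideanSpace ℝ (Fin 3)

/-- The group of isometries of Euclidean 3-space. -/
abbrev Isom3 : Type := E3 ≃ᵃⁱ[ℝ] E3

/-! ### The eleven affine classes of crystallographic groups -/

/-- The eleven types, four orthorhombic and seven tetragonal. For the orthorhombic ones we use the
standard international symbols (numbers 48, 52, 56, 54), with the third axis vertical; listing the
vertical axis first, these are `P 2/n 2/n 2/n`, `P 2/a 2/n 2₁/n`, `P 2/n 2₁/c 2₁/c` and
`P 2/a 2₁/c 2/c`. The tetragonal ones are numbers 86, 93, 94, 112, 114, 116, 118. -/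
inductive GroupType
  | Pnnn
  | Pnna
  | Pccn
  | Pcca
  | P4₂n
  | P4₂22
  | P4₂2₁2
  | Pbar42c
  | Pbar42₁c
  | Pbar4c2
  | Pbar4n2

/-- Generators of each group modulo the unit translations, as maps `(x, y, z) ↦ …` (one of the
standard origin choices of the International Tables). -/
def GroupType.generators : GroupType → Set (E3 → E3)
  | .Pnnn => {fun p => !₂[-p 0, -p 1, p 2], fun p => !₂[-p 0, p 1, -p 2],
      fun p => !₂[-p 0 + 1/2, -p 1 + 1/2, -p 2 + 1/2]}
  | .Pnna => {fun p => !₂[-p 0 + 1/2, -p 1, p 2], fun p => !₂[-p 0 + 1/2, p 1 + 1/2, -p 2 + 1/2],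
      fun p => !₂[-p 0, -p 1, -p 2]}
  | .Pccn => {fun p => !₂[-p 0 + 1/2, -p 1 + 1/2, p 2], fun p => !₂[-p 0, p 1 + 1/2, -p 2 + 1/2],
      fun p => !₂[-p 0, -p 1, -p 2]}
  | .Pcca => {fun p => !₂[-p 0 + 1/2, -p 1, p 2], fun p => !₂[-p 0, p 1, -p 2 + 1/2],
      fun p => !₂[-p 0, -p 1, -p 2]}
  | .P4₂n => {fun p => !₂[-p 1, p 0 + 1/2, p 2 + 1/2], fun p => !₂[-p 0, -p 1, -p 2]}
  | .P4₂22 => {fun p => !₂[-p 1, p 0, p 2 + 1/2], fun p => !₂[-p 0, p 1, -p 2]}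
  | .P4₂2₁2 => {fun p => !₂[-p 1 + 1/2, p 0 + 1/2, p 2 + 1/2],
      fun p => !₂[-p 0 + 1/2, p 1 + 1/2, -p 2 + 1/2]}
  | .Pbar42c => {fun p => !₂[p 1, -p 0, -p 2], fun p => !₂[-p 0, p 1, -p 2 + 1/2]}
  | .Pbar42₁c => {fun p => !₂[p 1, -p 0, -p 2], fun p => !₂[-p 0 + 1/2, p 1 + 1/2, -p 2 + 1/2]}
  | .Pbar4c2 => {fun p => !₂[p 1, -p 0, -p 2], fun p => !₂[p 0, -p 1, p 2 + 1/2]}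
  | .Pbar4n2 => {fun p => !₂[p 1, -p 0, -p 2], fun p => !₂[p 0 + 1/2, -p 1 + 1/2, p 2 + 1/2]}

/-- The unit translations along the three coordinate axes. -/
def unitTranslations : Set (E3 → E3) :=
  {fun p => !₂[p 0 + 1, p 1, p 2], fun p => !₂[p 0, p 1 + 1, p 2], fun p => !₂[p 0, p 1, p 2 + 1]}

/-- The standard representative of each type, as a group of affine maps of 3-space. -/
def GroupType.standardGroup (t : GroupType) : Subgroup (E3 ≃ᵃ[ℝ] E3) :=
  Subgroup.closure {g | ⇑g ∈ unitTranslations ∪ t.generators}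

/-- `G` is a crystallographic group of type `t`, the affine map `φ` being a conjugation from the
standard representative: `G = φ ∘ (standard group) ∘ φ⁻¹`. -/
def IsOfType (G : Subgroup Isom3) (t : GroupType) (φ : E3 ≃ᵃ[ℝ] E3) : Prop :=
  ∀ s : E3 ≃ᵃ[ℝ] E3, s ∈ t.standardGroup ↔ ∃ g ∈ G, ∀ x, g (φ x) = φ (s x)

/-- The vertical vector of a group of type `t` with conjugating map `φ`: the image of the third
basis vector, which spans the principal axis. -/
def verticalVector (φ : E3 ≃ᵃ[ℝ] E3) : E3 := φ.linear (EuclideanSpace.single 2 1)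

/-! ### Orbits, translations, aspects -/

/-- The translation by `w`. -/
abbrev translation (w : E3) : Isom3 := AffineIsometryEquiv.constVAdd ℝ E3 w

/-- The orbit `GP`. -/
def orbit (G : Subgroup Isom3) (P : E3) : Set E3 := {Q | ∃ g ∈ G, g P = Q}

/-- The subgroup of all translations of 3-space. -/
def allTranslations : Subgroup Isom3 where
  carrier := {g | ∃ w : E3, ∀ x, g x = w + x}
  one_mem' := ⟨0, fun x => by simp⟩
  mul_mem' := by
    rintro f g ⟨u, hu⟩ ⟨w, hw⟩
    exact ⟨u + w, fun x => by
      rw [AffineIsometryEquiv.coe_mul, Function.comp_apply, hw, hu, add_assoc]⟩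
  inv_mem' := by
    rintro g ⟨w, hw⟩
    refine ⟨-w, fun x => ?_⟩
    apply g.injective
    have h : g (g⁻¹ x) = x := g.apply_symm_apply x
    rw [h, hw]
    simp

/-- The number of aspects: the index in `G` of its translational subgroup (`0` if infinite). -/
def aspects (G : Subgroup Isom3) : ℕ := allTranslations.relIndex G

/-- `v` is a shortest translation vector of `G` in its direction. -/
def IsShortestTranslation (G : Subgroup Isom3) (v : E3) : Prop :=
  v ≠ 0 ∧ ∀ c : ℝ, translation (c • v) ∈ G ↔ ∃ k : ℤ, c = k

/-! ### Horizontal motions and planar groups `p2` with rectangular grid -/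

/-- The horizontal plane (orthogonal to `v`) through `Q`. -/
def horizontalPlane (v Q : E3) : AffineSubspace ℝ E3 := AffineSubspace.mk' Q (ℝ ∙ v)ᗮ

/-- The subgroup of horizontal motions of `G`: those sending every horizontal plane to itself. -/
def horizontalSubgroup (G : Subgroup Isom3) (v : E3) : Subgroup Isom3 where
  carrier := {g | g ∈ G ∧ ∀ x, inner ℝ (g x) v = inner ℝ x v}
  one_mem' := ⟨G.one_mem, fun x => by simp⟩
  mul_mem' := by
    rintro f g ⟨hf, hf'⟩ ⟨hg, hg'⟩
    exact ⟨G.mul_mem hf hg, fun x => by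
      rw [AffineIsometryEquiv.coe_mul, Function.comp_apply, hf', hg']⟩
  inv_mem' := by
    rintro g ⟨hg, hg'⟩
    refine ⟨G.inv_mem hg, fun x => ?_⟩
    have h : g (g⁻¹ x) = x := g.apply_symm_apply x
    rw [← hg' (g⁻¹ x), h]

/-- The half-turn (rotation of order two) about the line through `O` in direction `v`. -/
def halfTurn (O v : E3) : Isom3 := EuclideanGeometry.reflection (AffineSubspace.mk' O (ℝ ∙ v))

/-- The reflection in the plane through `O` orthogonal to `w`. -/
def planeReflection (O w : E3) : Isom3 :=
  EuclideanGeometry.reflection (AffineSubspace.mk' O (ℝ ∙ w)ᗮ)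

/-- `G₀` is a group of horizontal motions of type `p2` with rectangular grid: it is generated by
translations along two orthogonal horizontal vectors `a`, `b` and by a half-turn about the vertical
line through `O`. Its centers of order two are then the vertical lines through the points
`O + (m/2) a + (n/2) b`. -/
def IsRectangularP2 (G₀ : Subgroup Isom3) (v O a b : E3) : Prop :=
  a ≠ 0 ∧ b ≠ 0 ∧ inner ℝ a v = 0 ∧ inner ℝ b v = 0 ∧ inner ℝ a b = 0 ∧
    G₀ = Subgroup.closure {translation a, translation b, halfTurn O v}

/-- The set of points lying over the interior of the elementary rectangle with opposite corners
`O + (m/2) a + (n/2) b` and `O + ((m+1)/2) a + ((n+1)/2) b`. -/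
def overRectangle (O a b : E3) (m n : ℤ) : Set E3 :=
  {x | (m : ℝ) / 2 < inner ℝ (x - O) a / ‖a‖ ^ 2 ∧ inner ℝ (x - O) a / ‖a‖ ^ 2 < ((m : ℝ) + 1) / 2 ∧
    (n : ℝ) / 2 < inner ℝ (x - O) b / ‖b‖ ^ 2 ∧ inner ℝ (x - O) b / ‖b‖ ^ 2 < ((n : ℝ) + 1) / 2}

/-- `Q` is white with respect to the base point `P`: it lies over (the interior of) an elementary
rectangle in the same `G₀`-orbit of rectangles as the one below `P`. -/
def IsWhite (G₀ : Subgroup Isom3) (O a b P Q : E3) : Prop :=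
  ∃ m n m' n' : ℤ, P ∈ overRectangle O a b m n ∧ Q ∈ overRectangle O a b m' n' ∧
    ∃ g ∈ G₀, g '' overRectangle O a b m n = overRectangle O a b m' n'

/-- `Q` is black with respect to the base point `P`: it lies over (the interior of) an elementary
rectangle not in the `G₀`-orbit of the one below `P`. -/
def IsBlack (G₀ : Subgroup Isom3) (O a b P Q : E3) : Prop :=
  ∃ m n m' n' : ℤ, P ∈ overRectangle O a b m n ∧ Q ∈ overRectangle O a b m' n' ∧
    ∀ g ∈ G₀, g '' overRectangle O a b m n ≠ overRectangle O a b m' n'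

/-! ### The band around the base point -/

/-- The closed band bounded by the horizontal planes through `P + v` and `P - v`. -/
def band (v P : E3) : Set E3 := {x | |inner ℝ (x - P) v| ≤ ‖v‖ ^ 2}

/-- The horizontal planes contained in the band, other than the two boundary planes and the middle
one, that contain points of the orbit `GP`. -/
def orbitPlanes (G : Subgroup Isom3) (v P : E3) : Set (AffineSubspace ℝ E3) :=
  {α | (∃ Q ∈ orbit G P, α = horizontalPlane v Q) ∧ (α : Set E3) ⊆ band v P ∧
    α ≠ horizontalPlane v P ∧ α ≠ horizontalPlane v (P + v) ∧ α ≠ horizontalPlane v (P - v)}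

/-- Generic base points: they lie over no edge of the grid, and only horizontal motions of `G` keep
them at the same height. -/
def IsGeneric (G : Subgroup Isom3) (v O a b P : E3) : Prop :=
  (∃ m n : ℤ, P ∈ overRectangle O a b m n) ∧
    ∀ g ∈ G, inner ℝ (g P) v = inner ℝ P v → g ∈ horizontalSubgroup G v

/-! ### Dirichlet stereohedra and their facets -/

/-- The Dirichlet stereohedron of `G` with base point `P`: the closed Voronoi region of `P` in the
Voronoi diagram of the orbit `GP`. -/
def dirichletStereohedron (G : Subgroup Isom3) (P : E3) : Set E3 :=
  {x | ∀ Q ∈ orbit G P, dist x P ≤ dist x Q}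

/-- The facets of a convex set in 3-space: its exposed faces of affine dimension two. -/
def facets (K : Set E3) : Set (Set E3) :=
  {F | IsExposed ℝ K F ∧ Module.finrank ℝ (vectorSpan ℝ F) = 2}

end Stereohedra

end

noncomputable section

namespace Stereohedra

/-! ### Grid motions and their classes -/

/-! Choose a vertical half-turn axis as origin and double the coordinates, so that elementary
rectangles become unit squares and the shortest vertical translation has height 2. All eleven groups
then consist of signed permutations of the coordinates with integral shifts. Modulo the planar group
`p2` of horizontal motions only a finite class of the horizontal part survives. The vertical part `z
↦ e z + k` determines this class through `e` and `k` mod 2, so a group is a homomorphism `D` from a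
Klein four-group to `GridClass`. The frame `IsGridFrame` records this data. Everything after
`IsOfType.exists_isGridFrame` uses the frame only, and the eleven cases enter through the finite
checks on `GroupType.classes`.

The aspects, the shortness of `v`, the type of the horizontal subgroup and its normalizing
reflections are read off from `D`. For the colours, a motion keeps or exchanges the two colours of
the chessboard of unit squares, according to `GridClass.colour`. Of the three nontrivial values of
`D`, two exchange the colours and one keeps them. A generic height has six images strictly less than
2 away and different from itself: `z ± 1`, and `-z + k` for four consecutive `k`. Each nontrivial
value of `D` occurs twice among them, which gives four black planes and two white ones
(`sum_levels`).

For the bound, a facet lies in the bisector of `P` and a single orbit point `Q`, and some point `x`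
of the facet is strictly farther from all other orbit points (`exists_strictNeighbour_of_facet`). So
it suffices to count such `Q`. The points `P ± v` account for at most 2. The horizontal orbit of `P`
accounts for at most 6, since a planar cell of a `p2` orbit has at most six sides
(`encard_horizontal_le`). Any other `Q` lies in one of the six layers. The witness `x` belongs to
the planar cells of both `P` and `Q`, taken in their own horizontal orbits. Such a cell lies in the
cross made of the point's unit square and its four neighbours (`inCross_of_labelDist`). Crosses that
meet have close centres, and the colour fixes the parity of the offset. This leaves at most 4
candidates in a black layer and 7 in a white one (`encard_layer_le`), so the total is 2 + 6 + 4·4 +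
2·7 = 38. Base points over grid corners have non-unique labels and are treated separately. -/

/-- Classes of rectangular-grid symmetries modulo the group `p2` of the grid: whether the two axes
are interchanged, the product of the two signs, and the parities of the two shifts. -/
abbrev GridClass : Type := Bool × ℤˣ × ZMod 2 × ZMod 2

/-- Composition of grid classes. -/
def GridClass.comp (c d : GridClass) : GridClass :=
  (xor c.1 d.1, c.2.1 * d.2.1, c.2.2.1 + (if c.1 then d.2.2.2 else d.2.2.1),
    c.2.2.2 + (if c.1 then d.2.2.1 else d.2.2.2))

/-- The colour of a grid class: `0` if it preserves the chessboard colouring of the grid, `1` if it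
interchanges the colours. -/
def GridClass.colour (c : GridClass) : ZMod 2 :=
  c.2.2.1 + c.2.2.2 + if c.2.1 = 1 then 0 else 1

/-- A symmetry of the cubic grid that preserves the vertical direction, as a signed permutation of
the coordinates followed by an integral shift. -/
structure GridMotion where
  swap : Bool
  e₁ : ℤˣ
  e₂ : ℤˣ
  e₃ : ℤˣ
  k₁ : ℤ
  k₂ : ℤ
  k₃ : ℤ

namespace GridMotion

/-- The class of the horizontal part. -/
def cls (M : GridMotion) : GridClass := (M.swap, M.e₁ * M.e₂, (M.k₁ : ZMod 2), (M.k₂ : ZMod 2))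

/-- The horizontal class of `M` is the one that `D` assigns to the vertical part of `M`. -/
def IsIn (D : ℤˣ → ZMod 2 → GridClass) (M : GridMotion) : Prop := M.cls = D M.e₃ (M.k₃ : ZMod 2)

instance (D : ℤˣ → ZMod 2 → GridClass) (M : GridMotion) : Decidable (M.IsIn D) :=
  inferInstanceAs (Decidable (M.cls = D M.e₃ (M.k₃ : ZMod 2)))

/-- First coordinate of the image of a point. -/
def act₁ (M : GridMotion) (x y : ℝ) : ℝ := ((M.e₁ : ℤ) : ℝ) * (if M.swap then y else x) + M.k₁

/-- Second coordinate of the image of a point. -/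
def act₂ (M : GridMotion) (x y : ℝ) : ℝ := ((M.e₂ : ℤ) : ℝ) * (if M.swap then x else y) + M.k₂

/-- Third coordinate of the image of a point. -/
def act₃ (M : GridMotion) (z : ℝ) : ℝ := ((M.e₃ : ℤ) : ℝ) * z + M.k₃

/-- Composition of grid motions. -/
def comp (M N : GridMotion) : GridMotion where
  swap := xor M.swap N.swap
  e₁ := M.e₁ * (if M.swap then N.e₂ else N.e₁)
  e₂ := M.e₂ * (if M.swap then N.e₁ else N.e₂)
  e₃ := M.e₃ * N.e₃
  k₁ := M.e₁ * (if M.swap then N.k₂ else N.k₁) + M.k₁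
  k₂ := M.e₂ * (if M.swap then N.k₁ else N.k₂) + M.k₂
  k₃ := M.e₃ * N.k₃ + M.k₃

/-- Inverse of a grid motion. -/
def inverse (M : GridMotion) : GridMotion where
  swap := M.swap
  e₁ := if M.swap then M.e₂ else M.e₁
  e₂ := if M.swap then M.e₁ else M.e₂
  e₃ := M.e₃
  k₁ := if M.swap then -(M.e₂ * M.k₂) else -(M.e₁ * M.k₁)
  k₂ := if M.swap then -(M.e₁ * M.k₁) else -(M.e₂ * M.k₂)
  k₃ := -(M.e₃ * M.k₃)

theorem act₁_comp (M N : GridMotion) (x y : ℝ) :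
    (M.comp N).act₁ x y = M.act₁ (N.act₁ x y) (N.act₂ x y) := by
  obtain ⟨s, e₁, e₂, e₃, k₁, k₂, k₃⟩ := M
  obtain ⟨s', f₁, f₂, f₃, l₁, l₂, l₃⟩ := N
  cases s <;> cases s' <;> simp [act₁, act₂, comp] <;> ring

theorem act₂_comp (M N : GridMotion) (x y : ℝ) :
    (M.comp N).act₂ x y = M.act₂ (N.act₁ x y) (N.act₂ x y) := by
  obtain ⟨s, e₁, e₂, e₃, k₁, k₂, k₃⟩ := M
  obtain ⟨s', f₁, f₂, f₃, l₁, l₂, l₃⟩ := N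
  cases s <;> cases s' <;> simp [act₁, act₂, comp] <;> ring

theorem act₃_comp (M N : GridMotion) (z : ℝ) :
    (M.comp N).act₃ z = M.act₃ (N.act₃ z) := by
  simp [act₃, comp]; ring

theorem act₁_inverse (M : GridMotion) (x y : ℝ) :
    M.inverse.act₁ (M.act₁ x y) (M.act₂ x y) = x := by
  obtain ⟨s, e₁, e₂, e₃, k₁, k₂, k₃⟩ := M
  rcases Int.units_eq_one_or e₁ with rfl | rfl <;> rcases Int.units_eq_one_or e₂ with rfl | rfl <;>
    cases s <;> simp [act₁, act₂, inverse]

theorem act₂_inverse (M : GridMotion) (x y : ℝ) :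
    M.inverse.act₂ (M.act₁ x y) (M.act₂ x y) = y := by
  obtain ⟨s, e₁, e₂, e₃, k₁, k₂, k₃⟩ := M
  rcases Int.units_eq_one_or e₁ with rfl | rfl <;> rcases Int.units_eq_one_or e₂ with rfl | rfl <;>
    cases s <;> simp [act₁, act₂, inverse]

theorem act₃_inverse (M : GridMotion) (z : ℝ) : M.inverse.act₃ (M.act₃ z) = z := by
  obtain ⟨s, e₁, e₂, e₃, k₁, k₂, k₃⟩ := M
  rcases Int.units_eq_one_or e₃ with rfl | rfl <;> simp [act₃, inverse]

theorem zmod_two_units_mul (e : ℤˣ) (k : ZMod 2) : (((e : ℤ) : ZMod 2)) * k = k := by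
  rcases Int.units_eq_one_or e with rfl | rfl
  · simp
  · revert k; decide

/-- Passing to classes is multiplicative: signs are invisible modulo 2, and the product of the two
signs does not notice an interchange of the axes. -/
theorem cls_comp (M N : GridMotion) : (M.comp N).cls = M.cls.comp N.cls := by
  obtain ⟨s, e₁, e₂, e₃, k₁, k₂, k₃⟩ := M
  obtain ⟨s', f₁, f₂, f₃, l₁, l₂, l₃⟩ := N
  cases s <;> cases s' <;>
    simp only [cls, comp, GridClass.comp, Bool.false_eq_true, if_true, if_false, Int.cast_add,
      Int.cast_mul, zmod_two_units_mul] <;>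
    refine Prod.ext rfl (Prod.ext ?_ (Prod.ext ?_ ?_)) <;> dsimp only <;>
    first | ac_rfl | ring

end GridMotion

/-- The law satisfied by a compatible assignment of horizontal classes to vertical parts. -/
def IsCompatible (D : ℤˣ → ZMod 2 → GridClass) : Prop :=
  ∀ e f : ℤˣ, ∀ σ τ : ZMod 2, D (e * f) (σ + τ) = (D e σ).comp (D f τ)

theorem GridMotion.IsIn.comp {D : ℤˣ → ZMod 2 → GridClass} (hD : IsCompatible D)
    {M N : GridMotion} (hM : M.IsIn D) (hN : N.IsIn D) : (M.comp N).IsIn D := by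
  unfold IsIn at *
  rw [cls_comp, hM, hN, ← hD]
  simp [GridMotion.comp, zmod_two_units_mul, add_comm]

/-- The class `D 1 0` is idempotent, and the identity is the only idempotent class. -/
theorem IsCompatible.one {D : ℤˣ → ZMod 2 → GridClass} (hD : IsCompatible D) :
    D 1 0 = (false, 1, 0, 0) := by
  have h := hD 1 1 0 0
  generalize hc : D 1 0 = c at h
  simp only [mul_one, add_zero, hc] at h
  revert h
  clear hc hD
  revert c
  decide

theorem GridMotion.IsIn.inverse {D : ℤˣ → ZMod 2 → GridClass} (hD : IsCompatible D)
    {M : GridMotion} (hM : M.IsIn D) : M.inverse.IsIn D := by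
  have key : ∀ c d : GridClass, d.comp c = (false, 1, 0, 0) →
      d = (c.1, c.2.1, if c.1 then c.2.2.2 else c.2.2.1, if c.1 then c.2.2.1 else c.2.2.2) := by
    decide
  unfold IsIn at *
  have h1 := hD M.inverse.e₃ M.e₃ (M.inverse.k₃ : ZMod 2) (M.k₃ : ZMod 2)
  have h2 : M.inverse.e₃ * M.e₃ = 1 := by simp [GridMotion.inverse]
  have h3 : ((M.inverse.k₃ : ℤ) : ZMod 2) + (M.k₃ : ZMod 2) = 0 := by
    simp [GridMotion.inverse, zmod_two_units_mul, CharTwo.add_self_eq_zero]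
  rw [h2, h3, hD.one, ← hM] at h1
  rw [key _ _ h1.symm]
  obtain ⟨s, e₁, e₂, e₃, k₁, k₂, k₃⟩ := M
  have h4 : ∀ k : ZMod 2, -k = k := by decide
  cases s
  · simp [cls, GridMotion.inverse, zmod_two_units_mul, h4]
  · simp [cls, GridMotion.inverse, zmod_two_units_mul, h4, mul_comm e₂ e₁]

/-! ### The standard groups as groups of grid motions -/

/-- The horizontal class attached to each vertical part in the group of type `t`. -/
def GroupType.classes : GroupType → ℤˣ → ZMod 2 → GridClass := fun t e τ =>
  if e = 1 then
    if τ = 0 then (false, 1, 0, 0) else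
      match t with
      | .Pnnn => (false, -1, 1, 1)
      | .Pnna => (false, -1, 1, 1)
      | .Pccn => (false, -1, 0, 0)
      | .Pcca => (false, -1, 0, 0)
      | .P4₂n => (true, -1, 1, 1)
      | .P4₂22 => (true, -1, 0, 0)
      | .P4₂2₁2 => (true, -1, 1, 1)
      | .Pbar42c => (true, 1, 0, 0)
      | .Pbar42₁c => (true, 1, 1, 1)
      | .Pbar4c2 => (false, -1, 0, 0)
      | .Pbar4n2 => (false, -1, 1, 1)
  else
    if τ = 0 then
      match t with
      | .Pnnn => (false, -1, 0, 0)
      | .Pnna => (false, 1, 1, 0)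
      | .Pccn => (false, 1, 1, 1)
      | .Pcca => (false, 1, 1, 0)
      | .P4₂n => (false, 1, 1, 1)
      | .P4₂22 => (false, -1, 0, 0)
      | .P4₂2₁2 => (true, 1, 0, 0)
      | .Pbar42c => (true, -1, 0, 0)
      | .Pbar42₁c => (true, -1, 0, 0)
      | .Pbar4c2 => (true, -1, 0, 0)
      | .Pbar4n2 => (true, -1, 0, 0)
    else
      match t with
      | .Pnnn => (false, 1, 1, 1)
      | .Pnna => (false, -1, 0, 1)
      | .Pccn => (false, -1, 1, 1)
      | .Pcca => (false, -1, 1, 0)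
      | .P4₂n => (true, -1, 0, 0)
      | .P4₂22 => (true, 1, 0, 0)
      | .P4₂2₁2 => (false, -1, 1, 1)
      | .Pbar42c => (false, -1, 0, 0)
      | .Pbar42₁c => (false, -1, 1, 1)
      | .Pbar4c2 => (true, 1, 0, 0)
      | .Pbar4n2 => (true, 1, 1, 1)

/-- Twice the coordinates of a center of the grid in the standard setting. -/
def GroupType.center : GroupType → ℝ × ℝ
  | .Pnna => (1 / 2, 0)
  | .Pcca => (1 / 2, 0)
  | .Pccn => (1 / 2, 1 / 2)
  | .P4₂n => (1 / 2, 1 / 2)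
  | _ => (0, 0)

theorem GroupType.isCompatible_classes (t : GroupType) : IsCompatible t.classes := by
  unfold IsCompatible
  cases t <;> decide

/-- The affine map `s` acts as `M` on twice the standard coordinates relative to the center `o`. -/
def GridMotion.StdRealizes (M : GridMotion) (o : ℝ × ℝ) (s : E3 → E3) : Prop :=
  ∀ p : E3, 2 * s p 0 - o.1 = M.act₁ (2 * p 0 - o.1) (2 * p 1 - o.2) ∧
    2 * s p 1 - o.2 = M.act₂ (2 * p 0 - o.1) (2 * p 1 - o.2) ∧
    2 * s p 2 = M.act₃ (2 * p 2)

theorem GridMotion.StdRealizes.comp {M N : GridMotion} {o : ℝ × ℝ} {s u : E3 ≃ᵃ[ℝ] E3}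
    (hs : M.StdRealizes o s) (hu : N.StdRealizes o u) : (M.comp N).StdRealizes o ⇑(s * u) := by
  intro p
  obtain ⟨h1, h2, h3⟩ := hs (u p)
  obtain ⟨g1, g2, g3⟩ := hu p
  rw [act₁_comp, act₂_comp, act₃_comp, ← g1, ← g2, ← g3]
  exact ⟨h1, h2, h3⟩

theorem GridMotion.StdRealizes.inverse {M : GridMotion} {o : ℝ × ℝ} {s : E3 ≃ᵃ[ℝ] E3}
    (hs : M.StdRealizes o s) : M.inverse.StdRealizes o ⇑s⁻¹ := by
  intro p
  have hp : s (s⁻¹ p) = p := s.apply_symm_apply p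
  obtain ⟨h1, h2, h3⟩ := hs (s⁻¹ p)
  rw [hp] at h1 h2 h3
  rw [h1, h2, h3, act₁_inverse, act₂_inverse, act₃_inverse]
  exact ⟨rfl, rfl, rfl⟩

theorem E3.ext' {p q : E3} (h0 : p 0 = q 0) (h1 : p 1 = q 1) (h2 : p 2 = q 2) : p = q := by
  ext i; fin_cases i
  · exact h0
  · exact h1
  · exact h2

theorem GridMotion.StdRealizes.unique {M : GridMotion} {o : ℝ × ℝ} {s u : E3 ≃ᵃ[ℝ] E3}
    (hs : M.StdRealizes o s) (hu : M.StdRealizes o u) : s = u := by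
  ext1 p
  obtain ⟨h1, h2, h3⟩ := hs p
  obtain ⟨g1, g2, g3⟩ := hu p
  exact E3.ext' (by linarith) (by linarith) (by linarith)

/-- The linear part of a grid motion. -/
def GridMotion.linear (M : GridMotion) : E3 ≃ₗ[ℝ] E3 where
  toFun w := !₂[((M.e₁ : ℤ) : ℝ) * (if M.swap then w 1 else w 0),
    ((M.e₂ : ℤ) : ℝ) * (if M.swap then w 0 else w 1), ((M.e₃ : ℤ) : ℝ) * w 2]
  invFun w := !₂[if M.swap then ((M.e₂ : ℤ) : ℝ) * w 1 else ((M.e₁ : ℤ) : ℝ) * w 0,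
    if M.swap then ((M.e₁ : ℤ) : ℝ) * w 0 else ((M.e₂ : ℤ) : ℝ) * w 1, ((M.e₃ : ℤ) : ℝ) * w 2]
  map_add' p q := by
    apply E3.ext' <;> cases M.swap <;> simp <;> ring
  map_smul' c p := by
    apply E3.ext' <;> cases M.swap <;> simp <;> ring
  left_inv p := by
    obtain ⟨s, e₁, e₂, e₃, k₁, k₂, k₃⟩ := M
    rcases Int.units_eq_one_or e₁ with rfl | rfl <;> rcases Int.units_eq_one_or e₂ with rfl | rfl <;>
      rcases Int.units_eq_one_or e₃ with rfl | rfl <;> apply E3.ext' <;> cases s <;> simp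
  right_inv p := by
    obtain ⟨s, e₁, e₂, e₃, k₁, k₂, k₃⟩ := M
    rcases Int.units_eq_one_or e₁ with rfl | rfl <;> rcases Int.units_eq_one_or e₂ with rfl | rfl <;>
      rcases Int.units_eq_one_or e₃ with rfl | rfl <;> apply E3.ext' <;> cases s <;> simp

theorem GridMotion.exists_stdRealizes (M : GridMotion) (o : ℝ × ℝ) :
    ∃ s : E3 ≃ᵃ[ℝ] E3, M.StdRealizes o s := by
  refine ⟨M.linear.toAffineEquiv.trans (AffineEquiv.constVAdd ℝ E3
    !₂[(o.1 + M.act₁ (-o.1) (-o.2)) / 2, (o.2 + M.act₂ (-o.1) (-o.2)) / 2, (M.k₃ : ℝ) / 2]), ?_⟩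
  intro p
  obtain ⟨s, e₁, e₂, e₃, k₁, k₂, k₃⟩ := M
  refine ⟨?_, ?_, ?_⟩ <;> cases s <;> simp [GridMotion.linear, act₁, act₂, act₃] <;> ring

open GridMotion

/-- A horizontal coordinate with sign `e` and shift `σ` acquires, after doubling and recentring at
`o`, the shift `2σ + e o' - o`. Here `o` and `o'` are the centre coordinates belonging to the output
and the input axis. The motions listed below are obtained in this way. -/
theorem GroupType.exists_stdRealizes_of_mem_generators {t : GroupType} {s : E3 → E3}
    (hs : s ∈ unitTranslations ∪ t.generators) :
    ∃ M : GridMotion, M.IsIn t.classes ∧ M.StdRealizes t.center s := by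
  rcases hs with hs | hs
  · rcases hs with rfl | rfl | rfl
    · refine ⟨⟨false, 1, 1, 1, 2, 0, 0⟩, by cases t <;> decide, fun p => ?_⟩
      simp [act₁, act₂, act₃]; ring
    · refine ⟨⟨false, 1, 1, 1, 0, 2, 0⟩, by cases t <;> decide, fun p => ?_⟩
      simp [act₁, act₂, act₃]; ring
    · refine ⟨⟨false, 1, 1, 1, 0, 0, 2⟩, by cases t <;> decide, fun p => ?_⟩
      simp [act₁, act₂, act₃]; ring
  · cases t
    · rcases hs with rfl | rfl | rfl
      · exact ⟨⟨false, -1, -1, 1, 0, 0, 0⟩, by decide, fun p => by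
          simp [act₁, act₂, act₃, center]⟩
      · exact ⟨⟨false, -1, 1, -1, 0, 0, 0⟩, by decide, fun p => by
          simp [act₁, act₂, act₃, center]⟩
      · exact ⟨⟨false, -1, -1, -1, 1, 1, 1⟩, by decide, fun p => by
          simp [act₁, act₂, act₃, center]; refine ⟨?_, ?_, ?_⟩ <;> ring⟩
    · rcases hs with rfl | rfl | rfl
      · exact ⟨⟨false, -1, -1, 1, 0, 0, 0⟩, by decide, fun p => by
          simp [act₁, act₂, act₃, center]; ring⟩
      · exact ⟨⟨false, -1, 1, -1, 0, 1, 1⟩, by decide, fun p => by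
          simp [act₁, act₂, act₃, center]; refine ⟨?_, ?_, ?_⟩ <;> ring⟩
      · exact ⟨⟨false, -1, -1, -1, -1, 0, 0⟩, by decide, fun p => by
          simp [act₁, act₂, act₃, center]; ring⟩
    · rcases hs with rfl | rfl | rfl
      · exact ⟨⟨false, -1, -1, 1, 0, 0, 0⟩, by decide, fun p => by
          simp [act₁, act₂, act₃, center]; refine ⟨?_, ?_⟩ <;> ring⟩
      · exact ⟨⟨false, -1, 1, -1, -1, 1, 1⟩, by decide, fun p => by
          simp [act₁, act₂, act₃, center]; refine ⟨?_, ?_, ?_⟩ <;> ring⟩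
      · exact ⟨⟨false, -1, -1, -1, -1, -1, 0⟩, by decide, fun p => by
          simp [act₁, act₂, act₃, center]; refine ⟨?_, ?_⟩ <;> ring⟩
    · rcases hs with rfl | rfl | rfl
      · exact ⟨⟨false, -1, -1, 1, 0, 0, 0⟩, by decide, fun p => by
          simp [act₁, act₂, act₃, center]; ring⟩
      · exact ⟨⟨false, -1, 1, -1, -1, 0, 1⟩, by decide, fun p => by
          simp [act₁, act₂, act₃, center]; refine ⟨?_, ?_⟩ <;> ring⟩
      · exact ⟨⟨false, -1, -1, -1, -1, 0, 0⟩, by decide, fun p => by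
          simp [act₁, act₂, act₃, center]; ring⟩
    · rcases hs with rfl | rfl
      · exact ⟨⟨true, -1, 1, 1, -1, 1, 1⟩, by decide, fun p => by
          simp [act₁, act₂, act₃, center]; refine ⟨?_, ?_, ?_⟩ <;> ring⟩
      · exact ⟨⟨false, -1, -1, -1, -1, -1, 0⟩, by decide, fun p => by
          simp [act₁, act₂, act₃, center]; refine ⟨?_, ?_⟩ <;> ring⟩
    · rcases hs with rfl | rfl
      · exact ⟨⟨true, -1, 1, 1, 0, 0, 1⟩, by decide, fun p => by
          simp [act₁, act₂, act₃, center]; ring⟩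
      · exact ⟨⟨false, -1, 1, -1, 0, 0, 0⟩, by decide, fun p => by
          simp [act₁, act₂, act₃, center]⟩
    · rcases hs with rfl | rfl
      · exact ⟨⟨true, -1, 1, 1, 1, 1, 1⟩, by decide, fun p => by
          simp [act₁, act₂, act₃, center]; refine ⟨?_, ?_, ?_⟩ <;> ring⟩
      · exact ⟨⟨false, -1, 1, -1, 1, 1, 1⟩, by decide, fun p => by
          simp [act₁, act₂, act₃, center]; refine ⟨?_, ?_, ?_⟩ <;> ring⟩
    · rcases hs with rfl | rfl
      · exact ⟨⟨true, 1, -1, -1, 0, 0, 0⟩, by decide, fun p => by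
          simp [act₁, act₂, act₃, center]⟩
      · exact ⟨⟨false, -1, 1, -1, 0, 0, 1⟩, by decide, fun p => by
          simp [act₁, act₂, act₃, center]; ring⟩
    · rcases hs with rfl | rfl
      · exact ⟨⟨true, 1, -1, -1, 0, 0, 0⟩, by decide, fun p => by
          simp [act₁, act₂, act₃, center]⟩
      · exact ⟨⟨false, -1, 1, -1, 1, 1, 1⟩, by decide, fun p => by
          simp [act₁, act₂, act₃, center]; refine ⟨?_, ?_, ?_⟩ <;> ring⟩
    · rcases hs with rfl | rfl
      · exact ⟨⟨true, 1, -1, -1, 0, 0, 0⟩, by decide, fun p => by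
          simp [act₁, act₂, act₃, center]⟩
      · exact ⟨⟨false, 1, -1, 1, 0, 0, 1⟩, by decide, fun p => by
          simp [act₁, act₂, act₃, center]; ring⟩
    · rcases hs with rfl | rfl
      · exact ⟨⟨true, 1, -1, -1, 0, 0, 0⟩, by decide, fun p => by
          simp [act₁, act₂, act₃, center]⟩
      · exact ⟨⟨false, 1, -1, 1, 1, 1, 1⟩, by decide, fun p => by
          simp [act₁, act₂, act₃, center]; refine ⟨?_, ?_, ?_⟩ <;> ring⟩

theorem GroupType.exists_stdRealizes_of_mem {t : GroupType} {s : E3 ≃ᵃ[ℝ] E3}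
    (hs : s ∈ t.standardGroup) : ∃ M : GridMotion, M.IsIn t.classes ∧ M.StdRealizes t.center s := by
  induction hs using Subgroup.closure_induction with
  | mem s hs => exact t.exists_stdRealizes_of_mem_generators hs
  | one =>
    refine ⟨⟨false, 1, 1, 1, 0, 0, 0⟩, by cases t <;> decide, fun p => ?_⟩
    simp [act₁, act₂, act₃]
  | mul s u _ _ hs hu =>
    obtain ⟨M, hM, hs⟩ := hs
    obtain ⟨N, hN, hu⟩ := hu
    exact ⟨M.comp N, hM.comp t.isCompatible_classes hN, hs.comp hu⟩
  | inv s _ hs =>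
    obtain ⟨M, hM, hs⟩ := hs
    exact ⟨M.inverse, hM.inverse t.isCompatible_classes, hs.inverse⟩

theorem GroupType.mem_of_generators {t : GroupType} (M : GridMotion) (f : E3 → E3)
    (hf : f ∈ unitTranslations ∪ t.generators) (h : M.StdRealizes t.center f) :
    ∃ s ∈ t.standardGroup, M.StdRealizes t.center ⇑s := by
  obtain ⟨s, hs⟩ := M.exists_stdRealizes t.center
  have : ⇑s = f := by
    funext p
    obtain ⟨h1, h2, h3⟩ := hs p
    obtain ⟨g1, g2, g3⟩ := h p
    exact E3.ext' (by linarith) (by linarith) (by linarith)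
  exact ⟨s, Subgroup.subset_closure (by rw [Set.mem_ofPred_eq, this]; exact hf), hs⟩

theorem GroupType.translation_mem (t : GroupType) (i j k : ℤ) :
    ∃ s ∈ t.standardGroup, StdRealizes ⟨false, 1, 1, 1, 2 * i, 2 * j, 2 * k⟩ t.center ⇑s := by
  have key : ∀ w : E3, (fun p : E3 => w + p) ∈ unitTranslations → ∀ n : ℤ,
      AffineEquiv.constVAdd ℝ E3 (n • w) ∈ t.standardGroup := by
    intro w hw n
    have h : AffineEquiv.constVAdd ℝ E3 w ∈
        {g : E3 ≃ᵃ[ℝ] E3 | ⇑g ∈ unitTranslations ∪ t.generators} := Or.inl hw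
    rw [AffineEquiv.constVAdd_zsmul]
    exact Subgroup.zpow_mem _ (Subgroup.subset_closure h) n
  have h0 := key !₂[1, 0, 0] (Or.inl (by
    funext p; apply E3.ext' <;> simp [add_comm])) i
  have h1 := key !₂[0, 1, 0] (Or.inr (Or.inl (by
    funext p; apply E3.ext' <;> simp [add_comm]))) j
  have h2 := key !₂[0, 0, 1] (Or.inr (Or.inr (by
    rw [Set.mem_singleton_iff]
    funext p; apply E3.ext' <;> simp [add_comm]))) k
  refine ⟨_, mul_mem h0 (mul_mem h1 h2), fun p => ?_⟩
  simp [act₁, act₂, act₃]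
  refine ⟨?_, ?_, ?_⟩ <;> ring

theorem GridMotion.StdRealizes.vertical {M : GridMotion} {o : ℝ × ℝ} {f : E3 → E3}
    (h : M.StdRealizes o f) {e : ℤˣ} {k : ℤ} (hf : ∀ p, f p 2 = ((e : ℤ) : ℝ) * p 2 + k / 2) :
    M.e₃ = e ∧ M.k₃ = k := by
  have h0 := (h 0).2.2
  have h1 := (h (EuclideanSpace.single 2 1)).2.2
  rw [hf] at h0 h1
  simp [act₃] at h0 h1
  have hk : M.k₃ = k := by
    have : (k : ℝ) = M.k₃ := by linarith
    exact_mod_cast this.symm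
  refine ⟨?_, hk⟩
  rw [hk] at h1
  have : ((M.e₃ : ℤ) : ℝ) = (e : ℤ) := by linarith
  exact Units.ext (by exact_mod_cast this)

/-- The standard group contains an element with vertical part `z ↦ e z + τ` (in half units),
modulo unit translations. -/
def GroupType.HasVertical (t : GroupType) (e : ℤˣ) (τ : ZMod 2) : Prop :=
  ∃ M : GridMotion, M.IsIn t.classes ∧ M.e₃ = e ∧ (M.k₃ : ZMod 2) = τ ∧
    ∃ s ∈ t.standardGroup, M.StdRealizes t.center ⇑s

theorem GroupType.HasVertical.mul {t : GroupType} {e f : ℤˣ} {σ τ : ZMod 2}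
    (h : t.HasVertical e σ) (h' : t.HasVertical f τ) : t.HasVertical (e * f) (σ + τ) := by
  obtain ⟨M, hM, rfl, rfl, s, hs, hs'⟩ := h
  obtain ⟨N, hN, rfl, rfl, u, hu, hu'⟩ := h'
  refine ⟨M.comp N, hM.comp t.isCompatible_classes hN, rfl, ?_, s * u, mul_mem hs hu, hs'.comp hu'⟩
  simp [GridMotion.comp, zmod_two_units_mul, add_comm]

theorem GroupType.hasVertical_of_generator {t : GroupType} {f : E3 → E3}
    (hf : f ∈ t.generators) (e : ℤˣ) (k : ℤ)
    (h : ∀ p, f p 2 = ((e : ℤ) : ℝ) * p 2 + k / 2) : t.HasVertical e k := by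
  obtain ⟨M, hM, hr⟩ := t.exists_stdRealizes_of_mem_generators (Or.inr hf)
  obtain ⟨rfl, rfl⟩ := hr.vertical h
  exact ⟨M, hM, rfl, rfl, mem_of_generators M f (Or.inr hf) hr⟩

theorem GroupType.hasVertical_neg (t : GroupType) :
    t.HasVertical (-1) 0 ∧ t.HasVertical (-1) 1 := by
  cases t
  · refine ⟨?_, ?_⟩
    · simpa using hasVertical_of_generator (t := .Pnnn) (Or.inr (Or.inl rfl)) (-1) 0 (by simp)
    · simpa using hasVertical_of_generator (t := .Pnnn) (Or.inr (Or.inr rfl)) (-1) 1 (by simp)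
  · refine ⟨?_, ?_⟩
    · simpa using hasVertical_of_generator (t := .Pnna) (Or.inr (Or.inr rfl)) (-1) 0 (by simp)
    · simpa using hasVertical_of_generator (t := .Pnna) (Or.inr (Or.inl rfl)) (-1) 1 (by simp)
  · refine ⟨?_, ?_⟩
    · simpa using hasVertical_of_generator (t := .Pccn) (Or.inr (Or.inr rfl)) (-1) 0 (by simp)
    · simpa using hasVertical_of_generator (t := .Pccn) (Or.inr (Or.inl rfl)) (-1) 1 (by simp)
  · refine ⟨?_, ?_⟩
    · simpa using hasVertical_of_generator (t := .Pcca) (Or.inr (Or.inr rfl)) (-1) 0 (by simp)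
    · simpa using hasVertical_of_generator (t := .Pcca) (Or.inr (Or.inl rfl)) (-1) 1 (by simp)
  · have h := hasVertical_of_generator (t := .P4₂n) (Or.inl rfl) 1 1 (by simp)
    have h' := hasVertical_of_generator (t := .P4₂n) (Or.inr rfl) (-1) 0 (by simp)
    exact ⟨by simpa using h', by simpa using h.mul h'⟩
  · have h := hasVertical_of_generator (t := .P4₂22) (Or.inl rfl) 1 1 (by simp)
    have h' := hasVertical_of_generator (t := .P4₂22) (Or.inr rfl) (-1) 0 (by simp)
    exact ⟨by simpa using h', by simpa using h.mul h'⟩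
  · have h := hasVertical_of_generator (t := .P4₂2₁2) (Or.inl rfl) 1 1 (by simp)
    have h' := hasVertical_of_generator (t := .P4₂2₁2) (Or.inr rfl) (-1) 1 (by simp)
    exact ⟨by simpa [CharTwo.add_self_eq_zero] using h.mul h', by simpa using h'⟩
  · refine ⟨?_, ?_⟩
    · simpa using hasVertical_of_generator (t := .Pbar42c) (Or.inl rfl) (-1) 0 (by simp)
    · simpa using hasVertical_of_generator (t := .Pbar42c) (Or.inr rfl) (-1) 1 (by simp)
  · refine ⟨?_, ?_⟩
    · simpa using hasVertical_of_generator (t := .Pbar42₁c) (Or.inl rfl) (-1) 0 (by simp)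
    · simpa using hasVertical_of_generator (t := .Pbar42₁c) (Or.inr rfl) (-1) 1 (by simp)
  · have h := hasVertical_of_generator (t := .Pbar4c2) (Or.inl rfl) (-1) 0 (by simp)
    have h' := hasVertical_of_generator (t := .Pbar4c2) (Or.inr rfl) 1 1 (by simp)
    exact ⟨by simpa using h, by simpa using h.mul h'⟩
  · have h := hasVertical_of_generator (t := .Pbar4n2) (Or.inl rfl) (-1) 0 (by simp)
    have h' := hasVertical_of_generator (t := .Pbar4n2) (Or.inr rfl) 1 1 (by simp)
    exact ⟨by simpa using h, by simpa using h.mul h'⟩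

/-- Vertical parts modulo even shifts form a Klein four-group, generated by the two elements with `e
= -1`. -/
theorem GroupType.hasVertical (t : GroupType) (e : ℤˣ) (τ : ZMod 2) : t.HasVertical e τ := by
  obtain ⟨h0, h1⟩ := t.hasVertical_neg
  rcases Int.units_eq_one_or e with rfl | rfl <;> fin_cases τ
  · exact h0.mul h0
  · exact h0.mul h1
  · exact h0
  · exact h1

/-- The standard group contains a half-turn about a vertical line of the grid. -/
theorem GroupType.exists_halfTurn (t : GroupType) :
    ∃ M : GridMotion, M.swap = false ∧ M.e₁ = -1 ∧ M.e₂ = -1 ∧ M.e₃ = 1 ∧ Even M.k₁ ∧ Even M.k₂ ∧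
      Even M.k₃ ∧ ∃ s ∈ t.standardGroup, M.StdRealizes t.center ⇑s := by
  have ortho : ∀ f ∈ t.generators, StdRealizes ⟨false, -1, -1, 1, 0, 0, 0⟩ t.center f →
      ∃ M : GridMotion, M.swap = false ∧ M.e₁ = -1 ∧ M.e₂ = -1 ∧ M.e₃ = 1 ∧ Even M.k₁ ∧
        Even M.k₂ ∧ Even M.k₃ ∧ ∃ s ∈ t.standardGroup, M.StdRealizes t.center ⇑s :=
    fun f hf h => ⟨⟨false, -1, -1, 1, 0, 0, 0⟩, rfl, rfl, rfl, rfl, Even.zero, Even.zero,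
      Even.zero, mem_of_generators _ f (Or.inr hf) h⟩
  -- Horizontally such a class consists of quarter-turns. Squaring gives a half-turn, and all shifts
  -- become even because the two parities are both `x` and `e₃ k₃ + k₃` is even.
  have tetra : ∀ e τ x, t.classes e τ = (true, -1, x, x) →
      ∃ M : GridMotion, M.swap = false ∧ M.e₁ = -1 ∧ M.e₂ = -1 ∧ M.e₃ = 1 ∧ Even M.k₁ ∧
        Even M.k₂ ∧ Even M.k₃ ∧ ∃ s ∈ t.standardGroup, M.StdRealizes t.center ⇑s := by
    intro e τ x hx
    obtain ⟨M, hM, rfl, rfl, s, hs, hr⟩ := t.hasVertical e τ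
    unfold IsIn at hM
    rw [hx] at hM
    obtain ⟨sw, e₁, e₂, e₃, k₁, k₂, k₃⟩ := M
    simp only [cls, Prod.mk.injEq] at hM
    obtain ⟨rfl, he, hk₁, hk₂⟩ := hM
    refine ⟨_, ?_, ?_, ?_, ?_, ?_, ?_, ?_, s * s, mul_mem hs hs, hr.comp hr⟩ <;>
      simp only [GridMotion.comp, if_true, Bool.xor_self]
    · exact he
    · rw [mul_comm, he]
    · simp
    all_goals
      rw [← ZMod.intCast_eq_zero_iff_even]
      simp [zmod_two_units_mul, hk₁, hk₂, CharTwo.add_self_eq_zero]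
  cases t
  · exact ortho _ (Or.inl rfl) fun p => by simp [act₁, act₂, act₃, center]
  · exact ortho _ (Or.inl rfl) fun p => by simp [act₁, act₂, act₃, center]; ring
  · exact ortho _ (Or.inl rfl) fun p => by
      simp [act₁, act₂, act₃, center]; refine ⟨?_, ?_⟩ <;> ring
  · exact ortho _ (Or.inl rfl) fun p => by simp [act₁, act₂, act₃, center]; ring
  · exact tetra 1 1 _ rfl
  · exact tetra 1 1 _ rfl
  · exact tetra 1 1 _ rfl
  · exact tetra (-1) 0 _ rfl
  · exact tetra (-1) 0 _ rfl
  · exact tetra (-1) 0 _ rfl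
  · exact tetra (-1) 0 _ rfl

/-- After division by a group element with the same vertical part modulo 2, the class is trivial.
What is left is an even translation, or one multiplied by a vertical half-turn, and both belong to
the group. -/
theorem GroupType.mem_standardGroup_of_stdRealizes {t : GroupType} {M : GridMotion}
    (hM : M.IsIn t.classes) {s : E3 ≃ᵃ[ℝ] E3} (hs : M.StdRealizes t.center s) :
    s ∈ t.standardGroup := by
  have trans : ∀ (N : GridMotion) (u : E3 ≃ᵃ[ℝ] E3), N.StdRealizes t.center u → N.swap = false →
      N.e₁ = 1 → N.e₂ = 1 → N.e₃ = 1 → Even N.k₁ → Even N.k₂ → Even N.k₃ → u ∈ t.standardGroup := by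
    rintro ⟨_, _, _, _, k₁, k₂, k₃⟩ u hu rfl rfl rfl rfl ⟨i, rfl⟩ ⟨j, rfl⟩ ⟨k, rfl⟩
    obtain ⟨u', hu', hr⟩ := t.translation_mem i j k
    rw [two_mul, two_mul, two_mul] at hr
    rwa [hu.unique hr]
  obtain ⟨M', hM', he, hk, s', hs', hr⟩ := t.hasVertical M.e₃ M.k₃
  rw [show s = s * s'⁻¹ * s' by group]
  refine mul_mem ?_ hs'
  have hN := hM.comp t.isCompatible_classes (hM'.inverse t.isCompatible_classes)
  have hu := hs.comp hr.inverse
  generalize s * s'⁻¹ = u at hu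
  have he3 : (M.comp M'.inverse).e₃ = 1 := by simp [GridMotion.comp, GridMotion.inverse, he]
  have hk3 : ((M.comp M'.inverse).k₃ : ZMod 2) = 0 := by
    simp [GridMotion.comp, GridMotion.inverse, zmod_two_units_mul, hk, CharTwo.add_self_eq_zero]
  generalize M.comp M'.inverse = N at hN hu he3 hk3
  obtain ⟨sw, e₁, e₂, e₃, k₁, k₂, k₃⟩ := N
  simp only at he3 hk3
  unfold IsIn at hN
  simp only [he3, hk3, t.isCompatible_classes.one, cls, Prod.mk.injEq] at hN
  obtain ⟨rfl, hee, hk₁, hk₂⟩ := hN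
  rw [ZMod.intCast_eq_zero_iff_even] at hk₁ hk₂ hk3
  rcases Int.units_eq_one_or e₁ with rfl | rfl
  · exact trans _ u hu rfl rfl (by simpa using hee) he3 hk₁ hk₂ hk3
  · obtain ⟨⟨_, _, _, _, l₁, l₂, l₃⟩, rfl, rfl, rfl, rfl, hl₁, hl₂, hl₃, h, hh, hr'⟩ :=
      t.exists_halfTurn
    have he₂ : e₂ = -1 := by
      rw [neg_one_mul, neg_eq_iff_eq_neg] at hee
      exact hee
    simp only at hl₁ hl₂ hl₃
    subst he₂ he3
    rw [show u = u * h⁻¹ * h by group]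
    refine mul_mem (trans _ _ (hu.comp hr'.inverse) ?_ ?_ ?_ ?_ ?_ ?_ ?_) hh <;>
      simp [GridMotion.comp, GridMotion.inverse] <;>
      simp [← ZMod.intCast_eq_zero_iff_even] at * <;> simp [*]

/-! ### Coordinates adapted to the grid -/

/-- Twice the coordinate of `x` along `w`, relative to the origin `O` and the length of `w`. -/
def crd (O w x : E3) : ℝ := 2 * inner ℝ (x - O) w / ‖w‖ ^ 2

/-- The isometry `g` acts as `M` on the doubled coordinates relative to `O`, `a`, `b`, `v`. -/
def GridMotion.Realizes (M : GridMotion) (O a b v : E3) (g : Isom3) : Prop :=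
  ∀ x, crd O a (g x) = M.act₁ (crd O a x) (crd O b x) ∧
    crd O b (g x) = M.act₂ (crd O a x) (crd O b x) ∧ crd O v (g x) = M.act₃ (crd O v x)

/-- `O`, `a`, `b`, `v` is an orthogonal frame in which `G` consists of the grid motions whose
horizontal classes are attached to the vertical parts by `D`. -/
structure IsGridFrame (G : Subgroup Isom3) (O a b v : E3) (D : ℤˣ → ZMod 2 → GridClass) :
    Prop where
  a_ne : a ≠ 0
  b_ne : b ≠ 0
  v_ne : v ≠ 0
  ab : inner ℝ a b = 0
  av : inner ℝ a v = 0
  bv : inner ℝ b v = 0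
  expand : ∀ x, x = O + (crd O a x / 2) • a + (crd O b x / 2) • b + (crd O v x / 2) • v
  mem : ∀ g ∈ G, ∃ M : GridMotion, M.IsIn D ∧ M.Realizes O a b v g
  ex : ∀ M : GridMotion, M.IsIn D → ∃ g ∈ G, M.Realizes O a b v g
  compat : IsCompatible D
  nontrivial : (D 1 1).1 = true ∨ (D 1 1).2.1 = -1
  colours : ((D 1 1).colour = 0 ∧ (D (-1) 0).colour = 1 ∧ (D (-1) 1).colour = 1) ∨
    ((D 1 1).colour = 1 ∧ (D (-1) 0).colour = 0 ∧ (D (-1) 1).colour = 1) ∨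
    ((D 1 1).colour = 1 ∧ (D (-1) 0).colour = 1 ∧ (D (-1) 1).colour = 0)

theorem E3.eq_sum_single (w : E3) : w = w 0 • EuclideanSpace.single 0 1 +
    w 1 • EuclideanSpace.single 1 1 + w 2 • EuclideanSpace.single 2 (1 : ℝ) := by
  apply E3.ext' <;> simp

theorem crd_add_smul {O a b c : E3} (ha : a ≠ 0) (hb : inner ℝ a b = 0) (hc : inner ℝ a c = 0)
    (x y z : ℝ) : crd O a (O + x • a + y • b + z • c) = 2 * x := by
  have h : ‖a‖ ^ 2 ≠ 0 := by positivity
  have : O + x • a + y • b + z • c - O = x • a + y • b + z • c := by abel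
  rw [crd, this, inner_add_left, inner_add_left, inner_smul_left, inner_smul_left, inner_smul_left,
    real_inner_comm, real_inner_comm a b, real_inner_comm a c, hb, hc, real_inner_self_eq_norm_sq]
  simp
  field_simp

/-! ### An orthogonal frame adapted to the group -/

section Existence

variable {t : GroupType} {φ : E3 ≃ᵃ[ℝ] E3} {G : Subgroup Isom3}

theorem IsOfType.conj_mem (hG : IsOfType G t φ) {g : Isom3} (hg : g ∈ G) :
    ∃ s ∈ t.standardGroup, ∀ x, g (φ x) = φ (s x) := by
  refine ⟨φ.trans (g.toAffineEquiv.trans φ.symm), ?_, fun x => ?_⟩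
  · rw [hG]
    exact ⟨g, hg, fun x => by simp⟩
  · simp

theorem IsOfType.norm_linear (hG : IsOfType G t φ) {s : E3 ≃ᵃ[ℝ] E3} (hs : s ∈ t.standardGroup)
    (p q : E3) : ‖φ.linear (s p - s q)‖ = ‖φ.linear (p - q)‖ := by
  obtain ⟨g, -, h⟩ := (hG s).1 hs
  have h1 : ∀ x y : E3, φ.linear (x - y) = φ x - φ y := fun x y =>
    φ.toAffineMap.linearMap_vsub x y
  rw [h1, h1, ← h, ← h, ← dist_eq_norm, ← dist_eq_norm, g.dist_map]

theorem inner_eq_zero_of_norm_add_eq_norm_sub {x y : E3} (h : ‖x + y‖ = ‖x - y‖) :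
    inner ℝ x y = 0 := by
  have h1 := norm_add_sq_real x y
  have h2 := norm_sub_sq_real x y
  rw [h] at h1
  linarith

/-- The conjugating map need not be a similarity, but the norm pulled back by it is invariant under
the linear parts of the standard group. If a linear part sends `x + y` to `±(x - y)`, the images of
`x` and `y` are therefore orthogonal. The half-turn serves for the pairs involving the vertical
axis, and an element with `e₁ e₂ = -1` for the two horizontal axes. -/
theorem IsOfType.inner_linear (hG : IsOfType G t φ) :
    inner ℝ (φ.linear (EuclideanSpace.single 0 1)) (φ.linear (EuclideanSpace.single 1 1)) = 0 ∧
    inner ℝ (φ.linear (EuclideanSpace.single 0 1)) (φ.linear (EuclideanSpace.single 2 1)) = 0 ∧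
    inner ℝ (φ.linear (EuclideanSpace.single 1 1)) (φ.linear (EuclideanSpace.single 2 1)) = 0 := by
  have diff : ∀ (M : GridMotion) (s : E3 ≃ᵃ[ℝ] E3), M.StdRealizes t.center s → ∀ p q : E3,
      s p - s q = M.linear (p - q) := by
    intro M s hs p q
    obtain ⟨h1, h2, h3⟩ := hs p
    obtain ⟨g1, g2, g3⟩ := hs q
    apply E3.ext' <;> cases hsw : M.swap <;>
      simp [GridMotion.linear, act₁, act₂, act₃, hsw] at * <;> linarith
  obtain ⟨M, hsw, he₁, he₂, he₃, -, -, -, s, hs, hr⟩ := t.exists_halfTurn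
  refine ⟨?_, ?_, ?_⟩ <;> apply inner_eq_zero_of_norm_add_eq_norm_sub <;>
    rw [← map_add, ← map_sub]
  · obtain ⟨e, τ, h⟩ : ∃ e τ, (t.classes e τ).2.1 = -1 := by cases t <;> decide
    obtain ⟨N, hN, rfl, rfl, u, hu, hru⟩ := t.hasVertical e τ
    unfold IsIn at hN
    rw [← hN] at h
    have := hG.norm_linear hu (EuclideanSpace.single 0 1 + EuclideanSpace.single 1 1) 0
    rw [diff N u hru, sub_zero] at this
    rw [← this]
    obtain ⟨sw, e₁, e₂, e₃, k₁, k₂, k₃⟩ := N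
    simp only [cls] at h
    rcases Int.units_eq_one_or e₁ with rfl | rfl
    · have : e₂ = -1 := by simpa using h
      subst this
      congr 2
      apply E3.ext' <;> cases sw <;> simp [GridMotion.linear]
    · have : e₂ = 1 := by simpa using h
      subst this
      rw [← norm_neg, ← map_neg]
      congr 2
      apply E3.ext' <;> cases sw <;> simp [GridMotion.linear]
  · have := hG.norm_linear hs (EuclideanSpace.single 0 1 + EuclideanSpace.single 2 1) 0
    rw [diff M s hr, sub_zero] at this
    rw [← this, ← norm_neg, ← map_neg]
    congr 2
    apply E3.ext' <;> simp [GridMotion.linear, *]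
  · have := hG.norm_linear hs (EuclideanSpace.single 1 1 + EuclideanSpace.single 2 1) 0
    rw [diff M s hr, sub_zero] at this
    rw [← this, ← norm_neg, ← map_neg]
    congr 2
    apply E3.ext' <;> simp [GridMotion.linear, *]

/-- The frame is the image of the chosen centre and of the standard basis. Orthogonality makes the
inner-product coordinates `crd` agree with the doubled affine ones. -/
theorem IsOfType.exists_isGridFrame (hG : IsOfType G t φ) :
    ∃ O a b : E3, IsGridFrame G O a b (verticalVector φ) t.classes := by
  obtain ⟨hab, hav, hbv⟩ := hG.inner_linear
  have hne : ∀ i : Fin 3, φ.linear (EuclideanSpace.single i (1 : ℝ)) ≠ 0 := by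
    intro i
    rw [Ne, LinearEquiv.map_eq_zero_iff]
    simp
  have hφ : ∀ ξ : E3, φ ξ = φ !₂[t.center.1 / 2, t.center.2 / 2, 0] +
      (ξ 0 - t.center.1 / 2) • φ.linear (EuclideanSpace.single 0 1) +
      (ξ 1 - t.center.2 / 2) • φ.linear (EuclideanSpace.single 1 1) +
      (ξ 2) • φ.linear (EuclideanSpace.single 2 1) := by
    intro ξ
    have h := E3.eq_sum_single (ξ - !₂[t.center.1 / 2, t.center.2 / 2, 0])
    have h1 : φ.linear (ξ - !₂[t.center.1 / 2, t.center.2 / 2, 0]) =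
      φ ξ - φ !₂[t.center.1 / 2, t.center.2 / 2, 0] := φ.toAffineMap.linearMap_vsub _ _
    rw [h, map_add, map_add, map_smul, map_smul, map_smul] at h1
    rw [eq_comm, sub_eq_iff_eq_add'] at h1
    rw [h1]
    simp [add_assoc]
  have ha := hne 0
  have hb := hne 1
  have hv := hne 2
  unfold verticalVector
  generalize φ.linear (EuclideanSpace.single 0 1) = a at *
  generalize φ.linear (EuclideanSpace.single 1 1) = b at *
  generalize φ.linear (EuclideanSpace.single 2 1) = v at *
  generalize φ !₂[t.center.1 / 2, t.center.2 / 2, 0] = O at *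
  have hba : inner ℝ b a = 0 := by rw [real_inner_comm, hab]
  have hva : inner ℝ v a = 0 := by rw [real_inner_comm, hav]
  have hvb : inner ℝ v b = 0 := by rw [real_inner_comm, hbv]
  have c0 : ∀ ξ, crd O a (φ ξ) = 2 * ξ 0 - t.center.1 := fun ξ => by
    rw [hφ, crd_add_smul ha hab hav]; ring
  have c1 : ∀ ξ, crd O b (φ ξ) = 2 * ξ 1 - t.center.2 := fun ξ => by
    rw [hφ, add_right_comm O, crd_add_smul hb hba hbv]; ring
  have c2 : ∀ ξ, crd O v (φ ξ) = 2 * ξ 2 := fun ξ => by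
    rw [hφ, add_right_comm _ _ (ξ 2 • v), add_right_comm O, crd_add_smul hv hva hvb]
  have real : ∀ (M : GridMotion) (s : E3 ≃ᵃ[ℝ] E3) (g : Isom3), (∀ x, g (φ x) = φ (s x)) →
      M.StdRealizes t.center s → M.Realizes O a b v g := by
    intro M s g hg hs x
    obtain ⟨ξ, rfl⟩ := φ.surjective x
    rw [hg]
    simp only [c0, c1, c2]
    exact hs ξ
  refine ⟨O, a, b, ha, hb, hv, hab, hav, hbv, fun x => ?_, fun g hg => ?_, fun M hM => ?_,
    t.isCompatible_classes, by cases t <;> decide, by cases t <;> decide⟩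
  · obtain ⟨ξ, rfl⟩ := φ.surjective x
    rw [c0, c1, c2, hφ, sub_div, sub_div, mul_div_cancel_left₀ _ two_ne_zero,
      mul_div_cancel_left₀ _ two_ne_zero, mul_div_cancel_left₀ _ two_ne_zero]
  · obtain ⟨s, hs, h⟩ := hG.conj_mem hg
    obtain ⟨M, hM, hr⟩ := GroupType.exists_stdRealizes_of_mem hs
    exact ⟨M, hM, real M s g h hr⟩
  · obtain ⟨s, hr⟩ := M.exists_stdRealizes t.center
    obtain ⟨g, hg, h⟩ := (hG s).1 (GroupType.mem_standardGroup_of_stdRealizes hM hr)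
    exact ⟨g, hg, real M s g h hr⟩

end Existence

/-! ### Calculus of grid coordinates -/

theorem crd_zero_sub (O w x y : E3) : crd 0 w (x - y) = crd O w x - crd O w y := by
  simp only [crd, inner_sub_left, sub_zero]
  ring

theorem crd_zero_self {w : E3} (hw : w ≠ 0) (c : ℝ) : crd 0 w (c • w) = 2 * c := by
  have h : ‖w‖ ^ 2 ≠ 0 := by positivity
  simp only [crd, sub_zero, inner_smul_left, real_inner_self_eq_norm_sq]
  field_simp
  simp

theorem crd_zero_of_inner_eq_zero {w u : E3} (h : inner ℝ u w = 0) (c : ℝ) :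
    crd 0 w (c • u) = 0 := by
  simp [crd, inner_smul_left, h]

theorem crd_vadd (O w u x : E3) : crd O w (u + x) = crd 0 w u + crd O w x := by
  have := crd_zero_sub O w (u + x) x
  rw [add_sub_cancel_right] at this
  linarith

@[simp]
theorem crd_self (O w : E3) : crd O w O = 0 := by simp [crd]

theorem inner_sub_eq_crd {w : E3} (hw : w ≠ 0) (O x y : E3) :
    inner ℝ (x - y) w = (crd O w x - crd O w y) * ‖w‖ ^ 2 / 2 := by
  have h : ‖w‖ ^ 2 ≠ 0 := by positivity
  rw [← crd_zero_sub, crd, sub_zero]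
  field_simp

theorem inner_eq_inner_iff_crd {w : E3} (hw : w ≠ 0) (O x y : E3) :
    inner ℝ x w = inner ℝ y w ↔ crd O w x = crd O w y := by
  have h : ‖w‖ ^ 2 ≠ 0 := by positivity
  rw [← sub_eq_zero, ← inner_sub_left, inner_sub_eq_crd hw O, div_eq_zero_iff, mul_eq_zero,
    sub_eq_zero]
  simp [hw]

/-- The translations as a homomorphism. -/
def translationHom : Multiplicative E3 →* Isom3 where
  toFun w := translation w.toAdd
  map_one' := by ext1 x; simp
  map_mul' u w := by ext1 x; simp [add_assoc]

theorem translation_zsmul (i : ℤ) (w : E3) : translation (i • w) = translation w ^ i := by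
  have := map_zpow translationHom (Multiplicative.ofAdd w) i
  rwa [← ofAdd_zsmul] at this

namespace GridMotion

theorem ext_of_act {M N : GridMotion} (h₁ : ∀ x y, M.act₁ x y = N.act₁ x y)
    (h₂ : ∀ x y, M.act₂ x y = N.act₂ x y) (h₃ : ∀ z, M.act₃ z = N.act₃ z) : M = N := by
  obtain ⟨s, e₁, e₂, e₃, k₁, k₂, k₃⟩ := M
  obtain ⟨s', f₁, f₂, f₃, l₁, l₂, l₃⟩ := N
  have a0 := h₁ 0 0
  have a1 := h₁ 1 0
  have a2 := h₁ 0 1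
  have b0 := h₂ 0 0
  have b1 := h₂ 1 0
  have b2 := h₂ 0 1
  have c0 := h₃ 0
  have c1 := h₃ 1
  simp only [act₁, act₂, act₃, ite_self, mul_zero, zero_add, Int.cast_inj, mul_one] at *
  subst a0 b0 c0
  have key : ∀ e f : ℤˣ, (((e : ℤ) : ℝ)) = (f : ℤ) → e = f := fun e f h =>
    Units.ext (by exact_mod_cast h)
  have key0 : ∀ e : ℤˣ, (((e : ℤ) : ℝ)) ≠ 0 := fun e => by
    rcases Int.units_eq_one_or e with rfl | rfl <;> norm_num
  obtain rfl := key _ _ (add_right_cancel c1)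
  cases s <;> cases s' <;> simp [key0] at a1 a2 b1 b2
  · obtain rfl := Units.ext a1
    obtain rfl := Units.ext b2
    rfl
  · obtain rfl := Units.ext a2
    obtain rfl := Units.ext b1
    rfl

variable {O a b v : E3}

theorem Realizes.comp {M N : GridMotion} {g h : Isom3} (hg : M.Realizes O a b v g)
    (hh : N.Realizes O a b v h) : (M.comp N).Realizes O a b v (g * h) := by
  intro p
  obtain ⟨h1, h2, h3⟩ := hg (h p)
  obtain ⟨g1, g2, g3⟩ := hh p
  rw [act₁_comp, act₂_comp, act₃_comp, ← g1, ← g2, ← g3]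
  exact ⟨h1, h2, h3⟩

theorem Realizes.inverse {M : GridMotion} {g : Isom3} (hg : M.Realizes O a b v g) :
    M.inverse.Realizes O a b v g⁻¹ := by
  intro p
  have hp : g (g⁻¹ p) = p := g.apply_symm_apply p
  obtain ⟨h1, h2, h3⟩ := hg (g⁻¹ p)
  rw [hp] at h1 h2 h3
  rw [h1, h2, h3, act₁_inverse, act₂_inverse, act₃_inverse]
  exact ⟨rfl, rfl, rfl⟩

end GridMotion

/-! ### Isometries realizing given grid motions -/

namespace IsGridFrame

variable {G : Subgroup Isom3} {O a b v : E3} {D : ℤˣ → ZMod 2 → GridClass}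

section

variable (F : IsGridFrame G O a b v D)

include F

theorem ba : inner ℝ b a = 0 := by rw [real_inner_comm, F.ab]

theorem va : inner ℝ v a = 0 := by rw [real_inner_comm, F.av]

theorem vb : inner ℝ v b = 0 := by rw [real_inner_comm, F.bv]

theorem ext {x y : E3} (h₁ : crd O a x = crd O a y) (h₂ : crd O b x = crd O b y)
    (h₃ : crd O v x = crd O v y) : x = y := by
  rw [F.expand x, F.expand y, h₁, h₂, h₃]

theorem exists_point (x y z : ℝ) : ∃ p, crd O a p = x ∧ crd O b p = y ∧ crd O v p = z := by
  refine ⟨O + (x / 2) • a + (y / 2) • b + (z / 2) • v, ?_, ?_, ?_⟩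
  · rw [crd_add_smul F.a_ne F.ab F.av]; ring
  · rw [add_right_comm O, crd_add_smul F.b_ne F.ba F.bv]; ring
  · rw [add_right_comm _ _ ((z / 2) • v), add_right_comm O, crd_add_smul F.v_ne F.va F.vb]; ring

theorem dist_sq (x y : E3) : dist x y ^ 2 = ‖a‖ ^ 2 / 4 * (crd O a x - crd O a y) ^ 2 +
    ‖b‖ ^ 2 / 4 * (crd O b x - crd O b y) ^ 2 + ‖v‖ ^ 2 / 4 * (crd O v x - crd O v y) ^ 2 := by
  have h : x - y = ((crd O a x - crd O a y) / 2) • a + ((crd O b x - crd O b y) / 2) • b +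
      ((crd O v x - crd O v y) / 2) • v := by
    conv_lhs => rw [F.expand x, F.expand y]
    module
  rw [dist_eq_norm, h, ← real_inner_self_eq_norm_sq]
  simp only [inner_add_left, inner_add_right, inner_smul_left, inner_smul_right, F.ab, F.av, F.bv,
    F.ba, F.va, F.vb, real_inner_self_eq_norm_sq]
  simp
  ring

theorem eq_of_realizes {M : GridMotion} {g h : Isom3} (hg : M.Realizes O a b v g)
    (hh : M.Realizes O a b v h) : g = h := by
  ext1 x
  obtain ⟨h1, h2, h3⟩ := hg x
  obtain ⟨g1, g2, g3⟩ := hh x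
  exact F.ext (h1.trans g1.symm) (h2.trans g2.symm) (h3.trans g3.symm)

theorem motion_unique {M N : GridMotion} {g : Isom3} (hM : M.Realizes O a b v g)
    (hN : N.Realizes O a b v g) : M = N := by
  apply GridMotion.ext_of_act
  · intro x y
    obtain ⟨p, rfl, rfl, -⟩ := F.exists_point x y 0
    exact (hM p).1.symm.trans (hN p).1
  · intro x y
    obtain ⟨p, rfl, rfl, -⟩ := F.exists_point x y 0
    exact (hM p).2.1.symm.trans (hN p).2.1
  · intro z
    obtain ⟨p, -, -, rfl⟩ := F.exists_point 0 0 z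
    exact (hM p).2.2.symm.trans (hN p).2.2

theorem mem_of_realizes {M : GridMotion} (hM : M.IsIn D) {g : Isom3}
    (hg : M.Realizes O a b v g) : g ∈ G := by
  obtain ⟨h, hh, hr⟩ := F.ex M hM
  rwa [F.eq_of_realizes hg hr]

omit F in
theorem realizes_translation {w : E3} {i j k : ℤ} (hi : crd 0 a w = i) (hj : crd 0 b w = j)
    (hk : crd 0 v w = k) : Realizes ⟨false, 1, 1, 1, i, j, k⟩ O a b v (translation w) := by
  intro x
  have h : translation w x = w + x := rfl
  rw [h, crd_vadd, crd_vadd, crd_vadd, hi, hj, hk]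
  simp [act₁, act₂, act₃, add_comm]

theorem realizes_halfTurn : Realizes ⟨false, -1, -1, 1, 0, 0, 0⟩ O a b v (halfTurn O v) := by
  intro x
  have hx := F.expand x
  set s := AffineSubspace.mk' O (ℝ ∙ v)
  have hp : O + (crd O v x / 2) • v ∈ s := by
    rw [AffineSubspace.mem_mk']
    simpa using Submodule.smul_mem _ _ (Submodule.mem_span_singleton_self v)
  have hn : (crd O a x / 2) • a + (crd O b x / 2) • b ∈ s.directionᗮ := by
    rw [AffineSubspace.direction_mk', Submodule.mem_orthogonal_singleton_iff_inner_right,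
      inner_add_right, inner_smul_right, inner_smul_right, F.va, F.vb]
    simp
  have h := EuclideanGeometry.reflection_orthogonal_vadd hp hn
  have h2 : halfTurn O v x = O + (-crd O a x / 2) • a + (-crd O b x / 2) • b +
      (crd O v x / 2) • v := by
    have h3 : x = ((crd O a x / 2) • a + (crd O b x / 2) • b) +ᵥ (O + (crd O v x / 2) • v) := by
      rw [vadd_eq_add]
      conv_lhs => rw [hx]
      module
    conv_lhs => rw [h3]
    refine h.trans ?_
    rw [vadd_eq_add]
    module
  rw [h2]
  refine ⟨?_, ?_, ?_⟩
  · rw [crd_add_smul F.a_ne F.ab F.av]; simp [act₁]; ring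
  · rw [add_right_comm O, crd_add_smul F.b_ne F.ba F.bv]; simp [act₂]; ring
  · rw [add_right_comm _ _ ((crd O v x / 2) • v), add_right_comm O,
      crd_add_smul F.v_ne F.va F.vb]; simp [act₃]; ring

omit F in
theorem planeReflection_apply {w : E3} (c : ℝ) (hw : w ≠ 0) (x : E3) :
    planeReflection (O + (c / 2) • w) w x = (c - crd O w x) • w + x := by
  set s := AffineSubspace.mk' (O + (c / 2) • w) (ℝ ∙ w)ᗮ
  have hww : ‖w‖ ^ 2 ≠ 0 := by positivity
  -- This point is the orthogonal projection of `x` onto the mirror, which is where the coordinate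
  -- along `w` equals `c`.
  have hp : ((c - crd O w x) / 2) • w + x ∈ s := by
    rw [AffineSubspace.mem_mk', Submodule.mem_orthogonal_singleton_iff_inner_left, vsub_eq_sub]
    have h1 : ((c - crd O w x) / 2) • w + x - (O + (c / 2) • w) =
      (-crd O w x / 2) • w + (x - O) := by module
    rw [h1, inner_add_left, inner_smul_left, real_inner_self_eq_norm_sq]
    simp [crd]
    field_simp
    ring
  have hn : (-(c - crd O w x) / 2) • w ∈ s.directionᗮ := by
    rw [AffineSubspace.direction_mk']
    exact Submodule.le_orthogonal_orthogonal _
      (Submodule.smul_mem _ _ (Submodule.mem_span_singleton_self w))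
  have h := EuclideanGeometry.reflection_orthogonal_vadd hp hn
  have h3 : x = ((-(c - crd O w x) / 2) • w) +ᵥ (((c - crd O w x) / 2) • w + x) := by
    rw [vadd_eq_add]
    module
  conv_lhs => rw [h3]
  refine h.trans ?_
  rw [vadd_eq_add]
  module

end

end IsGridFrame

namespace IsGridFrame

variable {G : Subgroup Isom3} {O a b v : E3} {D : ℤˣ → ZMod 2 → GridClass}

section

variable (F : IsGridFrame G O a b v D)

include F

/-! ### Horizontal motions -/

theorem mem_horizontal_iff {g : Isom3} : g ∈ horizontalSubgroup G v ↔
    g ∈ G ∧ ∀ x, crd O v (g x) = crd O v x := by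
  refine and_congr_right fun _ => forall_congr' fun x => inner_eq_inner_iff_crd F.v_ne O _ _

theorem mem_horizontal_of_realizes {M : GridMotion} (hM : M.IsIn D) (h₃ : M.e₃ = 1)
    (hk : M.k₃ = 0) {g : Isom3} (hg : M.Realizes O a b v g) : g ∈ horizontalSubgroup G v := by
  rw [F.mem_horizontal_iff]
  refine ⟨F.mem_of_realizes hM hg, fun x => ?_⟩
  rw [(hg x).2.2, act₃, h₃, hk]
  simp

/-- Grid motions of `p2` type. -/
def _root_.Stereohedra.GridMotion.IsP2 (M : GridMotion) : Prop :=
  M.swap = false ∧ M.e₁ = M.e₂ ∧ M.e₃ = 1 ∧ Even M.k₁ ∧ Even M.k₂ ∧ M.k₃ = 0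

theorem isIn_of_isP2 {M : GridMotion} (hM : M.IsP2) : M.IsIn D := by
  obtain ⟨s, e₁, e₂, e₃, k₁, k₂, k₃⟩ := M
  obtain ⟨h1, h2, h3, h4, h5, h6⟩ := hM
  simp only at h1 h2 h3 h4 h5 h6
  subst h1 h2 h3 h6
  rw [← ZMod.intCast_eq_zero_iff_even] at h4 h5
  simp [IsIn, cls, F.compat.one, h4, h5]

/-- A horizontal motion has vertical part `z ↦ z`, hence the trivial class `D 1 0`: no interchange,
equal signs, even shifts. -/
theorem mem_horizontal_iff_isP2 {M : GridMotion} {g : Isom3} (hg : M.Realizes O a b v g) :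
    g ∈ horizontalSubgroup G v ↔ M.IsP2 := by
  constructor
  · intro h
    rw [F.mem_horizontal_iff] at h
    obtain ⟨hG, hz⟩ := h
    obtain ⟨N, hN, hr⟩ := F.mem g hG
    obtain rfl := F.motion_unique hg hr
    have h0 : ∀ z : ℝ, M.act₃ z = z := by
      intro z
      obtain ⟨p, -, -, rfl⟩ := F.exists_point 0 0 z
      rw [← (hg p).2.2, hz]
    obtain ⟨s, e₁, e₂, e₃, k₁, k₂, k₃⟩ := M
    have h1 := h0 0
    have h2 := h0 1
    simp [act₃] at h1 h2
    subst h1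
    have he : e₃ = 1 := by
      rcases Int.units_eq_one_or e₃ with rfl | rfl
      · rfl
      · norm_num at h2
    subst he
    simp only [IsIn, cls, Int.cast_zero, F.compat.one, Prod.mk.injEq] at hN
    obtain ⟨rfl, h3, h4, h5⟩ := hN
    rw [ZMod.intCast_eq_zero_iff_even] at h4 h5
    refine ⟨rfl, ?_, rfl, h4, h5, rfl⟩
    have := eq_inv_of_mul_eq_one_left h3
    rcases Int.units_eq_one_or e₂ with rfl | rfl <;> simpa using this
  · intro h
    exact F.mem_horizontal_of_realizes (F.isIn_of_isP2 h) h.2.2.1 h.2.2.2.2.2 hg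

theorem realizes_translation_a (i : ℤ) :
    Realizes ⟨false, 1, 1, 1, 2 * i, 0, 0⟩ O a b v (translation (i • a)) := by
  rw [← Int.cast_smul_eq_zsmul ℝ]
  apply realizes_translation
  · rw [crd_zero_self F.a_ne]; push_cast; rfl
  · rw [crd_zero_of_inner_eq_zero F.ab]; simp
  · rw [crd_zero_of_inner_eq_zero F.av]; simp

theorem realizes_translation_b (i : ℤ) :
    Realizes ⟨false, 1, 1, 1, 0, 2 * i, 0⟩ O a b v (translation (i • b)) := by
  rw [← Int.cast_smul_eq_zsmul ℝ]
  apply realizes_translation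
  · rw [crd_zero_of_inner_eq_zero F.ba]; simp
  · rw [crd_zero_self F.b_ne]; push_cast; rfl
  · rw [crd_zero_of_inner_eq_zero F.bv]; simp

theorem realizes_translation_v (i : ℤ) :
    Realizes ⟨false, 1, 1, 1, 0, 0, 2 * i⟩ O a b v (translation (i • v)) := by
  rw [← Int.cast_smul_eq_zsmul ℝ]
  apply realizes_translation
  · rw [crd_zero_of_inner_eq_zero F.va]; simp
  · rw [crd_zero_of_inner_eq_zero F.vb]; simp
  · rw [crd_zero_self F.v_ne]; push_cast; rfl

theorem isRectangularP2 : IsRectangularP2 (horizontalSubgroup G v) v O a b := by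
  refine ⟨F.a_ne, F.b_ne, F.av, F.bv, F.ab, le_antisymm ?_ ?_⟩
  · intro g hg
    have ht : translation a ∈ Subgroup.closure {translation a, translation b, halfTurn O v} :=
      Subgroup.subset_closure (by simp)
    have ht' : translation b ∈ Subgroup.closure {translation a, translation b, halfTurn O v} :=
      Subgroup.subset_closure (by simp)
    have ht'' : halfTurn O v ∈ Subgroup.closure {translation a, translation b, halfTurn O v} :=
      Subgroup.subset_closure (by simp)
    obtain ⟨M, hM, hr⟩ := F.mem g hg.1
    have hP := (F.mem_horizontal_iff_isP2 hr).1 hg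
    obtain ⟨s, e₁, e₂, e₃, k₁, k₂, k₃⟩ := M
    obtain ⟨h1, h2, h3, ⟨i, h4⟩, ⟨j, h5⟩, h6⟩ := hP
    simp only at h1 h2 h3 h4 h5 h6
    subst h1 h2 h3 h6 h4 h5
    have hT := (F.realizes_translation_a i).comp (F.realizes_translation_b j)
    rcases Int.units_eq_one_or e₁ with rfl | rfl
    · have : g = translation (i • a) * translation (j • b) := by
        apply F.eq_of_realizes hr
        convert hT using 1
        simp [GridMotion.comp, two_mul]
      rw [this, translation_zsmul, translation_zsmul]
      exact mul_mem (zpow_mem ht i) (zpow_mem ht' j)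
    · have : g = translation (i • a) * translation (j • b) * halfTurn O v := by
        apply F.eq_of_realizes hr
        convert hT.comp F.realizes_halfTurn using 1
        simp [GridMotion.comp, two_mul]
      rw [this, translation_zsmul, translation_zsmul]
      exact mul_mem (mul_mem (zpow_mem ht i) (zpow_mem ht' j)) ht''
  · rw [Subgroup.closure_le]
    rintro g (rfl | rfl | rfl)
    · have := F.realizes_translation_a 1
      rw [one_zsmul] at this
      exact (F.mem_horizontal_iff_isP2 this).2 (by simp [IsP2])
    · have := F.realizes_translation_b 1
      rw [one_zsmul] at this
      exact (F.mem_horizontal_iff_isP2 this).2 (by simp [IsP2])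
    · exact (F.mem_horizontal_iff_isP2 F.realizes_halfTurn).2 (by simp [IsP2])

/-- A vertical translation by an odd multiple of `v / 2` would have class `D 1 1`. By `nontrivial`
that class is never the class of a translation. -/
theorem isShortestTranslation : IsShortestTranslation G v := by
  refine ⟨F.v_ne, fun c => ⟨fun h => ?_, ?_⟩⟩
  · obtain ⟨M, hM, hr⟩ := F.mem _ h
    have h0 := (hr O).2.2
    have h1 : translation (c • v) O = c • v + O := rfl
    rw [h1, crd_vadd, crd_zero_self F.v_ne, crd_self] at h0
    have hk : 2 * c = M.k₃ := by simpa [act₃] using h0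
    have hr' : Realizes ⟨false, 1, 1, 1, 0, 0, M.k₃⟩ O a b v (translation (c • v)) := by
      apply realizes_translation
      · rw [crd_zero_of_inner_eq_zero F.va]; simp
      · rw [crd_zero_of_inner_eq_zero F.vb]; simp
      · rw [crd_zero_self F.v_ne, hk]
    have hMe := F.motion_unique hr hr'
    rw [hMe] at hM
    simp only [IsIn, cls] at hM
    rcases Int.even_or_odd M.k₃ with ⟨j, hj⟩ | hodd
    · refine ⟨j, ?_⟩
      rw [hj] at hk
      push_cast at hk
      linarith
    · exfalso
      have h2 : (M.k₃ : ZMod 2) = 1 := by rwa [ZMod.intCast_eq_one_iff_odd]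
      rw [h2] at hM
      have := F.nontrivial
      rw [← hM] at this
      revert this
      decide
  · rintro ⟨k, rfl⟩
    rw [Int.cast_smul_eq_zsmul]
    refine F.mem_of_realizes ?_ (F.realizes_translation_v k)
    have : ((2 * k : ℤ) : ZMod 2) = 0 := by
      rw [ZMod.intCast_eq_zero_iff_even]; exact even_two_mul k
    simp [IsIn, cls, this, F.compat.one]

/-! ### Reflections in grid planes -/

/-- Conjugation by the class `(false, -1, 0, 0)` of a grid reflection fixes every class, and it
leaves the vertical part alone. So it respects the table `D`. -/
theorem mem_normalizer {R : GridMotion} {r : Isom3} (hr : R.Realizes O a b v r)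
    (h₁ : R.swap = false) (h₂ : R.e₁ * R.e₂ = -1) (h₃ : R.e₃ = 1) (hk₁ : Even R.k₁)
    (hk₂ : Even R.k₂) (hk₃ : R.k₃ = 0) :
    r ∈ Subgroup.normalizer (G : Set Isom3) := by
  have key : ∀ (R : GridMotion) (r : Isom3), R.Realizes O a b v r → R.swap = false →
      R.e₁ * R.e₂ = -1 → R.e₃ = 1 → Even R.k₁ → Even R.k₂ → R.k₃ = 0 →
      ∀ g ∈ G, r * g * r⁻¹ ∈ G := by
    intro R r hr h₁ h₂ h₃ hk₁ hk₂ hk₃ g hg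
    rw [← ZMod.intCast_eq_zero_iff_even] at hk₁ hk₂
    obtain ⟨M, hM, hg⟩ := F.mem g hg
    refine F.mem_of_realizes ?_ ((hr.comp hg).comp hr.inverse)
    have hR : R.cls = (false, -1, 0, 0) := by simp [cls, h₁, h₂, hk₁, hk₂]
    have hR' : R.inverse.cls = (false, -1, 0, 0) := by
      simp [cls, GridMotion.inverse, h₁, h₂, hk₁, hk₂]
    have conj : ∀ c : GridClass,
        (GridClass.comp (false, -1, 0, 0) c).comp (false, -1, 0, 0) = c := by decide
    rw [IsIn, cls_comp, cls_comp, hR, hR', conj, hM]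
    congr 1
    · simp [GridMotion.comp, GridMotion.inverse, h₃]
    · simp [GridMotion.comp, GridMotion.inverse, h₃, hk₃]
  rw [Subgroup.mem_normalizer_iff]
  refine fun g => ⟨key R r hr h₁ h₂ h₃ hk₁ hk₂ hk₃ g, fun h => ?_⟩
  have := key R.inverse r⁻¹ hr.inverse h₁ (by simp [GridMotion.inverse, h₁, h₂])
    (by simp [GridMotion.inverse, h₃]) (by simp [GridMotion.inverse, h₁, hk₁])
    (by simp [GridMotion.inverse, h₁, hk₂]) (by simp [GridMotion.inverse, hk₃]) _ h
  simpa [mul_assoc] using this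

theorem planeReflection_mem_normalizer (m : ℤ) :
    planeReflection (O + ((m : ℝ) / 2) • a) a ∈ Subgroup.normalizer (G : Set Isom3) ∧
    planeReflection (O + ((m : ℝ) / 2) • b) b ∈ Subgroup.normalizer (G : Set Isom3) := by
  constructor
  · refine F.mem_normalizer (R := ⟨false, -1, 1, 1, 2 * m, 0, 0⟩) (fun x => ?_) rfl (by simp) rfl
      (even_two_mul m) Even.zero rfl
    rw [planeReflection_apply _ F.a_ne, crd_vadd, crd_vadd, crd_vadd, crd_zero_self F.a_ne,
      crd_zero_of_inner_eq_zero F.ab, crd_zero_of_inner_eq_zero F.av]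
    simp [act₁, act₂, act₃]
    ring
  · refine F.mem_normalizer (R := ⟨false, 1, -1, 1, 0, 2 * m, 0⟩) (fun x => ?_) rfl (by simp) rfl
      Even.zero (even_two_mul m) rfl
    rw [planeReflection_apply _ F.b_ne, crd_vadd, crd_vadd, crd_vadd, crd_zero_self F.b_ne,
      crd_zero_of_inner_eq_zero F.ba, crd_zero_of_inner_eq_zero F.bv]
    simp [act₁, act₂, act₃]
    ring

/-! ### Aspects -/

omit F in
/-- The linear part of a motion, as a homomorphism on `G`. -/
def _root_.Stereohedra.linearPart (G : Subgroup Isom3) : G →* (E3 ≃ₗ[ℝ] E3) where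
  toFun g := (g : Isom3).linearIsometryEquiv.toLinearEquiv
  map_one' := by ext1 x; rfl
  map_mul' g h := by ext1 x; rfl

omit F in
theorem _root_.Stereohedra.ker_linearPart (G : Subgroup Isom3) :
    (linearPart G).ker = allTranslations.subgroupOf G := by
  ext g
  rw [MonoidHom.mem_ker, Subgroup.mem_subgroupOf]
  have key : ∀ x : E3, (g : Isom3) x = linearPart G g x + (g : Isom3) 0 := fun x => by
    have := (g : Isom3).map_vadd 0 x
    rw [vadd_eq_add, vadd_eq_add, add_zero] at this
    exact this
  constructor
  · intro h
    refine ⟨(g : Isom3) 0, fun x => ?_⟩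
    rw [key x, h, add_comm]
    rfl
  · rintro ⟨w, hw⟩
    ext1 x
    have h1 := key x
    rw [hw, hw, add_zero, add_comm w] at h1
    exact (add_right_cancel h1).symm

omit F in
theorem _root_.Stereohedra.GridMotion.Realizes.linearPart {M : GridMotion} {g : G}
    (hg : M.Realizes O a b v (g : Isom3)) (w : E3) :
    crd 0 a (linearPart G g w) = ((M.e₁ : ℤ) : ℝ) * (if M.swap then crd 0 b w else crd 0 a w) ∧
    crd 0 b (linearPart G g w) = ((M.e₂ : ℤ) : ℝ) * (if M.swap then crd 0 a w else crd 0 b w) ∧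
    crd 0 v (linearPart G g w) = ((M.e₃ : ℤ) : ℝ) * crd 0 v w := by
  have key : Stereohedra.linearPart G g w = (g : Isom3) (w + O) - (g : Isom3) O := by
    have := (g : Isom3).map_vadd O w
    rw [vadd_eq_add, vadd_eq_add] at this
    rw [this, add_sub_cancel_right]
    rfl
  obtain ⟨h1, h2, h3⟩ := hg (w + O)
  obtain ⟨g1, g2, g3⟩ := hg O
  rw [key, crd_zero_sub O, crd_zero_sub O, crd_zero_sub O, h1, h2, h3, g1, g2, g3]
  simp only [crd_vadd, act₁, act₂, act₃, crd_self]
  refine ⟨?_, ?_, ?_⟩ <;> cases M.swap <;> simp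

theorem linear_unique {M N : GridMotion} {g h : G} (hg : M.Realizes O a b v (g : Isom3))
    (hh : N.Realizes O a b v (h : Isom3)) (hgh : linearPart G g = linearPart G h) :
    M.swap = N.swap ∧ M.e₁ = N.e₁ ∧ M.e₂ = N.e₂ ∧ M.e₃ = N.e₃ := by
  have key : GridMotion.mk M.swap M.e₁ M.e₂ M.e₃ 0 0 0 = ⟨N.swap, N.e₁, N.e₂, N.e₃, 0, 0, 0⟩ := by
    have pt : ∀ x y z : ℝ, ∃ w, crd 0 a w = x ∧ crd 0 b w = y ∧ crd 0 v w = z := fun x y z => by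
      obtain ⟨p, h1, h2, h3⟩ := F.exists_point x y z
      refine ⟨p - O, ?_, ?_, ?_⟩ <;> simp [crd_zero_sub O, *]
    apply ext_of_act
    · intro x y
      obtain ⟨w, rfl, rfl, -⟩ := pt x y 0
      have h1 := (hg.linearPart w).1
      rw [hgh, (hh.linearPart w).1] at h1
      simpa [act₁] using h1.symm
    · intro x y
      obtain ⟨w, rfl, rfl, -⟩ := pt x y 0
      have h1 := (hg.linearPart w).2.1
      rw [hgh, (hh.linearPart w).2.1] at h1
      simpa [act₂] using h1.symm
    · intro z
      obtain ⟨w, -, -, rfl⟩ := pt 0 0 z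
      have h1 := (hg.linearPart w).2.2
      rw [hgh, (hh.linearPart w).2.2] at h1
      simpa [act₃] using h1.symm
  simpa using key

theorem linear_eq {M N : GridMotion} {g h : G} (hg : M.Realizes O a b v (g : Isom3))
    (hh : N.Realizes O a b v (h : Isom3)) (h₀ : M.swap = N.swap) (h₁ : M.e₁ = N.e₁)
    (h₂ : M.e₂ = N.e₂) (h₃ : M.e₃ = N.e₃) : linearPart G g = linearPart G h := by
  have crd_ext : ∀ x y : E3, crd 0 a x = crd 0 a y → crd 0 b x = crd 0 b y →
      crd 0 v x = crd 0 v y → x = y := by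
    intro x y h1 h2 h3
    have := F.ext (x := x + O) (y := y + O) (by simp [crd_vadd, h1]) (by simp [crd_vadd, h2])
      (by simp [crd_vadd, h3])
    exact add_right_cancel this
  ext1 w
  obtain ⟨h4, h5, h6⟩ := hg.linearPart w
  obtain ⟨g4, g5, g6⟩ := hh.linearPart w
  rw [h₀, h₁] at h4
  rw [h₀, h₂] at h5
  rw [h₃] at h6
  exact crd_ext _ _ (h4.trans g4.symm) (h5.trans g5.symm) (h6.trans g6.symm)

/-- Changing the parity of the vertical shift multiplies the class by `D 1 1`, which alters either
the interchange bit or the product of signs. -/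
theorem eq_of_linear_eq {e : ℤˣ} {σ τ : ZMod 2} (h₁ : (D e σ).1 = (D e τ).1)
    (h₂ : (D e σ).2.1 = (D e τ).2.1) : σ = τ := by
  by_contra hne
  have aux : ∀ σ τ : ZMod 2, σ ≠ τ → σ = 1 + τ := by decide
  have h : σ = 1 + τ := aux σ τ hne
  have h3 := F.compat 1 e 1 τ
  rw [one_mul, ← h] at h3
  rw [h3] at h₁ h₂
  have h4 := F.nontrivial
  simp only [GridClass.comp] at h₁ h₂
  rw [mul_eq_right] at h₂
  rcases h4 with h4 | h4
  · rw [h4] at h₁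
    simp at h₁
  · rw [h4] at h₂
    exact absurd h₂ (by decide)

/-- The linear parts are parametrized bijectively by `e₁`, `e₃` and the parity of `k₃`. The
interchange bit and `e₂` are then read off from `D`, so there are 2·2·2 of them. -/
theorem aspects_eq : aspects G = 8 := by
  rw [aspects, Subgroup.relIndex, ← ker_linearPart, Subgroup.index_ker]
  have exm : ∀ r : ℤˣ × ℤˣ × ZMod 2, ∃ M : GridMotion, M.IsIn D ∧ M.e₁ = r.1 ∧ M.e₃ = r.2.1 ∧
      (M.k₃ : ZMod 2) = r.2.2 := by
    rintro ⟨e, e', τ⟩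
    refine ⟨⟨(D e' τ).1, e, e * (D e' τ).2.1, e', (D e' τ).2.2.1.val, (D e' τ).2.2.2.val, τ.val⟩,
      ?_, rfl, rfl, ?_⟩
    · simp [IsIn, cls, ← mul_assoc]
    · simp
  choose M hM h₁ h₃ hk using exm
  have exg : ∀ r, ∃ g : G, (M r).Realizes O a b v (g : Isom3) := fun r => by
    obtain ⟨g, hg, hr⟩ := F.ex (M r) (hM r)
    exact ⟨⟨g, hg⟩, hr⟩
  choose g hg using exg
  have hswap : ∀ r, (M r).swap = (D r.2.1 r.2.2).1 := fun r => by
    rw [← h₃ r, ← hk r, ← hM r]; rfl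
  have he₂ : ∀ r, r.1 * (M r).e₂ = (D r.2.1 r.2.2).2.1 := fun r => by
    rw [← h₃ r, ← hk r, ← hM r, ← h₁ r]; rfl
  let f : ℤˣ × ℤˣ × ZMod 2 → (linearPart G).range := fun r => ⟨linearPart G (g r), g r, rfl⟩
  have hf : Function.Bijective f := by
    constructor
    · intro r r' h
      obtain ⟨g0, g1, g2, g3⟩ := F.linear_unique (hg r) (hg r') (congrArg Subtype.val h)
      have d1 := hswap r
      have d2 := he₂ r
      rw [g0, hswap r'] at d1
      rw [h₁, h₁] at g1
      rw [h₃, h₃] at g3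
      rw [g2, g1, he₂ r'] at d2
      rw [← g3] at d1 d2
      exact Prod.ext g1 (Prod.ext g3 (F.eq_of_linear_eq d1 d2).symm)
    · rintro ⟨_, h, rfl⟩
      obtain ⟨N, hN, hr⟩ := F.mem _ h.2
      refine ⟨(N.e₁, N.e₃, (N.k₃ : ZMod 2)), Subtype.ext ?_⟩
      refine F.linear_eq (hg _) hr ?_ (h₁ _) ?_ (h₃ _)
      · rw [hswap, ← hN]; rfl
      · have := he₂ (N.e₁, N.e₃, (N.k₃ : ZMod 2))
        rw [← hN] at this
        exact mul_left_cancel this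
  rw [← Nat.card_congr (Equiv.ofBijective f hf)]
  simp [Nat.card_eq_fintype_card]

end

end IsGridFrame

/-! ### Facets and strict neighbours -/

/-- `Q` is a strict neighbour of `P` in `S`: some point is equidistant from `P` and `Q` and strictly
farther from all other points of `S`. -/
def IsStrictNeighbour (S : Set E3) (P Q : E3) : Prop :=
  Q ∈ S ∧ Q ≠ P ∧ ∃ x, dist x P = dist x Q ∧ ∀ T ∈ S, T ≠ P → T ≠ Q → dist x P < dist x T

/-- The affine function that vanishes on the bisector of `P` and `Q` and is positive on the side
of `P`. -/
def bisectorFun (P Q x : E3) : ℝ := ‖Q‖ ^ 2 - ‖P‖ ^ 2 - 2 * inner ℝ x (Q - P)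

theorem bisectorFun_eq (P Q x : E3) : bisectorFun P Q x = dist x Q ^ 2 - dist x P ^ 2 := by
  rw [dist_eq_norm, dist_eq_norm, norm_sub_sq_real, norm_sub_sq_real, bisectorFun, inner_sub_right]
  ring

theorem bisectorFun_nonneg {P Q x : E3} : 0 ≤ bisectorFun P Q x ↔ dist x P ≤ dist x Q := by
  rw [bisectorFun_eq, sub_nonneg, sq_le_sq₀ dist_nonneg dist_nonneg]

theorem bisectorFun_eq_zero {P Q x : E3} : bisectorFun P Q x = 0 ↔ dist x P = dist x Q := by
  rw [bisectorFun_eq, sub_eq_zero, sq_eq_sq₀ dist_nonneg dist_nonneg, eq_comm]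

theorem bisectorFun_midpoint (P Q x y : E3) : bisectorFun P Q ((1 / 2 : ℝ) • x + (1 / 2 : ℝ) • y) =
    (bisectorFun P Q x + bisectorFun P Q y) / 2 := by
  simp only [bisectorFun, inner_add_left, inner_smul_left]
  simp
  ring

/-- The closed Voronoi region of `P` with respect to `S`. -/
def voronoiRegion (S : Set E3) (P : E3) : Set E3 := {x | ∀ Q ∈ S, dist x P ≤ dist x Q}

theorem convex_voronoiRegion (S : Set E3) (P : E3) : Convex ℝ (voronoiRegion S P) := by
  intro x hx y hy s t hs ht hst Q hQ
  have h1 := bisectorFun_nonneg.2 (hx Q hQ)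
  have h2 := bisectorFun_nonneg.2 (hy Q hQ)
  rw [← bisectorFun_nonneg]
  have : bisectorFun P Q (s • x + t • y) = s * bisectorFun P Q x + t * bisectorFun P Q y := by
    obtain rfl : s = 1 - t := by linarith
    simp only [bisectorFun, inner_add_left, inner_smul_left]
    simp
    ring
  rw [this]
  positivity

/-- Only finitely many competitors lie within `dist x P + 2` of `x`, so the strict inequalities hold
with a common gap `δ`. Moving `x` by less than `min (δ / 2) 1` preserves all of them, and the
remaining points are too far away to matter. -/
theorem exists_ball_subset_voronoiRegion {S : Set E3}
    (hS : ∀ x r, (S ∩ Metric.closedBall x r).Finite) {P x : E3}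
    (h : ∀ Q ∈ S, Q ≠ P → dist x P < dist x Q) : ∃ r > 0, Metric.ball x r ⊆ voronoiRegion S P := by
  have hfin := (hS x (dist x P + 2)).subset (Set.inter_subset_inter_left _ Set.sdiff_subset :
    (S \ {P}) ∩ Metric.closedBall x (dist x P + 2) ⊆ _)
  obtain ⟨δ, hδ, hmin⟩ : ∃ δ > 0, ∀ Q ∈ (S \ {P}) ∩ Metric.closedBall x (dist x P + 2),
      dist x P + δ ≤ dist x Q := by
    rcases ((S \ {P}) ∩ Metric.closedBall x (dist x P + 2)).eq_empty_or_nonempty with he | hne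
    · exact ⟨1, one_pos, by simp [he]⟩
    · obtain ⟨Q₀, hQ₀, hm⟩ := Set.exists_min_image _ (fun Q => dist x Q) hfin hne
      refine ⟨dist x Q₀ - dist x P, sub_pos.2 (h Q₀ hQ₀.1.1 hQ₀.1.2), fun Q hQ => ?_⟩
      have := hm Q hQ
      linarith
  refine ⟨min (δ / 2) 1, by positivity, fun y hy Q hQ => ?_⟩
  rw [Metric.mem_ball] at hy
  have hy1 := hy.trans_le (min_le_left _ _)
  have hy2 := hy.trans_le (min_le_right _ _)
  by_cases hQP : Q = P
  · rw [hQP]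
  have t1 := dist_triangle y x P
  have t2 := dist_triangle x y Q
  rw [dist_comm x y] at t2
  by_cases hc : dist x Q ≤ dist x P + 2
  · have := hmin Q ⟨⟨hQ, hQP⟩, by rwa [Metric.mem_closedBall, dist_comm]⟩
    linarith
  · linarith

theorem finrank_orthogonal_singleton {u : E3} (hu : u ≠ 0) :
    Module.finrank ℝ (ℝ ∙ u)ᗮ = 2 := by
  have : Fact (Module.finrank ℝ E3 = 2 + 1) := ⟨by simp⟩
  exact Submodule.finrank_orthogonal_span_singleton hu

theorem vectorSpan_le_of_bisector {P Q : E3} {F : Set E3}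
    (h : ∀ x ∈ F, bisectorFun P Q x = 0) : vectorSpan ℝ F ≤ (ℝ ∙ (Q - P))ᗮ := by
  rw [vectorSpan_def, Submodule.span_le]
  rintro _ ⟨x, hx, y, hy, rfl⟩
  rw [SetLike.mem_coe, Submodule.mem_orthogonal_singleton_iff_inner_left]
  have h1 := h x hx
  have h2 := h y hy
  simp only [bisectorFun, vsub_eq_sub, inner_sub_left] at *
  linarith

/-- A point of the facet that lies on as few bisectors as possible behaves like a relative interior
point. Every bisector through it contains the whole facet, and a two-dimensional set lies in just
one of these planes. -/
theorem exists_strictNeighbour_of_facet {S : Set E3}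
    (hS : ∀ x r, (S ∩ Metric.closedBall x r).Finite) {P : E3} {F : Set E3}
    (hF : F ∈ facets (voronoiRegion S P)) :
    ∃ Q, IsStrictNeighbour S P Q ∧ F = {x ∈ voronoiRegion S P | dist x P = dist x Q} := by
  obtain ⟨hexp, hrank⟩ := hF
  have hne : F.Nonempty := by
    by_contra h
    rw [Set.not_nonempty_iff_eq_empty] at h
    rw [h, vectorSpan_empty, finrank_bot] at hrank
    exact absurd hrank (by norm_num)
  obtain ⟨l, hl⟩ := hexp hne
  have hconv : Convex ℝ F := hexp.convex (convex_voronoiRegion S P)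
  have hFK : F ⊆ voronoiRegion S P := hexp.subset
  let T : E3 → Set E3 := fun x => {Q ∈ S | Q ≠ P ∧ bisectorFun P Q x = 0}
  have hT : ∀ x, (T x).Finite := fun x => (hS x (dist x P)).subset fun Q hQ => by
    refine ⟨hQ.1, ?_⟩
    rw [Metric.mem_closedBall, dist_comm]
    exact (bisectorFun_eq_zero.1 hQ.2.2).ge
  obtain ⟨x₀, hx₀, hmin⟩ : ∃ x₀ ∈ F, ∀ y ∈ F, (T x₀).ncard ≤ (T y).ncard := by
    have := WellFounded.has_min (measure fun x : E3 => (T x).ncard).wf F hne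
    obtain ⟨x₀, hx₀, h⟩ := this
    exact ⟨x₀, hx₀, fun y hy => not_lt.1 (h y hy)⟩
  -- The bisector functions are affine and nonnegative on the region, so one that vanishes at a
  -- midpoint vanishes at both ends. Minimality at `x₀` then forces its bisectors to pass through
  -- `y` as well.
  have hsub : ∀ y ∈ F, T x₀ ⊆ T y := by
    intro y hy
    have hz : (1 / 2 : ℝ) • x₀ + (1 / 2 : ℝ) • y ∈ F :=
      hconv hx₀ hy (by norm_num) (by norm_num) (by norm_num)
    have hz' : T ((1 / 2 : ℝ) • x₀ + (1 / 2 : ℝ) • y) ⊆ T x₀ ∩ T y := by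
      rintro Q ⟨hQ, hQP, h⟩
      rw [bisectorFun_midpoint] at h
      have h1 := bisectorFun_nonneg.2 (hFK hx₀ Q hQ)
      have h2 := bisectorFun_nonneg.2 (hFK hy Q hQ)
      exact ⟨⟨hQ, hQP, by linarith⟩, ⟨hQ, hQP, by linarith⟩⟩
    have heq := Set.eq_of_subset_of_ncard_le (hz'.trans Set.inter_subset_left) (hmin _ hz) (hT x₀)
    rw [← heq]
    exact hz'.trans Set.inter_subset_right
  -- Otherwise `x₀` is interior to the region. The exposing functional, being maximal at an interior
  -- point, is constant on a ball by central symmetry, so the face would contain this ball and be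
  -- three-dimensional.
  obtain ⟨Q, hQ⟩ : (T x₀).Nonempty := by
    by_contra hemp
    rw [Set.not_nonempty_iff_eq_empty] at hemp
    obtain ⟨r, hr, hball⟩ := exists_ball_subset_voronoiRegion hS (P := P) (x := x₀) (by
      intro Q hQ hQP
      refine lt_of_le_of_ne (hFK hx₀ Q hQ) fun h => ?_
      have : Q ∈ T x₀ := ⟨hQ, hQP, bisectorFun_eq_zero.2 h⟩
      rw [hemp] at this
      exact this)
    have hx₀l : ∀ y ∈ voronoiRegion S P, l y ≤ l x₀ := by
      rw [hl] at hx₀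
      exact hx₀.2
    have hballF : Metric.ball x₀ r ⊆ F := by
      intro y hy
      have hy' : (2 : ℝ) • x₀ - y ∈ Metric.ball x₀ r := by
        rw [Metric.mem_ball, dist_eq_norm] at *
        rwa [show (2 : ℝ) • x₀ - y - x₀ = -(y - x₀) by module, norm_neg]
      have h1 := hx₀l _ (hball hy')
      rw [map_sub, map_smul, smul_eq_mul] at h1
      rw [hl]
      exact ⟨hball hy, fun z hz => by linarith [hx₀l z hz]⟩
    have h1 : affineSpan ℝ (Metric.ball x₀ r) = ⊤ :=
      Metric.isOpen_ball.affineSpan_eq_top (Metric.nonempty_ball.2 hr)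
    have h2 : vectorSpan ℝ F = ⊤ := by
      have h3 : affineSpan ℝ F = ⊤ := by
        rw [eq_top_iff, ← h1]
        exact affineSpan_mono ℝ hballF
      rw [← direction_affineSpan, h3, AffineSubspace.direction_top]
    rw [h2, finrank_top] at hrank
    simp at hrank
  have hFQ : ∀ R ∈ T x₀, ∀ x ∈ F, bisectorFun P R x = 0 := fun R hR x hx => (hsub x hx hR).2.2
  have hspan : ∀ R ∈ T x₀, vectorSpan ℝ F = (ℝ ∙ (R - P))ᗮ := fun R hR =>
    Submodule.eq_of_le_of_finrank_eq (vectorSpan_le_of_bisector (hFQ R hR))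
      (by rw [hrank, finrank_orthogonal_singleton (sub_ne_zero.2 hR.2.1)])
  -- Both bisectors are parallel to the span of the facet, so `R - P = c (Q - P)`. Equidistance from
  -- `x₀` then gives `c (c - 1) = 0`, and `c = 0` would mean `R = P`.
  have huniq : ∀ R ∈ T x₀, R = Q := by
    intro R hR
    have h1 : R - P ∈ (ℝ ∙ (Q - P)) := by
      rw [← Submodule.orthogonal_orthogonal (ℝ ∙ (Q - P)), ← hspan Q hQ, hspan R hR,
        Submodule.orthogonal_orthogonal]
      exact Submodule.mem_span_singleton_self _
    obtain ⟨c, hc⟩ := Submodule.mem_span_singleton.1 h1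
    have e : ∀ R ∈ T x₀, ‖R - P‖ ^ 2 = 2 * inner ℝ (x₀ - P) (R - P) := by
      intro R hR
      have h2 := bisectorFun_eq_zero.1 hR.2.2
      have h3 := norm_sub_sq_real (x₀ - P) (R - P)
      rw [dist_eq_norm, dist_eq_norm] at h2
      rw [show x₀ - P - (R - P) = x₀ - R by abel, ← h2] at h3
      linarith
    have eQ := e Q hQ
    have eR := e R hR
    rw [← hc, norm_smul, inner_smul_right, mul_pow, Real.norm_eq_abs, sq_abs] at eR
    have hQP : 0 < ‖Q - P‖ ^ 2 := by
      have := norm_pos_iff.2 (sub_ne_zero.2 hQ.2.1)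
      positivity
    have hc0 : c ≠ 0 := by
      rintro rfl
      rw [zero_smul, eq_comm, sub_eq_zero] at hc
      exact hR.2.1 hc
    have h4 : c * (c - 1) * ‖Q - P‖ ^ 2 = 0 := by linear_combination eR - c * eQ
    have h5 : c = 1 := by
      rcases mul_eq_zero.1 h4 with h5 | h5
      · rcases mul_eq_zero.1 h5 with h6 | h6
        · exact absurd h6 hc0
        · linarith
      · exact absurd h5 hQP.ne'
    rw [h5, one_smul] at hc
    exact (sub_left_injective hc).symm
  refine ⟨Q, ⟨hQ.1, hQ.2.1, x₀, bisectorFun_eq_zero.1 hQ.2.2, fun R hR hRP hRQ => ?_⟩, ?_⟩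
  · refine lt_of_le_of_ne (hFK hx₀ R hR) fun h => hRQ (huniq R ⟨hR, hRP, bisectorFun_eq_zero.2 h⟩)
  · ext x
    refine ⟨fun hx => ⟨hFK hx, bisectorFun_eq_zero.1 (hFQ Q hQ x hx)⟩, fun ⟨hx, hxQ⟩ => ?_⟩
    -- Conversely, the span of the facet is the whole direction of the bisector, and the exposing
    -- functional is constant along it. So every region point on the bisector also attains the
    -- maximum.
    have hdir : x - x₀ ∈ vectorSpan ℝ F := by
      rw [hspan Q hQ, Submodule.mem_orthogonal_singleton_iff_inner_left, inner_sub_left]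
      have h1 := bisectorFun_eq_zero.2 hxQ
      have h2 := hQ.2.2
      simp only [bisectorFun] at h1 h2
      linarith
    have hker : vectorSpan ℝ F ≤ LinearMap.ker (l : E3 →ₗ[ℝ] ℝ) := by
      rw [vectorSpan_def, Submodule.span_le]
      rintro _ ⟨y, hy, z, hz, rfl⟩
      rw [hl] at hy hz
      have h1 := hy.2 z hz.1
      have h2 := hz.2 y hy.1
      simp only [vsub_eq_sub, SetLike.mem_coe, LinearMap.mem_ker, map_sub,
        ContinuousLinearMap.coe_coe]
      linarith
    have h1 : l (x - x₀) = 0 := hker hdir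
    rw [map_sub, sub_eq_zero] at h1
    rw [hl] at hx₀ ⊢
    exact ⟨hx, fun y hy => (hx₀.2 y hy).trans h1.ge⟩

/-- The neighbour assigned to a facet determines it, as the part of the region lying on the
bisector. -/
theorem encard_facets_le {S : Set E3} (hS : ∀ x r, (S ∩ Metric.closedBall x r).Finite) (P : E3) :
    (facets (voronoiRegion S P)).encard ≤ {Q | IsStrictNeighbour S P Q}.encard := by
  choose! f hf hf' using fun F hF => exists_strictNeighbour_of_facet hS (P := P) (F := F) hF
  refine Set.encard_le_encard_of_injOn (f := f) (fun F hF => hf F hF) fun F hF F' hF' h => ?_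
  rw [hf' F hF, hf' F' hF', h]

/-! ### Labelling points by squares of the integral grid -/

/-- The point of the segment `[m, m + 1]` obtained from `p ∈ [0, 1]` by repeated reflection in
integers. -/
def gridPt (p : ℝ) (m : ℤ) : ℝ := if Even m then m + p else m + 1 - p

/-- The effect on the parameter `p` of a shift of the given parity. -/
def fold (κ : ZMod 2) (p : ℝ) : ℝ := if κ = 0 then p else 1 - p

theorem gridPt_add (p : ℝ) (m k : ℤ) : gridPt p m + k = gridPt (fold k p) (m + k) := by
  unfold gridPt fold
  simp only [ZMod.intCast_eq_zero_iff_even]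
  by_cases hm : Even m <;> by_cases hk : Even k <;> simp [hm, hk, Int.even_add] <;> ring

/-- Reversing a segment exchanges its ends: `[m, m + 1]` goes to the segment starting at `k - 1 -
m`. The extra `-1` is why each sign reversal contributes to the colour. -/
theorem neg_gridPt_add (p : ℝ) (m k : ℤ) : -gridPt p m + k = gridPt (fold k p) (k - 1 - m) := by
  unfold gridPt fold
  have h : Even (k - 1 - m) ↔ ¬(Even k ↔ Even m) := by
    rw [Int.even_sub, Int.even_sub_one]; tauto
  simp only [ZMod.intCast_eq_zero_iff_even, h]
  by_cases hm : Even m <;> by_cases hk : Even k <;> simp [hm, hk] <;> ring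

theorem fold_mem {κ : ZMod 2} {p : ℝ} (hp : p ∈ Set.Icc (0 : ℝ) 1) : fold κ p ∈ Set.Icc (0 : ℝ) 1 := by
  unfold fold
  split_ifs
  · exact hp
  · exact ⟨by linarith [hp.2], by linarith [hp.1]⟩

theorem fold_mem_Ioo {κ : ZMod 2} {p : ℝ} : fold κ p ∈ Set.Ioo (0 : ℝ) 1 ↔ p ∈ Set.Ioo (0 : ℝ) 1 := by
  unfold fold
  split_ifs
  · rfl
  · constructor <;> rintro ⟨h1, h2⟩ <;> constructor <;> linarith

theorem gridPt_mem {p : ℝ} (hp : p ∈ Set.Icc (0 : ℝ) 1) (m : ℤ) :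
    (m : ℝ) ≤ gridPt p m ∧ gridPt p m ≤ m + 1 := by
  unfold gridPt
  obtain ⟨h1, h2⟩ := hp
  split_ifs <;> constructor <;> linarith

theorem gridPt_mem_Ioo {p : ℝ} (hp : p ∈ Set.Ioo (0 : ℝ) 1) (m : ℤ) :
    (m : ℝ) < gridPt p m ∧ gridPt p m < m + 1 := by
  unfold gridPt
  obtain ⟨h1, h2⟩ := hp
  split_ifs <;> constructor <;> linarith

theorem gridPt_add_two (p : ℝ) (m : ℤ) : gridPt p (m + 2) = gridPt p m + 2 := by
  have h := gridPt_add p m 2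
  rw [show fold ((2 : ℤ) : ZMod 2) p = p from if_pos (by decide)] at h
  rw [← h]; norm_num

theorem gridPt_sub_two (p : ℝ) (m : ℤ) : gridPt p (m - 2) = gridPt p m - 2 := by
  have h := gridPt_add_two p (m - 2)
  rw [sub_add_cancel] at h
  linarith

theorem gridPt_add_one (p : ℝ) (m : ℤ) : gridPt p (m + 1) = 2 * (m + 1) - gridPt p m := by
  have h : Even (m + 1) ↔ ¬Even m := Int.even_add_one
  unfold gridPt
  simp only [h]
  by_cases hm : Even m <;> simp only [hm, not_true, not_false_iff, if_true, if_false] <;>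
    push_cast <;> ring

theorem gridPt_sub_one (p : ℝ) (m : ℤ) : gridPt p (m - 1) = 2 * m - gridPt p m := by
  have h : Even (m - 1) ↔ ¬Even m := Int.even_sub_one
  unfold gridPt
  simp only [h]
  by_cases hm : Even m <;> simp only [hm, not_true, not_false_iff, if_true, if_false] <;>
    push_cast <;> ring

theorem exists_gridPt (x : ℝ) : ∃ p ∈ Set.Icc (0 : ℝ) 1, ∃ m : ℤ, x = gridPt p m := by
  have h1 := Int.floor_le x
  have h2 := Int.lt_floor_add_one x
  by_cases hm : Even ⌊x⌋
  · exact ⟨x - ⌊x⌋, ⟨by linarith, by linarith⟩, ⌊x⌋, by simp [gridPt, hm]⟩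
  · exact ⟨⌊x⌋ + 1 - x, ⟨by linarith, by linarith⟩, ⌊x⌋, by simp [gridPt, hm]⟩

/-- The product of the distances to the two ends of the segment is the same for all reflected
copies, so inequalities between such products do not depend on labels. -/
theorem gridPt_sub_mul (p : ℝ) (m : ℤ) :
    (gridPt p m - m) * (m + 1 - gridPt p m) = p * (1 - p) := by
  unfold gridPt
  split_ifs <;> ring

theorem gridPt_even_shift (p : ℝ) (m k : ℤ) : gridPt p (m + 2 * k) = gridPt p m + 2 * k := by
  unfold gridPt
  by_cases hm : Even m <;> simp [hm, Int.even_add] <;> ring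

/-- Offsets between labels of neighbouring points in one orbit of `p2`. -/
def IsGridOffset (i j : ℤ) : Prop :=
  ((i = 1 ∨ i = -1) ∧ (j = 1 ∨ j = -1)) ∨ ((i = 2 ∨ i = -2) ∧ j = 0) ∨ (i = 0 ∧ (j = 2 ∨ j = -2))

/-- Weighted squared distance from `(x, y)` to the point with label `(m, n)`. -/
def labelDist (α β p q x y : ℝ) (m n : ℤ) : ℝ :=
  α * (x - gridPt p m) ^ 2 + β * (y - gridPt q n) ^ 2

/-- The open cross formed by the square with label `(m, n)` and its four neighbours. -/
def InCross (x y : ℝ) (m n : ℤ) : Prop :=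
  (m : ℝ) - 1 < x ∧ x < m + 2 ∧ (n : ℝ) - 1 < y ∧ y < n + 2 ∧
    (((m : ℝ) < x ∧ x < m + 1) ∨ ((n : ℝ) < y ∧ y < n + 1))

/-- The bisectors with the translates by two units confine each coordinate to distance less than 1
from the centre. Each diagonal neighbour is the image under the half-turn about a corner of the unit
square, and its bisector passes through that corner. This bisector cuts off the quadrant beyond the
corner, so `x` and `y` cannot both leave their strips. -/
theorem inCross_of_labelDist {α β p q x y : ℝ} {m n : ℤ} (hα : 0 < α) (hβ : 0 < β)
    (hp : p ∈ Set.Icc (0 : ℝ) 1) (hq : q ∈ Set.Icc (0 : ℝ) 1)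
    (h : ∀ i j : ℤ, IsGridOffset i j →
      labelDist α β p q x y m n < labelDist α β p q x y (m + i) (n + j)) : InCross x y m n := by
  have hX := gridPt_mem hp m
  have hY := gridPt_mem hq n
  have h1 := h 2 0 (by simp [IsGridOffset])
  have h2 := h (-2) 0 (by simp [IsGridOffset])
  have h3 := h 0 2 (by simp [IsGridOffset])
  have h4 := h 0 (-2) (by simp [IsGridOffset])
  have h5 := h 1 1 (by simp [IsGridOffset])
  have h6 := h 1 (-1) (by simp [IsGridOffset])
  have h7 := h (-1) 1 (by simp [IsGridOffset])
  have h8 := h (-1) (-1) (by simp [IsGridOffset])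
  simp only [labelDist, add_zero, ← sub_eq_add_neg, gridPt_add_two, gridPt_sub_two, gridPt_add_one,
    gridPt_sub_one] at h1 h2 h3 h4 h5 h6 h7 h8
  generalize gridPt p m = X at *
  generalize gridPt q n = Y at *
  have k1 : x < X + 1 := by
    have : 0 < α * (4 * (X + 1 - x)) := by linarith
    have := pos_of_mul_pos_right this hα.le
    linarith
  have k2 : X - 1 < x := by
    have : 0 < α * (4 * (x - X + 1)) := by linarith
    have := pos_of_mul_pos_right this hα.le
    linarith
  have k3 : y < Y + 1 := by
    have : 0 < β * (4 * (Y + 1 - y)) := by linarith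
    have := pos_of_mul_pos_right this hβ.le
    linarith
  have k4 : Y - 1 < y := by
    have : 0 < β * (4 * (y - Y + 1)) := by linarith
    have := pos_of_mul_pos_right this hβ.le
    linarith
  -- Each diagonal inequality, divided by 4 and written relative to the corner, which is the centre
  -- of the half-turn.
  have m5 : 0 < α * ((m + 1 - X) * (m + 1 - x)) + β * ((n + 1 - Y) * (n + 1 - y)) := by linarith
  have m6 : 0 < α * ((m + 1 - X) * (m + 1 - x)) + β * ((Y - n) * (y - n)) := by linarith
  have m7 : 0 < α * ((X - m) * (x - m)) + β * ((n + 1 - Y) * (n + 1 - y)) := by linarith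
  have m8 : 0 < α * ((X - m) * (x - m)) + β * ((Y - n) * (y - n)) := by linarith
  obtain ⟨hX1, hX2⟩ := hX
  obtain ⟨hY1, hY2⟩ := hY
  refine ⟨by linarith, by linarith, by linarith, by linarith, ?_⟩
  have neg : ∀ {c u w : ℝ}, 0 < c → 0 ≤ u → w ≤ 0 → c * (u * w) ≤ 0 := fun hc hu hw =>
    mul_nonpos_of_nonneg_of_nonpos hc.le (mul_nonpos_of_nonneg_of_nonpos hu hw)
  by_contra hcon
  rw [not_or, not_and_or, not_and_or, not_lt, not_lt, not_lt, not_lt] at hcon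
  rcases hcon with ⟨hx | hx, hy | hy⟩
  · linarith [neg hα (sub_nonneg.2 hX1) (sub_nonpos.2 hx), neg hβ (sub_nonneg.2 hY1) (sub_nonpos.2 hy)]
  · linarith [neg hα (sub_nonneg.2 hX1) (sub_nonpos.2 hx), neg hβ (sub_nonneg.2 hY2) (sub_nonpos.2 hy)]
  · linarith [neg hα (sub_nonneg.2 hX2) (sub_nonpos.2 hx), neg hβ (sub_nonneg.2 hY1) (sub_nonpos.2 hy)]
  · linarith [neg hα (sub_nonneg.2 hX2) (sub_nonpos.2 hx), neg hβ (sub_nonneg.2 hY2) (sub_nonpos.2 hy)]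

/-- A common point of two crosses lies over an arm or the central square of each. If both lie in
strips of the same direction, the labels agree in that direction; if the directions differ, both
offsets are at most 1. -/
theorem InCross.offset {x y : ℝ} {m n m' n' : ℤ} (h : InCross x y m n) (h' : InCross x y m' n') :
    (-1 ≤ m' - m ∧ m' - m ≤ 1 ∧ -1 ≤ n' - n ∧ n' - n ≤ 1) ∨
    (m' = m ∧ -2 ≤ n' - n ∧ n' - n ≤ 2) ∨ (n' = n ∧ -2 ≤ m' - m ∧ m' - m ≤ 2) := by
  have key : ∀ {i j : ℤ} {z : ℝ}, (i : ℝ) < z → z < j → i < j := fun h1 h2 => by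
    exact_mod_cast h1.trans h2
  obtain ⟨a1, a2, a3, a4, a5⟩ := h
  obtain ⟨b1, b2, b3, b4, b5⟩ := h'
  have c1 : m - 1 < m' + 2 := key (by push_cast; exact a1) (by push_cast; exact b2)
  have c2 : m' - 1 < m + 2 := key (by push_cast; exact b1) (by push_cast; exact a2)
  have c3 : n - 1 < n' + 2 := key (by push_cast; exact a3) (by push_cast; exact b4)
  have c4 : n' - 1 < n + 2 := key (by push_cast; exact b3) (by push_cast; exact a4)
  rcases a5 with ⟨a5, a6⟩ | ⟨a5, a6⟩ <;> rcases b5 with ⟨b5, b6⟩ | ⟨b5, b6⟩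
  · have d1 : m < m' + 1 := key a5 (by push_cast; exact b6)
    have d2 : m' < m + 1 := key b5 (by push_cast; exact a6)
    omega
  · have d1 : m < m' + 2 := key a5 (by push_cast; exact b2)
    have d2 : m' - 1 < m + 1 := key (by push_cast; exact b1) (by push_cast; exact a6)
    have d3 : n - 1 < n' + 1 := key (by push_cast; exact a3) (by push_cast; exact b6)
    have d4 : n' < n + 2 := key b5 (by push_cast; exact a4)
    omega
  · have d1 : m - 1 < m' + 1 := key (by push_cast; exact a1) (by push_cast; exact b6)
    have d2 : m' < m + 2 := key b5 (by push_cast; exact a2)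
    have d3 : n < n' + 2 := key a5 (by push_cast; exact b4)
    have d4 : n' - 1 < n + 1 := key (by push_cast; exact b3) (by push_cast; exact a6)
    omega
  · have d1 : n < n' + 1 := key a5 (by push_cast; exact b6)
    have d2 : n' < n + 1 := key b5 (by push_cast; exact a6)
    omega

theorem lt_of_labelDist_lt {α β p q x y : ℝ} {m n : ℤ} (hα : 0 < α)
    (h : labelDist α β p q x y m n < labelDist α β p q x y (m + 2) n) : x < gridPt p m + 1 := by
  simp only [labelDist, gridPt_add_two] at h
  have : 0 < α * (4 * (gridPt p m + 1 - x)) := by linarith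
  have := pos_of_mul_pos_right this hα.le
  linarith

theorem lt_of_labelDist_lt' {α β p q x y : ℝ} {m n : ℤ} (hα : 0 < α)
    (h : labelDist α β p q x y m n < labelDist α β p q x y (m - 2) n) : gridPt p m - 1 < x := by
  simp only [labelDist, gridPt_sub_two] at h
  have : 0 < α * (4 * (x - gridPt p m + 1)) := by linarith
  have := pos_of_mul_pos_right this hα.le
  linarith

theorem labelDist_swap (α β p q x y : ℝ) (m n : ℤ) :
    labelDist α β p q x y m n = labelDist β α q p y x n m := by
  simp [labelDist, add_comm]

/-- If the point two squares to the right (or left) is a neighbour, then the cell is cut by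
vertical sides rather than horizontal ones. -/
theorem lt_of_labelDist_eq {α β p q x y : ℝ} {m n s : ℤ} (hα : 0 < α)
    (hq : q ∈ Set.Icc (0 : ℝ) 1) (hs : s = 1 ∨ s = -1)
    (h : labelDist α β p q x y m n = labelDist α β p q x y (m + 2 * s) n)
    (h₁ : labelDist α β p q x y m n < labelDist α β p q x y (m + s) (n + 1))
    (h₂ : labelDist α β p q x y m n < labelDist α β p q x y (m + s) (n - 1)) :
    α * (p * (1 - p)) < β * (q * (1 - q)) := by
  obtain ⟨hY1, hY2⟩ := gridPt_mem hq n
  rw [← gridPt_sub_mul p m, ← gridPt_sub_mul q n]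
  simp only [labelDist, gridPt_even_shift] at h
  -- A convex combination with weights `Y - n` and `n + 1 - Y`. It eliminates `y`, since `(n + 1 -
  -- y) + (y - n) = 1`.
  have comb : ∀ {A Y y : ℝ}, (n : ℝ) ≤ Y → Y ≤ n + 1 → A < β * ((n + 1 - Y) * (n + 1 - y)) →
      A < β * ((Y - n) * (y - n)) → A < β * ((Y - n) * (n + 1 - Y)) := by
    intro A Y y g1 g2 g3 g4
    rcases g1.eq_or_lt with g1 | g1
    · subst g1
      have : A < 0 := by linarith
      linarith
    · have t1 := mul_lt_mul_of_pos_right g3 (sub_pos.2 g1)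
      have t2 := mul_le_mul_of_nonneg_right g4.le (sub_nonneg.2 g2)
      linarith
  rcases hs with rfl | rfl
  · simp only [labelDist, gridPt_add_one, gridPt_sub_one] at h₁ h₂
    push_cast at h
    -- The bisector with the point two units away is the line midway. On it the horizontal term of
    -- the corner inequalities becomes `-α p (1 - p)`.
    have hx : x = gridPt p m + 1 := by
      have : α * (4 * (gridPt p m + 1 - x)) = 0 := by linarith
      rcases mul_eq_zero.1 this with h | h
      · exact absurd h hα.ne'
      · linarith
    subst hx
    apply comb (y := y) hY1 hY2 <;> linarith
  · rw [← sub_eq_add_neg] at h₁ h₂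
    simp only [labelDist, gridPt_add_one, gridPt_sub_one] at h₁ h₂
    push_cast at h
    have hx : x = gridPt p m - 1 := by
      have : α * (4 * (gridPt p m - 1 - x)) = 0 := by linarith
      rcases mul_eq_zero.1 this with h | h
      · exact absurd h hα.ne'
      · linarith
    subst hx
    apply comb (y := y) hY1 hY2 <;> linarith

/-- The horizontal coordinates of `Q` are the grid point with parameters `p`, `q` in the square
with label `(m, n)`. -/
def HasLabel (O a b : E3) (p q : ℝ) (m n : ℤ) (Q : E3) : Prop :=
  crd O a Q = gridPt p m ∧ crd O b Q = gridPt q n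

/-- When `p` is 0 or 1, two adjacent segments share the same point, but fixing the parity of `m + n`
removes the ambiguity as long as the other parameter is interior. Over a corner this fails, which is
why corners form a separate case later. -/
theorem gridPt_injective {p q : ℝ} {m n m' n' : ℤ} (hc : p ∈ Set.Ioo (0 : ℝ) 1 ∨ q ∈ Set.Ioo (0 : ℝ) 1)
    (hm : gridPt p m = gridPt p m') (hn : gridPt q n = gridPt q n') (h : Even (m + n + (m' + n'))) :
    m = m' ∧ n = n' := by
  have eqI : ∀ {p : ℝ} {m m' : ℤ}, p ∈ Set.Ioo (0 : ℝ) 1 → gridPt p m = gridPt p m' → m = m' := by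
    intro p m m' hp h
    obtain ⟨h1, h2⟩ := gridPt_mem_Ioo hp m
    obtain ⟨h3, h4⟩ := gridPt_mem_Ioo hp m'
    rw [h] at h1 h2
    have a1 : m < m' + 1 := by exact_mod_cast h1.trans h4
    have a2 : m' < m + 1 := by exact_mod_cast h3.trans h2
    omega
  have eqE : ∀ {p : ℝ} {m m' : ℤ}, Even (m + m') → gridPt p m = gridPt p m' → m = m' := by
    intro p m m' he h
    obtain ⟨k, hk⟩ : Even (m' - m) := by
      rw [Int.even_sub, ← Int.even_add, add_comm]; exact he
    obtain rfl : m' = m + 2 * k := by omega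
    rw [gridPt_even_shift] at h
    have : (k : ℝ) = 0 := by linarith
    have : k = 0 := by exact_mod_cast this
    omega
  rcases hc with hp | hq
  · obtain rfl := eqI hp hm
    refine ⟨rfl, eqE ?_ hn⟩
    rw [show m + n + (m + n') = 2 * m + (n + n') by ring, Int.even_add] at h
    exact h.1 (even_two_mul m)
  · obtain rfl := eqI hq hn
    refine ⟨eqE ?_ hm, rfl⟩
    rw [show m + n + (m' + n) = 2 * n + (m + m') by ring, Int.even_add] at h
    exact h.1 (even_two_mul n)

/-- A shift `k` changes the parity of a label by `k`, and a sign reversal changes it by one more.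
Adding both coordinates gives the colour of the class. -/
theorem GridMotion.Realizes.hasLabel {M : GridMotion} {O a b v : E3} {g : Isom3}
    (hg : M.Realizes O a b v g) {p q : ℝ} {m n : ℤ} {P : E3} (hP : HasLabel O a b p q m n P) :
    ∃ m' n' : ℤ, HasLabel O a b (fold M.cls.2.2.1 (if M.cls.1 then q else p))
      (fold M.cls.2.2.2 (if M.cls.1 then p else q)) m' n' (g P) ∧
      ((m' + n' : ℤ) : ZMod 2) = ((m + n : ℤ) : ZMod 2) + M.cls.colour := by
  obtain ⟨h1, h2, -⟩ := hg P
  rw [hP.1, hP.2] at h1 h2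
  obtain ⟨s, e₁, e₂, e₃, k₁, k₂, k₃⟩ := M
  have key : ∀ (e : ℤˣ) (p : ℝ) (m k : ℤ), ∃ m' : ℤ,
      ((e : ℤ) : ℝ) * gridPt p m + k = gridPt (fold k p) m' ∧
        (m' : ZMod 2) = m + k + if e = 1 then 0 else 1 := by
    intro e p m k
    rcases Int.units_eq_one_or e with rfl | rfl
    · exact ⟨m + k, by simpa using gridPt_add p m k, by simp⟩
    · refine ⟨k - 1 - m, by simpa using neg_gridPt_add p m k, ?_⟩
      rw [if_neg (by decide)]
      push_cast
      generalize (k : ZMod 2) = k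
      generalize (m : ZMod 2) = m
      revert k m
      decide
  have col : ∀ (m n k l : ZMod 2) (e f : ℤˣ), m + k + (if e = 1 then 0 else 1) +
      (n + l + (if f = 1 then 0 else 1)) = m + n + (k + l + if e * f = 1 then 0 else 1) := by
    decide
  cases s
  · obtain ⟨m', hm, hm'⟩ := key e₁ p m k₁
    obtain ⟨n', hn, hn'⟩ := key e₂ q n k₂
    refine ⟨m', n', ⟨h1.trans hm, h2.trans hn⟩, ?_⟩
    push_cast
    rw [hm', hn', col]
    rfl
  · obtain ⟨m', hm, hm'⟩ := key e₁ q n k₁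
    obtain ⟨n', hn, hn'⟩ := key e₂ p m k₂
    refine ⟨m', n', ⟨h1.trans hm, h2.trans hn⟩, ?_⟩
    push_cast
    rw [hm', hn', col, add_comm (n : ZMod 2)]
    rfl

/-! ### Horizontal orbits and distances in terms of labels -/

namespace IsGridFrame

variable {G : Subgroup Isom3} {O a b v : E3} {D : ℤˣ → ZMod 2 → GridClass}

section

variable (F : IsGridFrame G O a b v D)

include F

theorem exists_realizes_isP2 {M : GridMotion} (hM : M.IsP2) :
    ∃ g ∈ horizontalSubgroup G v, M.Realizes O a b v g := by
  obtain ⟨g, -, hr⟩ := F.ex M (F.isIn_of_isP2 hM)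
  exact ⟨g, (F.mem_horizontal_iff_isP2 hr).2 hM, hr⟩

/-- With `exists_hasLabel_of_mem_orbit`, this identifies a `p2` orbit with the labels of one
chessboard colour, for fixed parameters and height. Two such labels differ evenly in both
directions, giving a translation, or oddly in both, giving a half-turn. -/
theorem mem_orbit_of_hasLabel {p q : ℝ} {m n m' n' : ℤ} {T S : E3} (hT : HasLabel O a b p q m n T)
    (hS : HasLabel O a b p q m' n' S) (hv : crd O v S = crd O v T)
    (h : Even (m + n + (m' + n'))) : S ∈ orbit (horizontalSubgroup G v) T := by
  have fz : ∀ {k : ℤ} (p : ℝ), Even k → fold (k : ZMod 2) p = p := fun p hk =>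
    if_pos ((ZMod.intCast_eq_zero_iff_even).2 hk)
  by_cases hm : Even (m' - m)
  · have hn : Even (n' - n) := by
      rw [show m + n + (m' + n') = (m' - m) + (n' - n) + 2 * (m + n) by ring, Int.even_add,
        Int.even_add] at h
      exact (h.2 (even_two_mul _)).1 hm
    obtain ⟨g, hg, hr⟩ := F.exists_realizes_isP2 (M := ⟨false, 1, 1, 1, m' - m, n' - n, 0⟩)
      ⟨rfl, rfl, rfl, hm, hn, rfl⟩
    refine ⟨g, hg, ?_⟩
    obtain ⟨h1, h2, h3⟩ := hr T
    rw [hT.1, hT.2] at h1 h2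
    have g1 := gridPt_add p m (m' - m)
    have g2 := gridPt_add q n (n' - n)
    rw [fz _ hm, add_sub_cancel] at g1
    rw [fz _ hn, add_sub_cancel] at g2
    refine F.ext ?_ ?_ ?_
    · rw [h1, hS.1, ← g1]; simp [act₁]
    · rw [h2, hS.2, ← g2]; simp [act₂]
    · rw [h3, hv]; simp [act₃]
  -- The half-turn with shift `m' + 1 + m` is chosen because it sends the label `m` to `(m' + 1 + m)
  -- - 1 - m = m'`.
  · have hm' : Even (m' + 1 + m) := by
      rw [show m' + 1 + m = (m' - m) + 1 + 2 * m by ring, Int.even_add, Int.even_add_one]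
      simp [hm]
    have hn : Even (n' + 1 + n) := by
      rw [show m + n + (m' + n') = (m' + 1 + m) + (n' + 1 + n) + 2 * (-1) by ring, Int.even_add,
        Int.even_add] at h
      exact (h.2 (even_two_mul _)).1 hm'
    obtain ⟨g, hg, hr⟩ := F.exists_realizes_isP2 (M := ⟨false, -1, -1, 1, m' + 1 + m, n' + 1 + n, 0⟩)
      ⟨rfl, rfl, rfl, hm', hn, rfl⟩
    refine ⟨g, hg, ?_⟩
    obtain ⟨h1, h2, h3⟩ := hr T
    rw [hT.1, hT.2] at h1 h2
    have g1 := neg_gridPt_add p m (m' + 1 + m)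
    have g2 := neg_gridPt_add q n (n' + 1 + n)
    rw [fz _ hm', show m' + 1 + m - 1 - m = m' by ring] at g1
    rw [fz _ hn, show n' + 1 + n - 1 - n = n' by ring] at g2
    refine F.ext ?_ ?_ ?_
    · rw [h1, hS.1, ← g1]; simp [act₁]
    · rw [h2, hS.2, ← g2]; simp [act₂]
    · rw [h3, hv]; simp [act₃]

theorem exists_hasLabel_of_mem_orbit {p q : ℝ} {m n : ℤ} {T S : E3}
    (hT : HasLabel O a b p q m n T) (hS : S ∈ orbit (horizontalSubgroup G v) T) :
    crd O v S = crd O v T ∧ ∃ m' n' : ℤ, HasLabel O a b p q m' n' S ∧ Even (m + n + (m' + n')) := by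
  obtain ⟨g, hg, rfl⟩ := hS
  obtain ⟨M, hM, hr⟩ := F.mem g hg.1
  refine ⟨(F.mem_horizontal_iff.1 hg).2 T, ?_⟩
  obtain ⟨h1, -, h3, -, -, h6⟩ := (F.mem_horizontal_iff_isP2 hr).1 hg
  obtain ⟨m', n', hl, hc⟩ := hr.hasLabel hT
  have hcls : M.cls = (false, 1, 0, 0) := by
    rw [hM, h3, h6, Int.cast_zero, F.compat.one]
  rw [hcls] at hl hc
  refine ⟨m', n', by simpa [fold] using hl, ?_⟩
  rw [← ZMod.intCast_eq_zero_iff_even, Int.cast_add (m + n), hc]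
  simp [GridClass.colour, CharTwo.add_self_eq_zero]

theorem dist_lt_iff {p q : ℝ} {m n m' n' : ℤ} {T S : E3} (hT : HasLabel O a b p q m n T)
    (hS : HasLabel O a b p q m' n' S) (hv : crd O v S = crd O v T) (x : E3) :
    dist x T < dist x S ↔ labelDist (‖a‖ ^ 2 / 4) (‖b‖ ^ 2 / 4) p q (crd O a x) (crd O b x) m n <
      labelDist (‖a‖ ^ 2 / 4) (‖b‖ ^ 2 / 4) p q (crd O a x) (crd O b x) m' n' := by
  rw [← sq_lt_sq₀ dist_nonneg dist_nonneg, F.dist_sq, F.dist_sq, hv, hT.1, hT.2, hS.1, hS.2,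
    labelDist, labelDist, add_lt_add_iff_right]

theorem dist_eq_iff {p q : ℝ} {m n m' n' : ℤ} {T S : E3} (hT : HasLabel O a b p q m n T)
    (hS : HasLabel O a b p q m' n' S) (hv : crd O v S = crd O v T) (x : E3) :
    dist x T = dist x S ↔ labelDist (‖a‖ ^ 2 / 4) (‖b‖ ^ 2 / 4) p q (crd O a x) (crd O b x) m n =
      labelDist (‖a‖ ^ 2 / 4) (‖b‖ ^ 2 / 4) p q (crd O a x) (crd O b x) m' n' := by
  rw [← sq_eq_sq₀ dist_nonneg dist_nonneg, F.dist_sq, F.dist_sq, hv, hT.1, hT.2, hS.1, hS.2,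
    labelDist, labelDist, add_left_inj]

theorem exists_hasLabel (p q z : ℝ) (m n : ℤ) : ∃ S, HasLabel O a b p q m n S ∧ crd O v S = z := by
  obtain ⟨S, h1, h2, h3⟩ := F.exists_point (gridPt p m) (gridPt q n) z
  exact ⟨S, ⟨h1, h2⟩, h3⟩

theorem inCross {p q : ℝ} {m n : ℤ} {T x : E3} (hT : HasLabel O a b p q m n T)
    (hp : p ∈ Set.Icc (0 : ℝ) 1) (hq : q ∈ Set.Icc (0 : ℝ) 1)
    (h : ∀ i j : ℤ, IsGridOffset i j → ∀ S, HasLabel O a b p q (m + i) (n + j) S →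
      crd O v S = crd O v T → dist x T < dist x S) : InCross (crd O a x) (crd O b x) m n := by
  have ha := norm_pos_iff.2 F.a_ne
  have hb := norm_pos_iff.2 F.b_ne
  refine inCross_of_labelDist (α := ‖a‖ ^ 2 / 4) (β := ‖b‖ ^ 2 / 4) (by positivity) (by positivity)
    hp hq fun i j hij => ?_
  obtain ⟨S, hS, hv⟩ := F.exists_hasLabel p q (crd O v T) (m + i) (n + j)
  rw [← F.dist_lt_iff hT hS hv]
  exact h i j hij S hS hv

end

end IsGridFrame

/-- `x` is strictly closer to `T` than to all other points of the orbit of `T` under horizontal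
motions. -/
def IsNearest (G : Subgroup Isom3) (v T x : E3) : Prop :=
  ∀ S ∈ orbit (horizontalSubgroup G v) T, S ≠ T → dist x T < dist x S

theorem IsGridOffset.even_add {i j : ℤ} (h : IsGridOffset i j) (m n : ℤ) :
    Even (m + n + (m + i + (n + j))) := by
  have : Even (i + j) := by
    unfold IsGridOffset at h
    rw [Int.even_iff]
    omega
  rw [show m + n + (m + i + (n + j)) = 2 * (m + n) + (i + j) by ring, Int.even_add]
  simp [this]

theorem IsGridOffset.ne_zero {i j : ℤ} (h : IsGridOffset i j) : ¬(i = 0 ∧ j = 0) := by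
  unfold IsGridOffset at h
  omega

namespace IsGridFrame

variable {G : Subgroup Isom3} {O a b v : E3} {D : ℤˣ → ZMod 2 → GridClass}

section

variable (F : IsGridFrame G O a b v D)

include F

theorem inCross_of_isNearest {p q : ℝ} {m n : ℤ} {T x : E3} (hT : HasLabel O a b p q m n T)
    (hp : p ∈ Set.Icc (0 : ℝ) 1) (hq : q ∈ Set.Icc (0 : ℝ) 1)
    (hc : p ∈ Set.Ioo (0 : ℝ) 1 ∨ q ∈ Set.Ioo (0 : ℝ) 1) (h : IsNearest G v T x) :
    InCross (crd O a x) (crd O b x) m n := by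
  refine F.inCross hT hp hq fun i j hij S hS hv => ?_
  refine h S (F.mem_orbit_of_hasLabel hT hS hv (hij.even_add m n)) ?_
  rintro rfl
  have := gridPt_injective hc (hT.1.symm.trans hS.1) (hT.2.symm.trans hS.2) (hij.even_add m n)
  exact hij.ne_zero (by omega)

/-- Only the translates by `±a` and `±b` are compared. These are distinct from `T` even over a
corner, so no genericity is needed. -/
theorem bounds_of_isNearest {p q : ℝ} {m n : ℤ} {T x : E3} (hT : HasLabel O a b p q m n T)
    (h : IsNearest G v T x) : |crd O a x - gridPt p m| < 1 ∧ |crd O b x - gridPt q n| < 1 := by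
  have ha := norm_pos_iff.2 F.a_ne
  have hb := norm_pos_iff.2 F.b_ne
  have key : ∀ i j : ℤ, IsGridOffset i j →
      (gridPt p (m + i) ≠ gridPt p m ∨ gridPt q (n + j) ≠ gridPt q n) →
      labelDist (‖a‖ ^ 2 / 4) (‖b‖ ^ 2 / 4) p q (crd O a x) (crd O b x) m n <
      labelDist (‖a‖ ^ 2 / 4) (‖b‖ ^ 2 / 4) p q (crd O a x) (crd O b x) (m + i) (n + j) := by
    intro i j hij hne
    obtain ⟨S, hS, hv⟩ := F.exists_hasLabel p q (crd O v T) (m + i) (n + j)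
    rw [← F.dist_lt_iff hT hS hv]
    refine h S (F.mem_orbit_of_hasLabel hT hS hv (hij.even_add m n)) ?_
    rintro rfl
    rw [← hS.1, ← hS.2, ← hT.1, ← hT.2] at hne
    simp at hne
  have h1 := key 2 0 (by simp [IsGridOffset]) (by simp [gridPt_add_two])
  have h2 := key (-2) 0 (by simp [IsGridOffset]) (by simp [← sub_eq_add_neg, gridPt_sub_two])
  have h3 := key 0 2 (by simp [IsGridOffset]) (by simp [gridPt_add_two])
  have h4 := key 0 (-2) (by simp [IsGridOffset]) (by simp [← sub_eq_add_neg, gridPt_sub_two])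
  rw [add_zero] at h1 h2 h3 h4
  rw [← sub_eq_add_neg] at h2 h4
  rw [labelDist_swap, labelDist_swap _ _ _ _ _ _ m (n + 2)] at h3
  rw [labelDist_swap, labelDist_swap _ _ _ _ _ _ m (n - 2)] at h4
  have g1 := lt_of_labelDist_lt (by positivity) h1
  have g2 := lt_of_labelDist_lt' (by positivity) h2
  have g3 := lt_of_labelDist_lt (by positivity) h3
  have g4 := lt_of_labelDist_lt' (by positivity) h4
  constructor <;> rw [abs_lt] <;> constructor <;> linarith

end

end IsGridFrame

theorem mem_orbit_self (H : Subgroup Isom3) (P : E3) : P ∈ orbit H P := ⟨1, H.one_mem, rfl⟩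

theorem mem_orbit_symm {H : Subgroup Isom3} {P Q : E3} (h : Q ∈ orbit H P) : P ∈ orbit H Q := by
  obtain ⟨g, hg, rfl⟩ := h
  exact ⟨g⁻¹, H.inv_mem hg, g.symm_apply_apply P⟩

theorem mem_orbit_trans {H : Subgroup Isom3} {P Q R : E3} (h : Q ∈ orbit H P)
    (h' : R ∈ orbit H Q) : R ∈ orbit H P := by
  obtain ⟨g, hg, rfl⟩ := h
  obtain ⟨g', hg', rfl⟩ := h'
  exact ⟨g' * g, H.mul_mem hg' hg, rfl⟩

theorem orbit_horizontal_subset {G : Subgroup Isom3} {v P Q : E3} (hQ : Q ∈ orbit G P) :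
    orbit (horizontalSubgroup G v) Q ⊆ orbit G P := by
  rintro _ ⟨g, hg, rfl⟩
  exact mem_orbit_trans hQ ⟨g, hg.1, rfl⟩

/-- When the horizontal orbits of `P` and `Q` differ, neither contains the other point. The witness
is then strictly nearest to each of them within its own orbit. -/
theorem IsStrictNeighbour.exists_isNearest {G : Subgroup Isom3} {v P Q : E3}
    (h : IsStrictNeighbour (orbit G P) P Q) (hQ : Q ∉ orbit (horizontalSubgroup G v) P) :
    ∃ x, dist x P = dist x Q ∧ IsNearest G v P x ∧ IsNearest G v Q x := by
  obtain ⟨hQP, -, x, hx, hlt⟩ := h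
  refine ⟨x, hx, fun S hS hne => ?_, fun S hS hne => ?_⟩
  · refine hlt S (orbit_horizontal_subset (mem_orbit_self G P) hS) hne ?_
    rintro rfl
    exact hQ hS
  · rw [← hx]
    refine hlt S (orbit_horizontal_subset hQP hS) ?_ hne
    rintro rfl
    exact hQ (mem_orbit_symm hS)

theorem exists_gridPt_eq_of_corner {p : ℝ} (m : ℤ) (hp : p = 0 ∨ p = 1) :
    ∃ k : ℤ, gridPt p m = 2 * k + p := by
  unfold gridPt
  rcases Int.even_or_odd' m with ⟨k, rfl | rfl⟩
  · exact ⟨k, by rw [if_pos (even_two_mul k)]; push_cast; ring⟩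
  · rw [if_neg (by simp)]
    rcases hp with rfl | rfl
    · exact ⟨k + 1, by push_cast; ring⟩
    · exact ⟨k, by push_cast; ring⟩

/-- Both values are integers of fixed parity. A difference smaller than 2 in absolute value is
therefore 0 if the parities agree, and `±1` otherwise. -/
theorem exists_corner_offset {p p' : ℝ} (hp : p = 0 ∨ p = 1) (hp' : p' = 0 ∨ p' = 1) :
    ∃ i₁ i₂ : ℤ, ∀ m m' : ℤ, |gridPt p' m' - gridPt p m| < 2 →
      ∃ i ∈ ({i₁, i₂} : Finset ℤ), gridPt p' m' = gridPt p m + i := by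
  have split : ∀ s : ℤ, p' - p = s → ∀ m m' : ℤ, |gridPt p' m' - gridPt p m| < 2 →
      ∃ d : ℤ, gridPt p' m' = gridPt p m + (2 * d + s : ℤ) ∧ -2 < 2 * d + s ∧ 2 * d + s < 2 := by
    intro s hs m m' h
    obtain ⟨k, hk⟩ := exists_gridPt_eq_of_corner m hp
    obtain ⟨k', hk'⟩ := exists_gridPt_eq_of_corner m' hp'
    rw [hk, hk', abs_lt] at h
    refine ⟨k' - k, ?_, ?_, ?_⟩
    · rw [hk, hk']; push_cast; linarith
    · have : ((-2 : ℤ) : ℝ) < (2 * (k' - k) + s : ℤ) := by push_cast; linarith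
      exact_mod_cast this
    · have : ((2 * (k' - k) + s : ℤ) : ℝ) < (2 : ℤ) := by push_cast; linarith
      exact_mod_cast this
  by_cases h : p' = p
  · refine ⟨0, 0, fun m m' hm => ?_⟩
    obtain ⟨d, h1, h2, h3⟩ := split 0 (by simp [h]) m m' hm
    obtain rfl : d = 0 := by omega
    exact ⟨0, by simp, by simpa using h1⟩
  · refine ⟨1, -1, fun m m' hm => ?_⟩
    obtain ⟨s, hs, hs'⟩ : ∃ s : ℤ, (s = 1 ∨ s = -1) ∧ p' - p = s := by
      rcases hp with rfl | rfl <;> rcases hp' with rfl | rfl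
      · exact absurd rfl h
      · exact ⟨1, by simp, by simp⟩
      · exact ⟨-1, by simp, by simp⟩
      · exact absurd rfl h
    obtain ⟨d, h1, h2, h3⟩ := split s hs' m m' hm
    refine ⟨2 * d + s, ?_, h1⟩
    simp only [Finset.mem_insert, Finset.mem_singleton]
    omega

theorem eq_or_eq_of_notMem_Ioo {p : ℝ} (hp : p ∈ Set.Icc (0 : ℝ) 1)
    (h : p ∉ Set.Ioo (0 : ℝ) 1) : p = 0 ∨ p = 1 := by
  by_contra hcon
  rw [not_or] at hcon
  exact h ⟨lt_of_le_of_ne hp.1 (Ne.symm hcon.1), lt_of_le_of_ne hp.2 hcon.2⟩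

theorem encard_le_of_subset_image {α β : Type*} {s : Set α} (f : β → α) (t : Finset β) {k : ℕ}
    (ht : t.card ≤ k) (h : s ⊆ f '' t) : s.encard ≤ k :=
  (Set.encard_le_encard h).trans ((Set.encard_image_le _ _).trans (by
    rw [Set.encard_coe_eq_coe_finsetCard]; exact_mod_cast ht))

/-! ### Counting neighbours in one layer -/

namespace IsGridFrame

variable {G : Subgroup Isom3} {O a b v : E3} {D : ℤˣ → ZMod 2 → GridClass}

/-- The points of the orbit `GP` obtained by the motions in `G` with vertical part
`z ↦ e z + k`. -/
def _root_.Stereohedra.layer (G : Subgroup Isom3) (O a b v : E3) (D : ℤˣ → ZMod 2 → GridClass)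
    (e : ℤˣ) (k : ℤ) (P : E3) : Set E3 :=
  {Q | ∃ g ∈ G, ∃ M : GridMotion, M.IsIn D ∧ M.Realizes O a b v g ∧ M.e₃ = e ∧ M.k₃ = k ∧ g P = Q}

theorem _root_.Stereohedra.exists_hasLabel_of_mem_layer {e : ℤˣ} {k : ℤ} {p q : ℝ} {m n : ℤ}
    {P Q : E3} (hP : HasLabel O a b p q m n P) (hQ : Q ∈ layer G O a b v D e k P) :
    crd O v Q = ((e : ℤ) : ℝ) * crd O v P + k ∧
    ∃ m' n' : ℤ, HasLabel O a b (fold (D e k).2.2.1 (if (D e k).1 then q else p))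
      (fold (D e k).2.2.2 (if (D e k).1 then p else q)) m' n' Q ∧
      ((m' + n' : ℤ) : ZMod 2) = ((m + n : ℤ) : ZMod 2) + (D e k).colour := by
  obtain ⟨g, -, M, hM, hr, rfl, rfl, rfl⟩ := hQ
  refine ⟨(hr P).2.2, ?_⟩
  rw [← hM]
  exact hr.hasLabel hP

section

variable (F : IsGridFrame G O a b v D)

include F

/-- The strict neighbours of `P` in the layer with vertical part `z ↦ e z + k`, except for those in
the orbit of `P` under horizontal motions. -/
theorem encard_layer_le {e : ℤˣ} {k : ℤ} {p q : ℝ} {m n : ℤ} {P : E3}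
    (hP : HasLabel O a b p q m n P) (hp : p ∈ Set.Icc (0 : ℝ) 1) (hq : q ∈ Set.Icc (0 : ℝ) 1) :
    {Q | IsStrictNeighbour (orbit G P) P Q ∧ Q ∉ orbit (horizontalSubgroup G v) P ∧
      Q ∈ layer G O a b v D e k P}.encard ≤ (if (D e k).colour = 1 then 4 else 7 : ℕ) := by
  have ha := norm_pos_iff.2 F.a_ne
  have hb := norm_pos_iff.2 F.b_ne
  by_cases hc : p ∈ Set.Ioo (0 : ℝ) 1 ∨ q ∈ Set.Ioo (0 : ℝ) 1
  · set p' := fold (D e k).2.2.1 (if (D e k).1 then q else p) with hp'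
    set q' := fold (D e k).2.2.2 (if (D e k).1 then p else q) with hq'
    have hp'I : p' ∈ Set.Icc (0 : ℝ) 1 := fold_mem (by split_ifs <;> assumption)
    have hq'I : q' ∈ Set.Icc (0 : ℝ) 1 := fold_mem (by split_ifs <;> assumption)
    have hc' : p' ∈ Set.Ioo (0 : ℝ) 1 ∨ q' ∈ Set.Ioo (0 : ℝ) 1 := by
      rw [hp', hq', fold_mem_Ioo, fold_mem_Ioo]
      split_ifs
      · exact hc.symm
      · exact hc
    choose f hf hfv using fun ij : ℤ × ℤ =>
      F.exists_hasLabel p' q' (((e : ℤ) : ℝ) * crd O v P + k) (m + ij.1) (n + ij.2)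
    -- An offset of `2` or `-2` in one direction can occur for one sign only, determined by which of
    -- the two points of the square with label `m` (respectively `n`) is further along.
    have side : ∀ x y : ℝ, ∃ s : ℤ, (x < y → s = 2) ∧ (y < x → s = -2) := fun x y =>
      ⟨if x < y then 2 else -2, fun h => if_pos h, fun h => if_neg h.not_gt⟩
    obtain ⟨s, hs, hs'⟩ := side (gridPt p' m) (gridPt p m)
    obtain ⟨t, ht, ht'⟩ := side (gridPt q' n) (gridPt q n)
    have main : ∀ Q, IsStrictNeighbour (orbit G P) P Q → Q ∉ orbit (horizontalSubgroup G v) P →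
        Q ∈ layer G O a b v D e k P → ∃ i j : ℤ, Q = f (i, j) ∧
        ((i + j : ℤ) : ZMod 2) = (D e k).colour ∧
        ((-1 ≤ i ∧ i ≤ 1 ∧ -1 ≤ j ∧ j ≤ 1) ∨ (i = 0 ∧ -2 ≤ j ∧ j ≤ 2) ∨
          (j = 0 ∧ -2 ≤ i ∧ i ≤ 2)) ∧ (i = 2 → s = 2) ∧ (i = -2 → s = -2) ∧
          (j = 2 → t = 2) ∧ (j = -2 → t = -2) := by
      intro Q hN hQ hL
      obtain ⟨x, -, hx, hx'⟩ := hN.exists_isNearest hQ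
      obtain ⟨hz, m', n', hl, hpar⟩ := exists_hasLabel_of_mem_layer hP hL
      have h1 := F.inCross_of_isNearest hP hp hq hc hx
      have h2 := F.inCross_of_isNearest hl hp'I hq'I hc' hx'
      obtain ⟨b1, b2⟩ := F.bounds_of_isNearest hP hx
      obtain ⟨b3, b4⟩ := F.bounds_of_isNearest hl hx'
      rw [← hp'] at b3
      rw [← hq'] at b4
      rw [abs_lt] at b1 b2 b3 b4
      have h3 := h1.offset h2
      refine ⟨m' - m, n' - n, ?_, ?_, by omega, ?_, ?_, ?_, ?_⟩
      · have h4 := hf (m' - m, n' - n)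
        simp only [add_sub_cancel] at h4
        exact F.ext (hl.1.trans h4.1.symm) (hl.2.trans h4.2.symm) (hz.trans (hfv _).symm)
      · have h4 : (((m' - m) + (n' - n) : ℤ) : ZMod 2) =
            ((m' + n' : ℤ) : ZMod 2) - ((m + n : ℤ) : ZMod 2) := by push_cast; ring
        rw [h4, hpar, add_sub_cancel_left]
      -- The witness is within 1 of both points, so a neighbour at `gridPt p' m + 2` forces `gridPt
      -- p' m < gridPt p m`.
      · intro h4
        apply hs
        rw [show m' = m + 2 by omega, gridPt_add_two] at b3
        linarith
      · intro h4
        rw [show m' = m - 2 by omega, gridPt_sub_two] at b3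
        apply hs'
        linarith
      · intro h4
        apply ht
        rw [show n' = n + 2 by omega, gridPt_add_two] at b4
        linarith
      · intro h4
        rw [show n' = n - 2 by omega, gridPt_sub_two] at b4
        apply ht'
        linarith
    split_ifs with hcol
    -- Odd offsets: only the four edge-adjacent squares survive.
    · refine encard_le_of_subset_image f {(1, 0), (-1, 0), (0, 1), (0, -1)} (by decide) ?_
      rintro Q ⟨h1, h2, h3⟩
      obtain ⟨i, j, rfl, hpar, hij, -⟩ := main Q h1 h2 h3
      refine ⟨(i, j), ?_, rfl⟩
      rw [hcol, ZMod.intCast_eq_one_iff_odd, Int.odd_iff] at hpar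
      rcases hij with ⟨i1, i2, j1, j2⟩ | ⟨rfl, j1, j2⟩ | ⟨rfl, i1, i2⟩
      · interval_cases i <;> interval_cases j <;> first | (exfalso; omega) | simp
      · interval_cases j <;> first | (exfalso; omega) | simp
      · interval_cases i <;> first | (exfalso; omega) | simp
    -- Even offsets: the square itself, the four diagonal ones, and at most one at distance two in
    -- each direction.
    · refine encard_le_of_subset_image f
        {(0, 0), (1, 1), (1, -1), (-1, 1), (-1, -1), (s, 0), (0, t)} 
        ((Finset.card_insert_le _ _).trans (Nat.succ_le_succ Finset.card_le_six)) ?_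
      rintro Q ⟨h1, h2, h3⟩
      obtain ⟨i, j, rfl, hpar, hij, g1, g2, g3, g4⟩ := main Q h1 h2 h3
      refine ⟨(i, j), ?_, rfl⟩
      have hcol' : (D e k).colour = 0 := by
        have : ∀ c : ZMod 2, c ≠ 1 → c = 0 := by decide
        exact this _ hcol
      rw [hcol', ZMod.intCast_eq_zero_iff_even, Int.even_iff] at hpar
      rcases hij with ⟨i1, i2, j1, j2⟩ | ⟨rfl, j1, j2⟩ | ⟨rfl, i1, i2⟩
      · interval_cases i <;> interval_cases j <;> first | (exfalso; omega) | simp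
      · interval_cases j <;> first | (exfalso; omega) | simp [g3, g4]
      · interval_cases i <;> first | (exfalso; omega) | simp [g1, g2]
  -- Here `P`, and hence `Q`, lies over a corner. Each coordinate has at most two possible offsets,
  -- so there are at most four candidates, whatever the colour.
  · have fold01 : ∀ {κ : ZMod 2} {p : ℝ}, p = 0 ∨ p = 1 → fold κ p = 0 ∨ fold κ p = 1 := by
      intro κ p h
      unfold fold
      split_ifs
      · exact h
      · rcases h with rfl | rfl <;> simp
    rw [not_or] at hc
    have hp0 := eq_or_eq_of_notMem_Ioo hp hc.1
    have hq0 := eq_or_eq_of_notMem_Ioo hq hc.2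
    obtain ⟨i₁, i₂, hi⟩ := exists_corner_offset hp0
      (fold01 (κ := (D e k).2.2.1) (p := if (D e k).1 then q else p) (by split_ifs <;> assumption))
    obtain ⟨j₁, j₂, hj⟩ := exists_corner_offset hq0
      (fold01 (κ := (D e k).2.2.2) (p := if (D e k).1 then p else q) (by split_ifs <;> assumption))
    choose f hf₁ hf₂ hf₃ using fun ij : ℤ × ℤ => F.exists_point (gridPt p m + ij.1)
      (gridPt q n + ij.2) (((e : ℤ) : ℝ) * crd O v P + k)
    have : (4 : ℕ) ≤ if (D e k).colour = 1 then 4 else 7 := by split_ifs <;> norm_num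
    refine encard_le_of_subset_image f ({i₁, i₂} ×ˢ {j₁, j₂}) (le_trans ?_ this) ?_
    · rw [Finset.card_product]
      exact Nat.mul_le_mul Finset.card_le_two Finset.card_le_two
    · rintro Q ⟨hN, hQ, hL⟩
      obtain ⟨x, -, hx, hx'⟩ := hN.exists_isNearest hQ
      obtain ⟨hz, m', n', hl, -⟩ := exists_hasLabel_of_mem_layer hP hL
      obtain ⟨b1, b2⟩ := F.bounds_of_isNearest hP hx
      obtain ⟨b3, b4⟩ := F.bounds_of_isNearest hl hx'
      rw [abs_lt] at b1 b2 b3 b4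
      obtain ⟨i, hi1, hi2⟩ := hi m m' (by rw [abs_lt]; constructor <;> linarith)
      obtain ⟨j, hj1, hj2⟩ := hj n n' (by rw [abs_lt]; constructor <;> linarith)
      refine ⟨(i, j), ?_, ?_⟩
      · rw [Finset.mem_coe, Finset.mem_product]
        exact ⟨hi1, hj1⟩
      · exact F.ext ((hf₁ _).trans (hi2.symm.trans hl.1.symm))
          ((hf₂ _).trans (hj2.symm.trans hl.2.symm)) ((hf₃ _).trans hz.symm)

end

end IsGridFrame

/-- The vertical parts `z ↦ e z + k`, other than the identity, that move a generic height `z` by less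
than two. -/
def levels (z : ℝ) : Finset (ℤˣ × ℤ) :=
  {(1, 1), (1, -1), (-1, ⌊2 * z⌋ - 1), (-1, ⌊2 * z⌋), (-1, ⌊2 * z⌋ + 1), (-1, ⌊2 * z⌋ + 2)}

/-- For `e = 1` the bound leaves `k = ±1`. For `e = -1` it says `2z - 2 < k < 2z + 2`, which is
covered by four consecutive integers. -/
theorem mem_levels {z : ℝ} {e : ℤˣ} {k : ℤ} (h₀ : e = 1 → k ≠ 0)
    (h : |((e : ℤ) : ℝ) * z + k - z| < 2) : (e, k) ∈ levels z := by
  rw [abs_lt] at h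
  obtain ⟨h1, h2⟩ := h
  have f1 := Int.floor_le (2 * z)
  have f2 := Int.lt_floor_add_one (2 * z)
  simp only [levels, Finset.mem_insert, Finset.mem_singleton, Prod.mk.injEq]
  rcases Int.units_eq_one_or e with rfl | rfl
  · simp only [Units.val_one, Int.cast_one, one_mul] at h1 h2
    have a1 : (-2 : ℤ) < k := by
      have : ((-2 : ℤ) : ℝ) < k := by push_cast; linarith
      exact_mod_cast this
    have a2 : k < (2 : ℤ) := by
      have : (k : ℝ) < (2 : ℤ) := by push_cast; linarith
      exact_mod_cast this
    have := h₀ rfl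
    have : k = 1 ∨ k = -1 := by omega
    tauto
  · simp only [Units.val_neg, Units.val_one, Int.cast_neg, Int.cast_one] at h1 h2
    have a1 : ⌊2 * z⌋ - 2 < k := by
      have : ((⌊2 * z⌋ - 2 : ℤ) : ℝ) < k := by push_cast; linarith
      exact_mod_cast this
    have a2 : k < ⌊2 * z⌋ + 3 := by
      have : (k : ℝ) < (⌊2 * z⌋ + 3 : ℤ) := by push_cast; linarith
      exact_mod_cast this
    have : k = ⌊2 * z⌋ - 1 ∨ k = ⌊2 * z⌋ ∨ k = ⌊2 * z⌋ + 1 ∨ k = ⌊2 * z⌋ + 2 := by omega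
    tauto

theorem mem_orbit_vadd {G : Subgroup Isom3} {v P T : E3} (hv : translation v ∈ G)
    (hT : T ∈ orbit G P) : v + T ∈ orbit G P :=
  mem_orbit_trans hT ⟨_, hv, rfl⟩

theorem mem_orbit_neg_vadd {G : Subgroup Isom3} {v P T : E3} (hv : translation v ∈ G)
    (hT : T ∈ orbit G P) : -v + T ∈ orbit G P := by
  refine mem_orbit_trans hT ⟨_, G.inv_mem hv, ?_⟩
  rfl

namespace IsGridFrame

variable {G : Subgroup Isom3} {O a b v : E3} {D : ℤˣ → ZMod 2 → GridClass}

section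

variable (F : IsGridFrame G O a b v D)

include F

/-- Every nontrivial value of `D` occurs exactly twice: `k = ±1` are both odd, and four consecutive
integers contain two of each parity. By `colours`, two of these values have colour 1 and one has
colour 0. -/
theorem sum_levels (z : ℝ) (f : ZMod 2 → ℕ) :
    ∑ i ∈ levels z, f (D i.1 i.2).colour = 4 * f 1 + 2 * f 0 := by
  have h2 : ((2 : ℤ) : ZMod 2) = 0 := by decide
  have h3 : ∀ x : ZMod 2, x - 1 = x + 1 := by decide
  have h4 : ∀ x : ZMod 2, x + 2 = x := by decide
  unfold levels
  generalize ⌊2 * z⌋ = k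
  have hne : ((1 : ℤˣ) = -1) = False := by decide
  rw [Finset.sum_insert (by simp [hne]), Finset.sum_insert (by simp [hne]),
    Finset.sum_insert (by simp; omega), Finset.sum_insert (by simp), Finset.sum_insert (by simp),
    Finset.sum_singleton]
  push_cast
  simp only [h3, h4]
  have hm : (-1 : ZMod 2) = 1 := by decide
  rw [hm]
  have h01 : (k : ZMod 2) = 0 ∨ (k : ZMod 2) = 1 := by
    generalize (k : ZMod 2) = k
    revert k
    decide
  have h5 : (1 : ZMod 2) + 1 = 0 := by decide
  rcases h01 with h | h <;> rw [h] <;> rcases F.colours with ⟨c1, c2, c3⟩ | ⟨c1, c2, c3⟩ | ⟨c1, c2, c3⟩ <;>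
    simp only [zero_add, h5, c1, c2, c3] <;> ring

theorem translation_v_mem : translation v ∈ G := by
  have := (F.isShortestTranslation.2 1).2 ⟨1, by simp⟩
  rwa [one_smul] at this

omit F in
/-- A point closer to `T` than to the two translates of `T` by `± w`. -/
theorem abs_sub_lt_one {w T x : E3} (hw : w ≠ 0) (h₁ : dist x T < dist x (w + T))
    (h₂ : dist x T < dist x (-w + T)) : |crd O w x - crd O w T| < 1 := by
  have hww : 0 < ‖w‖ ^ 2 := by positivity
  have key : ∀ u : E3, dist x T < dist x (u + T) → 2 * inner ℝ (x - T) u < ‖u‖ ^ 2 := by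
    intro u hu
    rw [← sq_lt_sq₀ dist_nonneg dist_nonneg, dist_eq_norm, dist_eq_norm,
      show x - (u + T) = (x - T) - u by abel] at hu
    have := norm_sub_sq_real (x - T) u
    linarith
  have k1 := key w h₁
  have k2 := key (-w) h₂
  rw [inner_neg_right, norm_neg] at k2
  rw [inner_sub_eq_crd hw O] at k1 k2
  rw [abs_lt]
  constructor
  · by_contra hcon
    nlinarith
  · by_contra hcon
    nlinarith

/-- Besides the four half-turn images about the corners, only the two translates in a single
direction can be neighbours. Which direction it is depends on the comparison of `‖a‖² p (1 - p)`
with `‖b‖² q (1 - q)`. -/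
theorem encard_horizontal_le {p q : ℝ} {m n : ℤ} {P : E3} (hP : HasLabel O a b p q m n P)
    (hp : p ∈ Set.Icc (0 : ℝ) 1) (hq : q ∈ Set.Icc (0 : ℝ) 1) :
    {Q | IsStrictNeighbour (orbit G P) P Q ∧ Q ∈ orbit (horizontalSubgroup G v) P}.encard ≤
      (6 : ℕ) := by
  have ha := norm_pos_iff.2 F.a_ne
  have hb := norm_pos_iff.2 F.b_ne
  by_cases hc : p ∈ Set.Ioo (0 : ℝ) 1 ∨ q ∈ Set.Ioo (0 : ℝ) 1
  · choose f hf hfv using fun ij : ℤ × ℤ =>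
      F.exists_hasLabel p q (crd O v P) (m + ij.1) (n + ij.2)
    have main : ∀ Q, IsStrictNeighbour (orbit G P) P Q → Q ∈ orbit (horizontalSubgroup G v) P →
        ∃ i j : ℤ, Q = f (i, j) ∧ IsGridOffset i j ∧
        (j = 0 → ‖a‖ ^ 2 / 4 * (p * (1 - p)) < ‖b‖ ^ 2 / 4 * (q * (1 - q))) ∧
        (i = 0 → ‖b‖ ^ 2 / 4 * (q * (1 - q)) < ‖a‖ ^ 2 / 4 * (p * (1 - p))) := by
      rintro Q ⟨hQG, hQP, x, hx, hlt⟩ hQ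
      obtain ⟨hz, m', n', hl, hpar⟩ := F.exists_hasLabel_of_mem_orbit hP hQ
      have hne : ¬(m' = m ∧ n' = n) := by
        rintro ⟨rfl, rfl⟩
        exact hQP (F.ext (hl.1.trans hP.1.symm) (hl.2.trans hP.2.symm) hz)
      -- strictness with respect to the other labels
      have strict : ∀ k l : ℤ, Even (m + n + (k + l)) → ¬(k = m ∧ l = n) → ¬(k = m' ∧ l = n') →
          ∀ S, HasLabel O a b p q k l S → crd O v S = crd O v P → dist x P < dist x S := by
        intro k l hkl h1 h2 S hS hSv
        refine hlt S (orbit_horizontal_subset (mem_orbit_self G P)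
          (F.mem_orbit_of_hasLabel hP hS hSv hkl)) ?_ ?_
        · rintro rfl
          have := gridPt_injective hc (hS.1.symm.trans hP.1) (hS.2.symm.trans hP.2)
            (by rwa [add_comm])
          exact h1 this
        · rintro rfl
          refine h2 (gridPt_injective hc (hS.1.symm.trans hl.1) (hS.2.symm.trans hl.2) ?_)
          have := hkl.add hpar
          rw [show m + n + (k + l) + (m + n + (m' + n')) = 2 * (m + n) + (k + l + (m' + n')) by ring,
            Int.even_add] at this
          exact this.1 (even_two_mul _)
      -- If the offset were not in the list, all eight comparison points around `P` and around `Q`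
      -- would be strictly farther from `x`. Then `x` would lie in both crosses, and the only even
      -- offsets of meeting crosses are zero and those in the list.
      have hoff : IsGridOffset (m' - m) (n' - n) := by
        by_contra hoff
        have hoff' : ∀ i j, IsGridOffset i j → ¬(m + i = m' ∧ n + j = n') := by
          rintro i j hij ⟨rfl, rfl⟩
          simp only [add_sub_cancel_left] at hoff
          exact hoff hij
        have hoff'' : ∀ i j, IsGridOffset i j → ¬(m' + i = m ∧ n' + j = n) := by
          intro i j hij h
          refine hoff ?_
          unfold IsGridOffset at *
          omega
        have h1 : InCross (crd O a x) (crd O b x) m n := by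
          refine F.inCross hP hp hq fun i j hij S hS hSv => strict _ _ (hij.even_add m n) ?_
            (hoff' i j hij) S hS hSv
          rintro ⟨h1, h2⟩
          exact hij.ne_zero (by omega)
        have h2 : InCross (crd O a x) (crd O b x) m' n' := by
          refine F.inCross hl hp hq fun i j hij S hS hSv => ?_
          rw [← hx]
          refine strict _ _ ?_ (hoff'' i j hij) ?_ S hS (hSv.trans hz)
          · have := (hij.even_add m' n').add hpar
            rw [show m' + n' + (m' + i + (n' + j)) + (m + n + (m' + n')) =
              2 * (m' + n') + (m + n + (m' + i + (n' + j))) by ring, Int.even_add] at this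
            exact this.1 (even_two_mul _)
          · rintro ⟨h1, h2⟩
            exact hij.ne_zero (by omega)
        have h3 := h1.offset h2
        unfold IsGridOffset at hoff
        rw [Int.even_iff] at hpar
        omega
      have hdist := (F.dist_eq_iff hP hl hz x).1 hx
      have strict' : ∀ i j : ℤ, IsGridOffset i j → ¬(m + i = m' ∧ n + j = n') →
          labelDist (‖a‖ ^ 2 / 4) (‖b‖ ^ 2 / 4) p q (crd O a x) (crd O b x) m n <
          labelDist (‖a‖ ^ 2 / 4) (‖b‖ ^ 2 / 4) p q (crd O a x) (crd O b x) (m + i) (n + j) := by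
        intro i j hij hne'
        rw [← F.dist_lt_iff hP (hf (i, j)) (hfv _)]
        refine strict _ _ (hij.even_add m n) ?_ hne' _ (hf _) (hfv _)
        rintro ⟨h1, h2⟩
        exact hij.ne_zero (by omega)
      refine ⟨m' - m, n' - n, ?_, hoff, fun hj => ?_, fun hi => ?_⟩
      · have h4 := hf (m' - m, n' - n)
        simp only [add_sub_cancel] at h4
        exact F.ext (hl.1.trans h4.1.symm) (hl.2.trans h4.2.symm) (hz.trans (hfv _).symm)
      · obtain ⟨s, hs, hs'⟩ : ∃ s : ℤ, (s = 1 ∨ s = -1) ∧ m' = m + 2 * s := by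
          unfold IsGridOffset at hoff
          rcases hoff with h | h | h
          · omega
          · rcases h.1 with h | h
            · exact ⟨1, by simp, by omega⟩
            · exact ⟨-1, by simp, by omega⟩
          · omega
        obtain rfl : n' = n := by omega
        rw [hs'] at hdist
        have g1 := strict' s 1 (by unfold IsGridOffset; omega) (by omega)
        have g2 := strict' s (-1) (by unfold IsGridOffset; omega) (by omega)
        exact lt_of_labelDist_eq (by positivity) hq hs hdist g1 g2
      · obtain ⟨s, hs, hs'⟩ : ∃ s : ℤ, (s = 1 ∨ s = -1) ∧ n' = n + 2 * s := by
          unfold IsGridOffset at hoff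
          rcases hoff with h | h | h
          · omega
          · omega
          · rcases h.2 with h | h
            · exact ⟨1, by simp, by omega⟩
            · exact ⟨-1, by simp, by omega⟩
        obtain rfl : m' = m := by omega
        rw [hs', labelDist_swap, labelDist_swap _ _ _ _ _ _ m'] at hdist
        have g1 := strict' 1 s (by unfold IsGridOffset; omega) (by omega)
        have g2 := strict' (-1) s (by unfold IsGridOffset; omega) (by omega)
        rw [labelDist_swap, labelDist_swap _ _ _ _ _ _ (m' + _)] at g1 g2
        exact lt_of_labelDist_eq (by positivity) hp hs hdist g1 g2
    by_cases hcut : ‖a‖ ^ 2 / 4 * (p * (1 - p)) < ‖b‖ ^ 2 / 4 * (q * (1 - q))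
    · refine encard_le_of_subset_image f {(1, 1), (1, -1), (-1, 1), (-1, -1), (2, 0), (-2, 0)}
        Finset.card_le_six ?_
      rintro Q ⟨h1, h2⟩
      obtain ⟨i, j, rfl, hij, -, h4⟩ := main Q h1 h2
      refine ⟨(i, j), ?_, rfl⟩
      have hi : i ≠ 0 := fun h => absurd (h4 h) hcut.not_gt
      rcases hij with ⟨rfl | rfl, rfl | rfl⟩ | ⟨rfl | rfl, rfl⟩ | ⟨rfl, -⟩
      all_goals first | exact absurd rfl hi | simp
    · refine encard_le_of_subset_image f {(1, 1), (1, -1), (-1, 1), (-1, -1), (0, 2), (0, -2)}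
        Finset.card_le_six ?_
      rintro Q ⟨h1, h2⟩
      obtain ⟨i, j, rfl, hij, h3, -⟩ := main Q h1 h2
      refine ⟨(i, j), ?_, rfl⟩
      have hj : j ≠ 0 := fun h => absurd (h3 h) hcut
      rcases hij with ⟨rfl | rfl, rfl | rfl⟩ | ⟨-, rfl⟩ | ⟨rfl, rfl | rfl⟩
      all_goals first | exact absurd rfl hj | simp
  · rw [not_or] at hc
    have hp0 := eq_or_eq_of_notMem_Ioo hp hc.1
    have hq0 := eq_or_eq_of_notMem_Ioo hq hc.2
    -- Over a corner the half-turn images are translates, and the orbit is the rectangular lattice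
    -- spanned by `a` and `b`. Its only possible neighbours are the four nearest lattice translates.
    have hta : translation a ∈ horizontalSubgroup G v := by
      rw [F.isRectangularP2.2.2.2.2.2]
      exact Subgroup.subset_closure (by simp)
    have htb : translation b ∈ horizontalSubgroup G v := by
      rw [F.isRectangularP2.2.2.2.2.2]
      exact Subgroup.subset_closure (by simp)
    refine encard_le_of_subset_image (fun i : Fin 4 => ![a + P, -a + P, b + P, -b + P] i)
      Finset.univ (by simp) ?_
    rintro Q ⟨⟨hQG, hQP, x, hx, hlt⟩, hQ⟩
    by_contra hcon
    have n1 : Q ≠ a + P := fun h => hcon ⟨0, by simp, h.symm⟩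
    have n2 : Q ≠ -a + P := fun h => hcon ⟨1, by simp, h.symm⟩
    have n3 : Q ≠ b + P := fun h => hcon ⟨2, by simp, h.symm⟩
    have n4 : Q ≠ -b + P := fun h => hcon ⟨3, by simp, h.symm⟩
    have ltP : ∀ w : E3, w ≠ 0 → translation w ∈ G → Q ≠ w + P → Q ≠ -w + P →
        |crd O w x - crd O w P| < 1 ∧ |crd O w x - crd O w Q| < 1 := by
      intro w hw hwG h1 h2
      have z1 : ∀ T : E3, w + T ≠ T := fun T => by simpa using hw
      have z2 : ∀ T : E3, -w + T ≠ T := fun T => by simpa using hw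
      refine ⟨abs_sub_lt_one hw (hlt _ (mem_orbit_vadd hwG (mem_orbit_self _ _)) (z1 _) h1.symm)
        (hlt _ (mem_orbit_neg_vadd hwG (mem_orbit_self _ _)) (z2 _) h2.symm), ?_⟩
      refine abs_sub_lt_one hw ?_ ?_ <;> rw [← hx]
      · refine hlt _ (mem_orbit_vadd hwG hQG) (fun h => h2 ?_) (z1 _)
        rw [← h]; abel
      · refine hlt _ (mem_orbit_neg_vadd hwG hQG) (fun h => h1 ?_) (z2 _)
        rw [← h]; abel
    obtain ⟨c1, c2⟩ := ltP a F.a_ne hta.1 n1 n2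
    obtain ⟨c3, c4⟩ := ltP b F.b_ne htb.1 n3 n4
    obtain ⟨hz, m', n', hl, -⟩ := F.exists_hasLabel_of_mem_orbit hP hQ
    -- Corner coordinates in one orbit lie in `2ℤ + p`, so two of them at distance less than 1 from
    -- the same number coincide.
    have eqc : ∀ {p x : ℝ} {m m' : ℤ}, (p = 0 ∨ p = 1) → |x - gridPt p m| < 1 →
        |x - gridPt p m'| < 1 → gridPt p m' = gridPt p m := by
      intro p x m m' hp h1 h2
      obtain ⟨k, hk⟩ := exists_gridPt_eq_of_corner m hp
      obtain ⟨k', hk'⟩ := exists_gridPt_eq_of_corner m' hp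
      rw [hk, abs_lt] at h1
      rw [hk', abs_lt] at h2
      have a1 : k < k' + 1 := by
        have : (k : ℝ) < (k' + 1 : ℤ) := by push_cast; linarith
        exact_mod_cast this
      have a2 : k' < k + 1 := by
        have : (k' : ℝ) < (k + 1 : ℤ) := by push_cast; linarith
        exact_mod_cast this
      rw [hk, hk', show k' = k by omega]
    rw [hP.1] at c1
    rw [hl.1] at c2
    rw [hP.2] at c3
    rw [hl.2] at c4
    exact hQP (F.ext ((hl.1.trans (eqc hp0 c1 c2)).trans hP.1.symm)
      ((hl.2.trans (eqc hq0 c3 c4)).trans hP.2.symm) hz)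

end

end IsGridFrame

/-! ### Local finiteness of orbits and the facet bound -/

theorem abs_crd_le (O w x : E3) : |crd O w x| ≤ 2 * ‖x - O‖ * ‖w‖ / ‖w‖ ^ 2 := by
  rw [crd, abs_div, abs_mul, abs_two, abs_of_nonneg (sq_nonneg ‖w‖), mul_assoc]
  gcongr
  exact abs_real_inner_le_norm _ _

theorem finite_setOf_gridMotion (N : ℤ) :
    {M : GridMotion | |M.k₁| ≤ N ∧ |M.k₂| ≤ N ∧ |M.k₃| ≤ N}.Finite := by
  have h := ((Set.finite_univ (α := Bool × ℤˣ × ℤˣ × ℤˣ)).prod ((Set.finite_Icc (-N) N).prod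
    ((Set.finite_Icc (-N) N).prod (Set.finite_Icc (-N) N))))
  refine (h.image fun t => GridMotion.mk t.1.1 t.1.2.1 t.1.2.2.1 t.1.2.2.2 t.2.1 t.2.2.1
    t.2.2.2).subset ?_
  rintro ⟨s, e₁, e₂, e₃, k₁, k₂, k₃⟩ ⟨h1, h2, h3⟩
  refine ⟨((s, e₁, e₂, e₃), k₁, k₂, k₃), ?_, rfl⟩
  simp only [Set.mem_prod, Set.mem_univ, true_and, Set.mem_Icc]
  exact ⟨abs_le.1 h1, abs_le.1 h2, abs_le.1 h3⟩

namespace IsGridFrame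

variable {G : Subgroup Isom3} {O a b v : E3} {D : ℤˣ → ZMod 2 → GridClass}

section

variable (F : IsGridFrame G O a b v D)

include F

theorem finite_orbit_inter_closedBall (P x : E3) (r : ℝ) :
    (orbit G P ∩ Metric.closedBall x r).Finite := by
  choose f hf₁ hf₂ hf₃ using fun M : GridMotion => F.exists_point
    (M.act₁ (crd O a P) (crd O b P)) (M.act₂ (crd O a P) (crd O b P)) (M.act₃ (crd O v P))
  obtain ⟨C, hC⟩ : ∃ C : ℝ, ∀ Q ∈ Metric.closedBall x r,
      |crd O a Q| ≤ C ∧ |crd O b Q| ≤ C ∧ |crd O v Q| ≤ C := by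
    have bd : ∀ w : E3, ∀ Q ∈ Metric.closedBall x r,
        |crd O w Q| ≤ 2 * (r + ‖x - O‖) * ‖w‖ / ‖w‖ ^ 2 := by
      intro w Q hQ
      refine (abs_crd_le O w Q).trans ?_
      rw [Metric.mem_closedBall, dist_eq_norm] at hQ
      have : ‖Q - O‖ ≤ r + ‖x - O‖ := by
        calc ‖Q - O‖ = ‖(Q - x) + (x - O)‖ := by rw [sub_add_sub_cancel]
          _ ≤ ‖Q - x‖ + ‖x - O‖ := norm_add_le _ _
          _ ≤ r + ‖x - O‖ := by linarith
      gcongr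
    exact ⟨max _ (max _ _), fun Q hQ => ⟨(bd a Q hQ).trans (le_max_left _ _),
      (bd b Q hQ).trans ((le_max_left _ _).trans (le_max_right _ _)),
      (bd v Q hQ).trans ((le_max_right _ _).trans (le_max_right _ _))⟩⟩
  obtain ⟨N, hN⟩ := exists_nat_ge (C + |crd O a P| + |crd O b P| + |crd O v P|)
  refine ((finite_setOf_gridMotion N).image f).subset ?_
  rintro Q ⟨⟨g, hg, rfl⟩, hQ⟩
  obtain ⟨M, -, hr⟩ := F.mem g hg
  obtain ⟨h1, h2, h3⟩ := hr P
  obtain ⟨c1, c2, c3⟩ := hC _ hQ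
  refine ⟨M, ?_, F.ext ((hf₁ M).trans h1.symm) ((hf₂ M).trans h2.symm) ((hf₃ M).trans h3.symm)⟩
  have key : ∀ (e : ℤˣ) (k : ℤ) (u y : ℝ), y = ((e : ℤ) : ℝ) * u + k → |y| ≤ C →
      |u| ≤ |crd O a P| + |crd O b P| + |crd O v P| → |k| ≤ (N : ℤ) := by
    intro e k u y hy hyC hu
    have h4 : |(k : ℝ)| ≤ N := by
      have h5 : (k : ℝ) = y - ((e : ℤ) : ℝ) * u := by linarith
      have h6 : |((e : ℤ) : ℝ) * u| = |u| := by
        rcases Int.units_eq_one_or e with rfl | rfl <;> simp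
      have h7 := abs_sub y (((e : ℤ) : ℝ) * u)
      rw [h6] at h7
      rw [h5]
      linarith
    exact_mod_cast h4
  have p1 := abs_nonneg (crd O a P)
  have p2 := abs_nonneg (crd O b P)
  have p3 := abs_nonneg (crd O v P)
  refine ⟨key M.e₁ _ _ _ h1 c1 ?_, key M.e₂ _ _ _ h2 c2 ?_, key M.e₃ _ _ _ h3 c3 (by linarith)⟩
  · split_ifs <;> linarith
  · split_ifs <;> linarith

/-- If `Q` is neither `P + v` nor `P - v`, the translates of `P` and of `Q` by `±v` are all farther
from the witness. The witness is then at height less than 1 from both points, so their heights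
differ by less than 2 and `mem_levels` applies. -/
theorem strictNeighbour_subset (P : E3) : {Q | IsStrictNeighbour (orbit G P) P Q} ⊆
    {v + P, -v + P} ∪
    {Q | IsStrictNeighbour (orbit G P) P Q ∧ Q ∈ orbit (horizontalSubgroup G v) P} ∪
    ⋃ i ∈ levels (crd O v P), {Q | IsStrictNeighbour (orbit G P) P Q ∧
      Q ∉ orbit (horizontalSubgroup G v) P ∧ Q ∈ layer G O a b v D i.1 i.2 P} := by
  intro Q hQ
  by_cases h₁ : Q = v + P
  · simp [h₁]
  by_cases h₂ : Q = -v + P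
  · simp [h₂]
  by_cases h₃ : Q ∈ orbit (horizontalSubgroup G v) P
  · exact Or.inl (Or.inr ⟨hQ, h₃⟩)
  refine Or.inr ?_
  obtain ⟨hQG, hQP, x, hx, hlt⟩ := id hQ
  obtain ⟨g, hg, rfl⟩ := id hQG
  obtain ⟨M, hM, hr⟩ := F.mem g hg
  have hv := F.translation_v_mem
  have z1 : ∀ T : E3, v + T ≠ T := fun T => by simpa using F.v_ne
  have z2 : ∀ T : E3, -v + T ≠ T := fun T => by simpa using F.v_ne
  have d1 := abs_sub_lt_one (O := O) F.v_ne
    (hlt _ (mem_orbit_vadd hv (mem_orbit_self _ _)) (z1 _) (Ne.symm h₁))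
    (hlt _ (mem_orbit_neg_vadd hv (mem_orbit_self _ _)) (z2 _) (Ne.symm h₂))
  have d2 : |crd O v x - crd O v (g P)| < 1 := by
    refine abs_sub_lt_one F.v_ne ?_ ?_ <;> rw [← hx]
    · refine hlt _ (mem_orbit_vadd hv hQG) (fun h => h₂ (eq_neg_add_of_add_eq h)) (z1 _)
    · refine hlt _ (mem_orbit_neg_vadd hv hQG) (fun h => h₁ (neg_add_eq_iff_eq_add.1 h)) (z2 _)
  rw [(hr P).2.2, act₃] at d2
  simp only [Set.mem_iUnion]
  refine ⟨(M.e₃, M.k₃), mem_levels (fun he hk => h₃ ?_) ?_, hQ, h₃, g, hg, M, hM, hr, rfl, rfl, rfl⟩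
  · exact ⟨g, F.mem_horizontal_of_realizes hM he hk hr, rfl⟩
  · rw [abs_lt] at *
    constructor <;> linarith

theorem encard_strictNeighbour_le (P : E3) :
    {Q | IsStrictNeighbour (orbit G P) P Q}.encard ≤ 38 := by
  obtain ⟨p, hp, m, hm⟩ := exists_gridPt (crd O a P)
  obtain ⟨q, hq, n, hn⟩ := exists_gridPt (crd O b P)
  have hP : HasLabel O a b p q m n P := ⟨hm, hn⟩
  refine (Set.encard_le_encard (F.strictNeighbour_subset P)).trans ?_
  refine (Set.encard_union_le _ _).trans ?_
  have h1 := (Set.encard_union_le {v + P, -v + P}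
    {Q | IsStrictNeighbour (orbit G P) P Q ∧ Q ∈ orbit (horizontalSubgroup G v) P})
  have h2 : ({v + P, -v + P} : Set E3).encard ≤ 2 :=
    (Set.encard_insert_le _ _).trans (by rw [Set.encard_singleton]; norm_num)
  have h3 := F.encard_horizontal_le hP hp hq
  have h4 : (⋃ i ∈ levels (crd O v P), {Q | IsStrictNeighbour (orbit G P) P Q ∧
      Q ∉ orbit (horizontalSubgroup G v) P ∧ Q ∈ layer G O a b v D i.1 i.2 P}).encard ≤ 30 := by
    -- Each layer contributes 4 or 7 according to its colour. The sum is 4·4 + 2·7 = 30 for every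
    -- base point, generic or not.
    have h5 := F.sum_levels (crd O v P) fun c => if c = 1 then 4 else 7
    have h6 : (4 * (if (1 : ZMod 2) = 1 then 4 else 7) + 2 * (if (0 : ZMod 2) = 1 then 4 else 7) : ℕ)
        = 30 := by decide
    rw [h6] at h5
    have h7 : ∀ s : Finset (ℤˣ × ℤ), (⋃ i ∈ s, {Q | IsStrictNeighbour (orbit G P) P Q ∧
        Q ∉ orbit (horizontalSubgroup G v) P ∧ Q ∈ layer G O a b v D i.1 i.2 P}).encard ≤
        ((∑ i ∈ s, if (D i.1 i.2).colour = 1 then 4 else 7 : ℕ) : ℕ∞) := by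
      intro s
      induction s using Finset.induction_on with
      | empty => simp
      | insert i s hi ih =>
        rw [Finset.set_biUnion_insert, Finset.sum_insert hi]
        refine (Set.encard_union_le _ _).trans ?_
        push_cast
        have := F.encard_layer_le (e := i.1) (k := i.2) hP hp hq
        push_cast at this ih
        exact add_le_add this ih
    refine (h7 _).trans ?_
    rw [h5]
    rfl
  calc _ ≤ (2 + (6 : ℕ) : ℕ∞) + 30 := add_le_add (h1.trans (add_le_add h2 h3)) h4
    _ = 38 := by norm_num

theorem encard_facets_dirichletStereohedron_le (P : E3) :
    (facets (dirichletStereohedron G P)).encard ≤ 38 :=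
  (encard_facets_le (F.finite_orbit_inter_closedBall P) P).trans (F.encard_strictNeighbour_le P)

end

end IsGridFrame

/-! ### Generic points -/

theorem crd_eq_inner_div (O w x : E3) : crd O w x = 2 * (inner ℝ (x - O) w / ‖w‖ ^ 2) := by
  rw [crd, mul_div_assoc]

theorem mem_overRectangle {O a b x : E3} {m n : ℤ} : x ∈ overRectangle O a b m n ↔
    ((m : ℝ) < crd O a x ∧ crd O a x < m + 1) ∧ ((n : ℝ) < crd O b x ∧ crd O b x < n + 1) := by
  rw [crd_eq_inner_div, crd_eq_inner_div]
  constructor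
  · rintro ⟨h1, h2, h3, h4⟩
    exact ⟨⟨by linarith, by linarith⟩, ⟨by linarith, by linarith⟩⟩
  · rintro ⟨⟨h1, h2⟩, ⟨h3, h4⟩⟩
    exact ⟨by linarith, by linarith, by linarith, by linarith⟩

theorem exists_int_mem_Ioo_iff {x : ℝ} : (∃ m : ℤ, (m : ℝ) < x ∧ x < m + 1) ↔ ∀ k : ℤ, x ≠ k := by
  constructor
  · rintro ⟨m, h1, h2⟩ k rfl
    have a1 : m < k := by exact_mod_cast h1
    have a2 : k < m + 1 := by exact_mod_cast h2
    omega
  · intro h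
    exact ⟨⌊x⌋, lt_of_le_of_ne (Int.floor_le x) (h _).symm, Int.lt_floor_add_one x⟩

theorem int_eq_of_mem_Ioo {x : ℝ} {m m' : ℤ} (h : (m : ℝ) < x ∧ x < m + 1)
    (h' : (m' : ℝ) < x ∧ x < m' + 1) : m = m' := by
  have a1 : m < m' + 1 := by exact_mod_cast h.1.trans h'.2
  have a2 : m' < m + 1 := by exact_mod_cast h'.1.trans h.2
  omega

theorem exists_gridPt_of_mem_Ioo {x : ℝ} {m : ℤ} (h : (m : ℝ) < x ∧ x < m + 1) :
    ∃ p ∈ Set.Ioo (0 : ℝ) 1, x = gridPt p m := by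
  by_cases hm : Even m
  · exact ⟨x - m, ⟨by linarith, by linarith⟩, by simp [gridPt, hm]⟩
  · exact ⟨m + 1 - x, ⟨by linarith, by linarith⟩, by simp [gridPt, hm]⟩

theorem continuous_crd (O w : E3) : Continuous (crd O w) := by
  unfold crd
  fun_prop

theorem isOpenMap_crd (O : E3) {w : E3} (hw : w ≠ 0) : IsOpenMap (crd O w) := by
  let l : E3 →L[ℝ] ℝ := (2 / ‖w‖ ^ 2) • innerSL ℝ w
  have hl : ∀ x, l x = crd 0 w x := fun x => by
    simp [l, crd, real_inner_comm w x]
    ring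
  have hsurj : Function.Surjective l := fun c => ⟨(c / 2) • w, by
    rw [hl, crd_zero_self hw]; ring⟩
  have h : crd O w = l ∘ Homeomorph.subRight O := by
    funext x
    have := crd_zero_sub O w x O
    rw [crd_self, sub_zero] at this
    rw [Function.comp_apply, hl, ← this]
    rfl
  rw [h]
  exact (l.isOpenMap hsurj).comp (Homeomorph.subRight O).isOpenMap

theorem isOpen_setOf_ne_intCast {f : E3 → ℝ} (hf : Continuous f) :
    IsOpen {x | ∀ k : ℤ, f x ≠ k} := by
  have : {x | ∀ k : ℤ, f x ≠ k} = f ⁻¹' (Set.range ((↑) : ℤ → ℝ))ᶜ := by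
    ext x
    simp [eq_comm]
  rw [this]
  exact Int.isClosedEmbedding_coe_real.isClosed_range.isOpen_compl.preimage hf

/-- Preimages of dense sets under open maps are dense, and the complement of a countable set of
reals is dense. -/
theorem dense_setOf_ne_intCast {f : E3 → ℝ} (hf : IsOpenMap f) {c : ℝ} (hc : c ≠ 0) :
    Dense {x | ∀ k : ℤ, c * f x ≠ k} := by
  have : {x | ∀ k : ℤ, c * f x ≠ k} = f ⁻¹' (Set.range fun k : ℤ => (k : ℝ) / c)ᶜ := by
    ext x
    simp [div_eq_iff hc, mul_comm c, eq_comm]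
  rw [this]
  exact ((Set.countable_range _).dense_compl ℝ).preimage hf

theorem mem_levels_iff {z : ℝ} (hz : ∀ k : ℤ, 2 * z ≠ k) {i : ℤˣ × ℤ} : i ∈ levels z ↔
    ((i.1 : ℤ) : ℝ) * z + i.2 ≠ z ∧ |((i.1 : ℤ) : ℝ) * z + i.2 - z| < 2 := by
  constructor
  · intro h
    have f1 := lt_of_le_of_ne (Int.floor_le (2 * z)) (hz _).symm
    have f2 := Int.lt_floor_add_one (2 * z)
    simp only [levels, Finset.mem_insert, Finset.mem_singleton] at h
    have key : ∀ k : ℤ, ((-1 : ℤˣ) : ℤ) * z + k ≠ z := by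
      intro k hk
      refine hz k ?_
      simp at hk
      linarith
    rcases h with rfl | rfl | rfl | rfl | rfl | rfl
    · simp
    · simp
    all_goals
      refine ⟨key _, ?_⟩
      rw [abs_lt]
      push_cast
      constructor <;> linarith
  · rintro ⟨h1, h2⟩
    refine mem_levels (fun he hk => h1 ?_) h2
    rw [he, hk]
    simp

/-- Vertical parts of opposite sign agree at height `z` only if `2z` is an integer. -/
theorem level_injective {z : ℝ} (hz : ∀ k : ℤ, 2 * z ≠ k) {e f : ℤˣ} {k l : ℤ}
    (h : ((e : ℤ) : ℝ) * z + k = ((f : ℤ) : ℝ) * z + l) : e = f ∧ k = l := by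
  rcases Int.units_eq_one_or e with rfl | rfl <;> rcases Int.units_eq_one_or f with rfl | rfl
  · exact ⟨rfl, by simpa using h⟩
  · exfalso
    refine hz (l - k) ?_
    simp at h ⊢
    linarith
  · exfalso
    refine hz (k - l) ?_
    simp at h ⊢
    linarith
  · exact ⟨rfl, by simpa using h⟩

namespace IsGridFrame

variable {G : Subgroup Isom3} {O a b v : E3} {D : ℤˣ → ZMod 2 → GridClass}

section

variable (F : IsGridFrame G O a b v D)

include F

theorem nonempty_layer (e : ℤˣ) (k : ℤ) (P : E3) : (layer G O a b v D e k P).Nonempty := by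
  obtain ⟨g, hg, hr⟩ := F.ex ⟨(D e k).1, 1, (D e k).2.1, e, (D e k).2.2.1.val,
    (D e k).2.2.2.val, k⟩ (by simp [IsIn, cls])
  exact ⟨g P, g, hg, _, by simp [IsIn, cls], hr, rfl, rfl, rfl⟩

/-- Every vertical part `z ↦ -z + k` occurs in the group, so genericity in height means that none of
these reflections fixes the height of `P`. -/
theorem isGeneric_iff {P : E3} : IsGeneric G v O a b P ↔
    (∀ k : ℤ, crd O a P ≠ k) ∧ (∀ k : ℤ, crd O b P ≠ k) ∧ ∀ k : ℤ, 2 * crd O v P ≠ k := by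
  rw [IsGeneric, ← exists_int_mem_Ioo_iff, ← exists_int_mem_Ioo_iff, ← and_assoc]
  simp only [mem_overRectangle, exists_and_left, exists_and_right]
  refine and_congr_right fun _ => ⟨fun h k hk => ?_, fun h g hg hgP => ?_⟩
  · obtain ⟨_, g, hg, M, hM, hr, he, hk', rfl⟩ := F.nonempty_layer (-1) k P
    have h1 := (hr P).2.2
    have h2 := h g hg (by
      rw [inner_eq_inner_iff_crd F.v_ne O, h1, act₃, he, hk', ← hk]
      simp
      ring)
    have h3 := ((F.mem_horizontal_iff_isP2 hr).1 h2).2.2.1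
    rw [he] at h3
    exact absurd h3 (by decide)
  · obtain ⟨M, hM, hr⟩ := F.mem g hg
    rw [inner_eq_inner_iff_crd F.v_ne O, (hr P).2.2, act₃] at hgP
    obtain ⟨h1, h2⟩ := level_injective h (e := M.e₃) (f := 1) (k := M.k₃) (l := 0) (by simpa using hgP)
    exact F.mem_horizontal_of_realizes hM h1 h2 hr

theorem isOpen_isGeneric : IsOpen {P | IsGeneric G v O a b P} := by
  simp only [F.isGeneric_iff]
  exact (isOpen_setOf_ne_intCast (continuous_crd O a)).inter
    ((isOpen_setOf_ne_intCast (continuous_crd O b)).inter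
      (isOpen_setOf_ne_intCast (f := fun P => 2 * crd O v P) ((continuous_crd O v).const_mul 2)))

theorem dense_isGeneric : Dense {P | IsGeneric G v O a b P} := by
  simp only [F.isGeneric_iff]
  have h1 := dense_setOf_ne_intCast (isOpenMap_crd O F.a_ne) one_ne_zero
  have h2 := dense_setOf_ne_intCast (isOpenMap_crd O F.b_ne) one_ne_zero
  simp only [one_mul] at h1 h2
  have h3 := dense_setOf_ne_intCast (isOpenMap_crd O F.v_ne) two_ne_zero
  exact h1.inter_of_isOpen_left (h2.inter_of_isOpen_left h3
    (isOpen_setOf_ne_intCast (continuous_crd O b))) (isOpen_setOf_ne_intCast (continuous_crd O a))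

/-! ### Colours of the orbit points -/

/-- Following the midpoint of a square reduces the action on rectangles to the action on labels.
This shows that the orbits of rectangles are the two chessboard colours. -/
theorem exists_image_overRectangle_iff {m n m' n' : ℤ} :
    (∃ g ∈ horizontalSubgroup G v, g '' overRectangle O a b m n = overRectangle O a b m' n') ↔
      Even (m + n + (m' + n')) := by
  have half : (1 / 2 : ℝ) ∈ Set.Ioo (0 : ℝ) 1 := by norm_num
  constructor
  · rintro ⟨g, hg, h⟩
    obtain ⟨x, hx, -⟩ := F.exists_hasLabel (1 / 2) (1 / 2) 0 m n
    obtain ⟨-, m₁, n₁, hl, hpar⟩ := F.exists_hasLabel_of_mem_orbit hx ⟨g, hg, rfl⟩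
    have hgx : g x ∈ overRectangle O a b m' n' := by
      rw [← h]
      refine ⟨x, ?_, rfl⟩
      rw [mem_overRectangle, hx.1, hx.2]
      exact ⟨gridPt_mem_Ioo half m, gridPt_mem_Ioo half n⟩
    rw [mem_overRectangle, hl.1, hl.2] at hgx
    rwa [int_eq_of_mem_Ioo hgx.1 (gridPt_mem_Ioo half _),
      int_eq_of_mem_Ioo hgx.2 (gridPt_mem_Ioo half _)]
  · intro h
    have image : ∀ g : Isom3, (∀ x, g x ∈ overRectangle O a b m' n' ↔ x ∈ overRectangle O a b m n) →
        g '' overRectangle O a b m n = overRectangle O a b m' n' := by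
      intro g hg
      ext y
      obtain ⟨x, rfl⟩ := g.surjective y
      rw [g.injective.mem_set_image, hg]
    by_cases hm : Even (m' - m)
    · have hn : Even (n' - n) := by
        rw [show m + n + (m' + n') = (m' - m) + (n' - n) + 2 * (m + n) by ring, Int.even_add,
          Int.even_add] at h
        exact (h.2 (even_two_mul _)).1 hm
      obtain ⟨g, hg, hr⟩ := F.exists_realizes_isP2 (M := ⟨false, 1, 1, 1, m' - m, n' - n, 0⟩)
        ⟨rfl, rfl, rfl, hm, hn, rfl⟩
      refine ⟨g, hg, image g fun x => ?_⟩
      rw [mem_overRectangle, mem_overRectangle, (hr x).1, (hr x).2.1]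
      simp only [act₁, act₂]
      push_cast
      constructor <;> rintro ⟨⟨h1, h2⟩, ⟨h3, h4⟩⟩ <;> simp at * <;>
        refine ⟨⟨?_, ?_⟩, ⟨?_, ?_⟩⟩ <;> linarith
    · have hm' : Even (m' + 1 + m) := by
        rw [show m' + 1 + m = (m' - m) + 1 + 2 * m by ring, Int.even_add, Int.even_add_one]
        simp [hm]
      have hn : Even (n' + 1 + n) := by
        rw [show m + n + (m' + n') = (m' + 1 + m) + (n' + 1 + n) + 2 * (-1) by ring, Int.even_add,
          Int.even_add] at h
        exact (h.2 (even_two_mul _)).1 hm'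
      obtain ⟨g, hg, hr⟩ := F.exists_realizes_isP2
        (M := ⟨false, -1, -1, 1, m' + 1 + m, n' + 1 + n, 0⟩) ⟨rfl, rfl, rfl, hm', hn, rfl⟩
      refine ⟨g, hg, image g fun x => ?_⟩
      rw [mem_overRectangle, mem_overRectangle, (hr x).1, (hr x).2.1]
      simp only [act₁, act₂]
      push_cast
      constructor <;> rintro ⟨⟨h1, h2⟩, ⟨h3, h4⟩⟩ <;> simp at * <;>
        refine ⟨⟨?_, ?_⟩, ⟨?_, ?_⟩⟩ <;> linarith

theorem isWhite_iff {P Q : E3} {m n m' n' : ℤ} (hP : P ∈ overRectangle O a b m n)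
    (hQ : Q ∈ overRectangle O a b m' n') :
    IsWhite (horizontalSubgroup G v) O a b P Q ↔ Even (m + n + (m' + n')) := by
  rw [← F.exists_image_overRectangle_iff]
  refine ⟨?_, fun h => ⟨m, n, m', n', hP, hQ, h⟩⟩
  rintro ⟨m₁, n₁, m₁', n₁', hP', hQ', h⟩
  rw [mem_overRectangle] at hP hP' hQ hQ'
  rwa [int_eq_of_mem_Ioo hP.1 hP'.1, int_eq_of_mem_Ioo hP.2 hP'.2, int_eq_of_mem_Ioo hQ.1 hQ'.1,
    int_eq_of_mem_Ioo hQ.2 hQ'.2]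

theorem isBlack_iff {P Q : E3} {m n m' n' : ℤ} (hP : P ∈ overRectangle O a b m n)
    (hQ : Q ∈ overRectangle O a b m' n') :
    IsBlack (horizontalSubgroup G v) O a b P Q ↔ ¬Even (m + n + (m' + n')) := by
  rw [← F.exists_image_overRectangle_iff]
  constructor
  · rintro ⟨m₁, n₁, m₁', n₁', hP', hQ', h⟩
    rw [mem_overRectangle] at hP hP' hQ hQ'
    rw [int_eq_of_mem_Ioo hP.1 hP'.1, int_eq_of_mem_Ioo hP.2 hP'.2, int_eq_of_mem_Ioo hQ.1 hQ'.1,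
      int_eq_of_mem_Ioo hQ.2 hQ'.2]
    rintro ⟨g, hg, hg'⟩
    exact h g hg hg'
  · intro h
    exact ⟨m, n, m', n', hP, hQ, fun g hg hg' => h ⟨g, hg, hg'⟩⟩

theorem colour_of_mem_layer {e : ℤˣ} {k : ℤ} {P Q : E3} {m n : ℤ}
    (hP : P ∈ overRectangle O a b m n) (hQ : Q ∈ layer G O a b v D e k P) :
    (IsWhite (horizontalSubgroup G v) O a b P Q ↔ (D e k).colour = 0) ∧
      (IsBlack (horizontalSubgroup G v) O a b P Q ↔ (D e k).colour = 1) := by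
  have hP' := mem_overRectangle.1 hP
  obtain ⟨p, hp, hp'⟩ := exists_gridPt_of_mem_Ioo hP'.1
  obtain ⟨q, hq, hq'⟩ := exists_gridPt_of_mem_Ioo hP'.2
  obtain ⟨-, m', n', hl, hpar⟩ := exists_hasLabel_of_mem_layer ⟨hp', hq'⟩ hQ
  have hQ' : Q ∈ overRectangle O a b m' n' := by
    rw [mem_overRectangle, hl.1, hl.2]
    exact ⟨gridPt_mem_Ioo (fold_mem_Ioo.2 (by split_ifs <;> assumption)) _,
      gridPt_mem_Ioo (fold_mem_Ioo.2 (by split_ifs <;> assumption)) _⟩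
  rw [F.isWhite_iff hP hQ', F.isBlack_iff hP hQ', ← ZMod.intCast_eq_zero_iff_even,
    Int.cast_add (m + n), hpar]
  generalize ((m + n : ℤ) : ZMod 2) = s
  generalize (D e k).colour = c
  revert s c
  decide

/-! ### The planes of the orbit -/

theorem mem_horizontalPlane {Q x : E3} : x ∈ horizontalPlane v Q ↔ crd O v x = crd O v Q := by
  rw [horizontalPlane, AffineSubspace.mem_mk', Submodule.mem_orthogonal_singleton_iff_inner_left,
    vsub_eq_sub, inner_sub_left, sub_eq_zero, inner_eq_inner_iff_crd F.v_ne O]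

theorem horizontalPlane_eq_iff {Q R : E3} :
    horizontalPlane v Q = horizontalPlane v R ↔ crd O v Q = crd O v R := by
  constructor
  · intro h
    rw [← F.mem_horizontalPlane, ← h, F.mem_horizontalPlane]
  · intro h
    ext x
    rw [F.mem_horizontalPlane, F.mem_horizontalPlane, h]

theorem mem_band {P x : E3} : x ∈ band v P ↔ |crd O v x - crd O v P| ≤ 2 := by
  have hv : 0 < ‖v‖ ^ 2 := by have := norm_pos_iff.2 F.v_ne; positivity
  rw [band, Set.mem_ofPred_eq, inner_sub_eq_crd F.v_ne O, abs_div, abs_mul, abs_of_pos hv, abs_two]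
  constructor
  · intro h
    by_contra hcon
    nlinarith
  · intro h
    nlinarith

theorem crd_add_v (P : E3) : crd O v (P + v) = crd O v P + 2 := by
  have := crd_zero_self F.v_ne 1
  rw [one_smul] at this
  rw [add_comm P, crd_vadd, this]
  ring

theorem crd_sub_v (P : E3) : crd O v (P - v) = crd O v P - 2 := by
  have := F.crd_add_v (P - v)
  rw [sub_add_cancel] at this
  linarith

/-- The boundary planes are at relative height `±2`, so excluding them makes the band condition
strict, and orbit planes become indexed by `levels`. The function `f` only picks a point at each
height. -/
theorem orbitPlanes_eq {P : E3} (hz : ∀ k : ℤ, 2 * crd O v P ≠ k) {f : ℝ → E3}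
    (hf : ∀ z, crd O v (f z) = z) : orbitPlanes G v P =
      (fun i : ℤˣ × ℤ => horizontalPlane v (f (((i.1 : ℤ) : ℝ) * crd O v P + i.2))) ''
        levels (crd O v P) := by
  ext α
  constructor
  · rintro ⟨⟨_, ⟨g, hg, rfl⟩, rfl⟩, hb, h0, h1, h2⟩
    obtain ⟨M, hM, hr⟩ := F.mem g hg
    have hb' := F.mem_band.1 (hb (F.mem_horizontalPlane.2 rfl : g P ∈ horizontalPlane v (g P)))
    rw [Ne, F.horizontalPlane_eq_iff] at h0 h1 h2
    rw [F.crd_add_v] at h1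
    rw [F.crd_sub_v] at h2
    refine ⟨(M.e₃, M.k₃), ?_, ?_⟩
    · rw [Finset.mem_coe, mem_levels_iff hz]
      rw [(hr P).2.2, act₃] at *
      refine ⟨h0, lt_of_le_of_ne hb' fun h => ?_⟩
      rcases (abs_eq zero_le_two).1 h with h | h
      · exact h1 (by linarith)
      · exact h2 (by linarith)
    · dsimp only
      rw [F.horizontalPlane_eq_iff, hf, (hr P).2.2, act₃]
  · rintro ⟨⟨e, k⟩, hi, rfl⟩
    rw [Finset.mem_coe, mem_levels_iff hz] at hi
    obtain ⟨h0, h1⟩ := hi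
    obtain ⟨_, g, hg, M, hM, hr, rfl, rfl, rfl⟩ := F.nonempty_layer e k P
    dsimp only at *
    rw [abs_lt] at h1
    refine ⟨⟨g P, ⟨g, hg, rfl⟩, ?_⟩, fun x hx => ?_, ?_, ?_, ?_⟩
    · rw [F.horizontalPlane_eq_iff, hf, (hr P).2.2, act₃]
    · rw [SetLike.mem_coe, F.mem_horizontalPlane, hf] at hx
      rw [F.mem_band, hx, abs_le]
      constructor <;> linarith
    · rwa [Ne, F.horizontalPlane_eq_iff, hf]
    · rw [Ne, F.horizontalPlane_eq_iff, hf, F.crd_add_v]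
      exact fun h => by linarith
    · rw [Ne, F.horizontalPlane_eq_iff, hf, F.crd_sub_v]
      exact fun h => by linarith

theorem mem_layer_of_crd {P Q : E3} (hz : ∀ k : ℤ, 2 * crd O v P ≠ k) {e : ℤˣ} {k : ℤ}
    (hQ : Q ∈ orbit G P) (h : crd O v Q = ((e : ℤ) : ℝ) * crd O v P + k) :
    Q ∈ layer G O a b v D e k P := by
  obtain ⟨g, hg, rfl⟩ := hQ
  obtain ⟨M, hM, hr⟩ := F.mem g hg
  rw [(hr P).2.2, act₃] at h
  obtain ⟨h1, h2⟩ := level_injective hz h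
  exact ⟨g, hg, M, hM, hr, h1, h2, rfl⟩

/-- Two motions with the same vertical part differ by a motion whose vertical part is the identity,
that is, a horizontal one. -/
theorem layer_subset_orbit {P Q R : E3} {e : ℤˣ} {k : ℤ} (hQ : Q ∈ layer G O a b v D e k P)
    (hR : R ∈ layer G O a b v D e k P) : R ∈ orbit (horizontalSubgroup G v) Q := by
  obtain ⟨g, hg, M, hM, hr, rfl, rfl, rfl⟩ := hQ
  obtain ⟨h, hh, N, hN, hs, h1, h2, rfl⟩ := hR
  refine ⟨h * g⁻¹, F.mem_horizontal_of_realizes (hN.comp F.compat (hM.inverse F.compat)) ?_ ?_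
    (hs.comp hr.inverse), ?_⟩
  · simp [GridMotion.comp, GridMotion.inverse, h1]
  · rcases Int.units_eq_one_or M.e₃ with h3 | h3 <;>
      simp [GridMotion.comp, GridMotion.inverse, h1, h2, h3]
  · have : g⁻¹ (g P) = P := g.symm_apply_apply P
    rw [AffineIsometryEquiv.coe_mul, Function.comp_apply, this]

theorem orbitPlanes_colours {P : E3} (hP : IsGeneric G v O a b P) :
    (orbitPlanes G v P).encard = 6 ∧
    (∀ α ∈ orbitPlanes G v P, ∃ Q : E3,
      orbit G P ∩ (α : Set E3) = orbit (horizontalSubgroup G v) Q) ∧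
    {α ∈ orbitPlanes G v P | ∀ Q ∈ orbit G P, Q ∈ α →
      IsBlack (horizontalSubgroup G v) O a b P Q}.encard = 4 ∧
    {α ∈ orbitPlanes G v P | ∀ Q ∈ orbit G P, Q ∈ α →
      IsWhite (horizontalSubgroup G v) O a b P Q}.encard = 2 := by
  obtain ⟨m, n, hmn⟩ := hP.1
  have hz := (F.isGeneric_iff.1 hP).2.2
  choose f hf using fun z => (F.exists_point 0 0 z).imp fun p hp => hp.2.2
  set z := crd O v P with hzP
  set pl : ℤˣ × ℤ → AffineSubspace ℝ E3 :=
    fun i => horizontalPlane v (f (((i.1 : ℤ) : ℝ) * z + i.2)) with hpl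
  have hinj : Function.Injective pl := by
    rintro ⟨e, k⟩ ⟨e', k'⟩ h
    simp only [hpl, F.horizontalPlane_eq_iff, hf] at h
    obtain ⟨rfl, rfl⟩ := level_injective hz h
    rfl
  have hlay : ∀ i : ℤˣ × ℤ, ∀ Q ∈ orbit G P, Q ∈ pl i ↔ Q ∈ layer G O a b v D i.1 i.2 P := by
    intro i Q hQ
    rw [F.mem_horizontalPlane, hf]
    refine ⟨F.mem_layer_of_crd hz hQ, ?_⟩
    rintro ⟨g, -, M, -, hr, h1, h2, rfl⟩
    rw [(hr P).2.2, act₃, h1, h2]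
  have hlayG : ∀ i : ℤˣ × ℤ, ∀ Q ∈ layer G O a b v D i.1 i.2 P, Q ∈ orbit G P := by
    rintro i _ ⟨g, hg, -, -, -, -, -, rfl⟩
    exact ⟨g, hg, rfl⟩
  rw [F.orbitPlanes_eq hz hf]
  -- A property of planes that holds exactly on the layers of one colour is counted by applying
  -- `sum_levels` to an indicator function.
  have count : ∀ (c : ZMod 2) (p : AffineSubspace ℝ E3 → Prop),
      (∀ i, p (pl i) ↔ (D i.1 i.2).colour = c) →
      {α ∈ pl '' levels z | p α}.encard =
        ((4 * (if 1 = c then 1 else 0) + 2 * (if 0 = c then 1 else 0) : ℕ) : ℕ∞) := by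
    intro c p hp
    have h1 : {α ∈ pl '' levels z | p α} =
        pl '' ((levels z).filter fun i => (D i.1 i.2).colour = c : Finset (ℤˣ × ℤ)) := by
      ext α
      constructor
      · rintro ⟨⟨i, hi, rfl⟩, h⟩
        exact ⟨i, by rw [Finset.mem_coe, Finset.mem_filter]; exact ⟨hi, (hp i).1 h⟩, rfl⟩
      · rintro ⟨i, hi, rfl⟩
        rw [Finset.mem_coe, Finset.mem_filter] at hi
        exact ⟨⟨i, hi.1, rfl⟩, (hp i).2 hi.2⟩
    rw [h1, hinj.encard_image, Set.encard_coe_eq_coe_finsetCard, Finset.card_filter,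
      F.sum_levels z fun d => if d = c then 1 else 0]
  refine ⟨?_, ?_, ?_, ?_⟩
  · rw [hinj.encard_image, Set.encard_coe_eq_coe_finsetCard, Finset.card_eq_sum_ones,
      F.sum_levels z fun _ => 1]
    norm_num
  · rintro _ ⟨i, -, rfl⟩
    obtain ⟨Q, hQ⟩ := F.nonempty_layer i.1 i.2 P
    refine ⟨Q, ?_⟩
    ext R
    constructor
    · rintro ⟨hR, hR'⟩
      exact F.layer_subset_orbit hQ ((hlay i R hR).1 hR')
    · intro hR
      have hRG := orbit_horizontal_subset (hlayG i Q hQ) hR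
      refine ⟨hRG, ?_⟩
      have h1 := (hlay i Q (hlayG i Q hQ)).2 hQ
      obtain ⟨g, hg, rfl⟩ := hR
      rw [SetLike.mem_coe, F.mem_horizontalPlane] at *
      rw [(F.mem_horizontal_iff.1 hg).2, h1]
  · refine (count 1 _ fun i => ?_).trans (by norm_num)
    constructor
    · intro h
      obtain ⟨Q, hQ⟩ := F.nonempty_layer i.1 i.2 P
      have hQG := hlayG i Q hQ
      exact (F.colour_of_mem_layer hmn hQ).2.1 (h Q hQG ((hlay i Q hQG).2 hQ))
    · intro h Q hQ hQi
      exact (F.colour_of_mem_layer hmn ((hlay i Q hQ).1 hQi)).2.2 h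
  · refine (count 0 _ fun i => ?_).trans (by norm_num)
    constructor
    · intro h
      obtain ⟨Q, hQ⟩ := F.nonempty_layer i.1 i.2 P
      have hQG := hlayG i Q hQ
      exact (F.colour_of_mem_layer hmn hQ).1.1 (h Q hQG ((hlay i Q hQG).2 hQ))
    · intro h Q hQ hQi
      exact (F.colour_of_mem_layer hmn ((hlay i Q hQ).1 hQi)).1.2 h

end

end IsGridFrame

end Stereohedra

end

theorem mainTheorem9 (t : Stereohedra.GroupType) (φ : Stereohedra.E3 ≃ᵃ[ℝ] Stereohedra.E3)
    (G : Subgroup Stereohedra.Isom3) (hG : Stereohedra.IsOfType G t φ)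
    (v : Stereohedra.E3) (hv : v = Stereohedra.verticalVector φ)
    (G₀ : Subgroup Stereohedra.Isom3) (hG₀ : G₀ = Stereohedra.horizontalSubgroup G v) :
    Stereohedra.aspects G = 8 ∧
    Stereohedra.IsShortestTranslation G v ∧
    (∃ O a b : Stereohedra.E3,
      Stereohedra.IsRectangularP2 G₀ v O a b ∧
      -- reflections in the vertical planes through the grid lines normalize `G`
      (∀ m : ℤ,
        Stereohedra.planeReflection (O + ((m : ℝ) / 2) • a) a ∈
            Subgroup.normalizer (G : Set Stereohedra.Isom3) ∧
        Stereohedra.planeReflection (O + ((m : ℝ) / 2) • b) b ∈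
            Subgroup.normalizer (G : Set Stereohedra.Isom3)) ∧
      -- generic points form an open dense set
      IsOpen {P | Stereohedra.IsGeneric G v O a b P} ∧
      Dense {P | Stereohedra.IsGeneric G v O a b P} ∧
      -- six planes of a generic orbit in the band, four black and two white
      (∀ P : Stereohedra.E3, Stereohedra.IsGeneric G v O a b P →
        (Stereohedra.orbitPlanes G v P).encard = 6 ∧
        (∀ α ∈ Stereohedra.orbitPlanes G v P, ∃ Q : Stereohedra.E3,
          Stereohedra.orbit G P ∩ (α : Set Stereohedra.E3) = Stereohedra.orbit G₀ Q) ∧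
        {α ∈ Stereohedra.orbitPlanes G v P | ∀ Q ∈ Stereohedra.orbit G P, Q ∈ α →
          Stereohedra.IsBlack G₀ O a b P Q}.encard = 4 ∧
        {α ∈ Stereohedra.orbitPlanes G v P | ∀ Q ∈ Stereohedra.orbit G P, Q ∈ α →
          Stereohedra.IsWhite G₀ O a b P Q}.encard = 2)) ∧
    -- every Dirichlet stereohedron has at most 38 facets
    (∀ P : Stereohedra.E3,
      (Stereohedra.facets (Stereohedra.dirichletStereohedron G P)).encard ≤ 38) := by
  subst hv hG₀
  obtain ⟨O, a, b, F⟩ := hG.exists_isGridFrame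
  exact ⟨F.aspects_eq, F.isShortestTranslation,
    ⟨O, a, b, F.isRectangularP2, F.planeReflection_mem_normalizer, F.isOpen_isGeneric,
      F.dense_isGeneric, fun P hP => F.orbitPlanes_colours hP⟩,
    F.encard_facets_dirichletStereohedron_le⟩
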